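/- Let $G=(V,E)$ be a finite undirected graph with $n=|V|$ vertices and $m=|E|\ge 1$ edges, and let each edge $e$ fail independently with probability $p_e\in[0,1)$; put $p_{\max}=\max_e p_e$. For $S\subseteq E$ let $\mathrm{wt}(S)=\prod_{e\in S}(1-p_e)\prod_{e\in E\setminus S}p_e$, and let $Z_{\mathrm{rel}}(G;\mathbf p)=\sum_{S\subseteq E,\ (V,S)\text{ connected}}\mathrm{wt}(S)$ be the probability that the surviving graph is connected. For a directed graph $G=(V,A)$ with root $r$ and arc failure probabilities $\mathbf p$, let $Z_{\mathrm{reach}}(G,r;\mathbf p)$ be the probability that, after independent failures of the arcs, every vertex still has a directed path to $r$. A directed graph is bi-directed if every arc has an anti-parallel twin with the same failure probability. Running time is the number of steps of a randomized random access machine (unit cost for additions, subtractions, comparisons, memory accesses and for tossing a coin of given bias). (1) There are a randomized algorithm and a constant $C$ such that, for every undirected $(G,\mathbf p)$ as above and every $0<\varepsilon\le 1$, the algorithm outputs with probability at least $3/4$ a number $\widetilde Z$ with $|\widetilde Z-Z_{\mathrm{rel}}(G;\mathbf p)|\le\varepsilon Z_{\mathrm{rel}}(G;\mathbf p)$, and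 its expected running time is at most $C\,\varepsilon^{-2}(1-p_{\max})^{-3}m^2n^3$. (2) The same holds for $Z_{\mathrm{reach}}(G,r;\mathbf p)$ on bi-directed graphs $G$ with $n$ vertices, $m\ge1$ arcs and any root $r$. (3) The two problems are equivalent: $Z_{\mathrm{rel}}(G;\mathbf p)=Z_{\mathrm{reach}}(\overrightarrow G,r;\mathbf p')$ for every undirected $G$ and every vertex $r$, where $(\overrightarrow G,\mathbf p')$ is obtained by replacing each edge by two anti-parallel arcs with the failure probability of that edge. (4) There are a randomized algorithm and a constant $C$ such that, for every connected undirected $(G,\mathbf p)$ as above, the algorithm outputs a random set $S\subseteq E$ distributed exactly as the surviving edge set conditioned on connectedness, i.e. $\Pr[S]=\mathrm{wt}(S)/Z_{\mathrm{rel}}(G;\mathbf p)$ if $(V,S)$ is connected and $\Pr[S]=0$ otherwise, and its expected running time is at most $C\,(1-p_{\max})^{-1}m^2n$. -/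

import Mathlib

open scoped ENNReal

namespace NetRel

/-! ### Networks -/

/-- A finite multigraph with vertex set `V` and edge set `E` (parallel edges and loops are allowed),
together with a failure probability for each edge.  Read as an undirected graph, `e` is an edge
joining `fst e` and `snd e`; read as a directed graph, `e` is an arc from `fst e` to `snd e`. -/
structure Network (V E : Type) where
  fst : E → V
  snd : E → V
  fail : E → ℝ

namespace Network

variable {V E : Type}

/-- There is a surviving arc from `u` to `v`, when `S` is the set of surviving arcs. -/
def Arc (G : Network V E) (S : Finset E) (u v : V) : Prop :=
  ∃ e ∈ S, G.fst e = u ∧ G.snd e = v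

/-- The undirected graph `(V, S)` is connected. -/
def IsConnected (G : Network V E) (S : Finset E) : Prop :=
  (SimpleGraph.fromRel (G.Arc S)).Connected

/-- The directed graph `(V, S)` is root-connected: every vertex has a directed path to `r`. -/
def IsRootConnected (G : Network V E) (r : V) (S : Finset E) : Prop :=
  ∀ v, Relation.ReflTransGen (G.Arc S) v r

open Classical in
/-- The probability that `S` is exactly the set of surviving edges. -/
noncomputable def wt [Fintype E] (G : Network V E) (S : Finset E) : ℝ :=
  (∏ e ∈ S, (1 - G.fail e)) * ∏ e ∈ Sᶜ, G.fail e

open Classical in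
/-- All-terminal reliability: the probability that the surviving undirected graph is connected. -/
noncomputable def rel [Fintype E] (G : Network V E) : ℝ :=
  ∑ S : Finset E with G.IsConnected S, G.wt S

open Classical in
/-- Reachability: the probability that the surviving directed graph is root-connected. -/
noncomputable def reach [Fintype E] (G : Network V E) (r : V) : ℝ :=
  ∑ S : Finset E with G.IsRootConnected r S, G.wt S

/-- Every arc has an anti-parallel twin with the same failure probability. -/
def IsBidirected (G : Network V E) : Prop :=
  ∃ τ : E → E, Function.Involutive τ ∧
    ∀ e, G.fst (τ e) = G.snd e ∧ G.snd (τ e) = G.fst e ∧ G.fail (τ e) = G.fail e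

/-- Replace every undirected edge by a pair of anti-parallel arcs with the same failure
probability. -/
def toBidirected (G : Network V E) : Network V (E × Bool) where
  fst a := if a.2 then G.snd a.1 else G.fst a.1
  snd a := if a.2 then G.fst a.1 else G.snd a.1
  fail a := G.fail a.1

/-- The maximum failure probability (used for a nonempty finite edge set). -/
noncomputable def pmax (G : Network V E) : ℝ := ⨆ e, G.fail e

end Network

/-! ### The machine model

A randomized random access machine.  Its memory consists of arrays of natural numbers and arrays of
real numbers; a program mentions finitely many of them (a register is cell `0` of an array).
The operations are addition, subtraction and comparison, plus tossing a coin of given bias.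
There is no multiplication, division or rounding, and every elementary statement costs one step.
Expressions and tests have a size that is fixed by the program, so their evaluation is part of the
constant cost of a statement.  As only additive operations are available, for rational data the
numbers that arise in `t` steps have bit length polynomial in `t` and the length of the input. -/

/-- Memory: `nat a i` and `real a i` are the contents of cell `i` of array `a`. -/
structure State where
  nat : ℕ → ℕ → ℕ
  real : ℕ → ℕ → ℝ

/-- Expressions over the natural numbers (subtraction is truncated). -/
inductive NatExp
  | lit (k : ℕ)
  | get (a : ℕ) (i : NatExp)
  | add (x y : NatExp)
  | sub (x y : NatExp)

/-- Expressions over the real numbers. -/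
inductive RealExp
  | lit (k : ℕ)
  | get (a : ℕ) (i : NatExp)
  | add (x y : RealExp)
  | sub (x y : RealExp)

/-- Tests. -/
inductive Test
  | natEq (x y : NatExp)
  | natLt (x y : NatExp)
  | realLt (x y : RealExp)
  | neg (b : Test)
  | conj (b c : Test)

/-- Programs. -/
inductive Prog
  | skip
  | setNat (a : ℕ) (i : NatExp) (x : NatExp)
  | setReal (a : ℕ) (i : NatExp) (x : RealExp)
  /-- Write into cell `i` of the integer array `a` the value `1` with probability `p`, else `0`. -/
  | toss (a : ℕ) (i : NatExp) (p : RealExp)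
  | seq (P Q : Prog)
  | ite (b : Test) (P Q : Prog)
  | loop (b : Test) (P : Prog)

def NatExp.eval (σ : State) : NatExp → ℕ
  | .lit k => k
  | .get a i => σ.nat a (i.eval σ)
  | .add x y => x.eval σ + y.eval σ
  | .sub x y => x.eval σ - y.eval σ

def RealExp.eval (σ : State) : RealExp → ℝ
  | .lit k => (k : ℝ)
  | .get a i => σ.real a (i.eval σ)
  | .add x y => x.eval σ + y.eval σ
  | .sub x y => x.eval σ - y.eval σ

def Test.Holds (σ : State) : Test → Prop
  | .natEq x y => x.eval σ = y.eval σ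
  | .natLt x y => x.eval σ < y.eval σ
  | .realLt x y => x.eval σ < y.eval σ
  | .neg b => ¬ b.Holds σ
  | .conj b c => b.Holds σ ∧ c.Holds σ

/-- Write `v` into cell `i` of the integer array `a`. -/
def State.writeNat (σ : State) (a i v : ℕ) : State :=
  { σ with nat := Function.update σ.nat a (Function.update (σ.nat a) i v) }

/-- Write `v` into cell `i` of the real array `a`. -/
noncomputable def State.writeReal (σ : State) (a i : ℕ) (v : ℝ) : State :=
  { σ with real := Function.update σ.real a (Function.update (σ.real a) i v) }

set_option linter.deprecated false in
/-- A coin showing `true` with probability `p` (clamped to `[0, 1]`). -/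
noncomputable def coin (p : ℝ) : PMF Bool :=
  PMF.bernoulli (min p.toNNReal 1) (min_le_right _ _)

/-- A configuration: the statements still to be executed, and the memory.
The machine has halted when nothing is left to be executed. -/
abbrev Config : Type := List Prog × State

open Classical in
/-- One step of the machine. -/
noncomputable def step : Config → PMF Config
  | ([], σ) => PMF.pure ([], σ)
  | (.skip :: K, σ) => PMF.pure (K, σ)
  | (.setNat a i x :: K, σ) => PMF.pure (K, σ.writeNat a (i.eval σ) (x.eval σ))
  | (.setReal a i x :: K, σ) => PMF.pure (K, σ.writeReal a (i.eval σ) (x.eval σ))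
  | (.toss a i p :: K, σ) =>
      (coin (p.eval σ)).map fun b => (K, σ.writeNat a (i.eval σ) (if b then 1 else 0))
  | (.seq P Q :: K, σ) => PMF.pure (P :: Q :: K, σ)
  | (.ite b P Q :: K, σ) => PMF.pure (if b.Holds σ then P :: K else Q :: K, σ)
  | (.loop b P :: K, σ) => PMF.pure (if b.Holds σ then P :: .loop b P :: K else K, σ)

/-- The distribution of the configuration after `k` steps from configuration `c`. -/
noncomputable def runFor : ℕ → Config → PMF Config
  | 0, c => PMF.pure c
  | k + 1, c => (step c).bind (runFor k)

/-- The expected running time `∑ₖ ℙ(not halted after k steps)` of `P` on initial memory `σ`. -/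
noncomputable def expectedTime (P : Prog) (σ : State) : ℝ≥0∞ :=
  ∑' k, (runFor k ([P], σ)).toOuterMeasure {c | c.1 ≠ []}

/-- The probability that `P`, started on memory `σ`, halts with its memory in the set `A`. -/
noncomputable def haltProb (P : Prog) (σ : State) (A : Set State) : ℝ≥0∞ :=
  ⨆ k, (runFor k ([P], σ)).toOuterMeasure {c | c.1 = [] ∧ c.2 ∈ A}

/-! ### Input and output -/

/-- The initial memory: integer array `0` holds `n`, `m` and the number `r` of a vertex (the root,
when there is one), integer arrays `1` and `2` hold the list of the ends of the edges,
real array `0` holds the precision `ε` and real array `1` the failure probabilities.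
All other cells are `0`. -/
noncomputable def input {n m : ℕ} (G : Network (Fin n) (Fin m)) (r : ℕ) (ε : ℝ) : State where
  nat a i :=
    if a = 0 then (if i = 0 then n else if i = 1 then m else if i = 2 then r else 0)
    else if h : i < m then
      (if a = 1 then (G.fst ⟨i, h⟩ : ℕ) else if a = 2 then (G.snd ⟨i, h⟩ : ℕ) else 0)
    else 0
  real a i :=
    if a = 0 then (if i = 0 then ε else 0)
    else if h : i < m then (if a = 1 then G.fail ⟨i, h⟩ else 0)
    else 0

/-- The final memories whose output, the fraction of cells `0` and `1` of integer array `3`, is a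
`(1 ± ε)`-approximation of `Z`. -/
def approximates (Z ε : ℝ) : Set State :=
  {σ | σ.nat 3 1 ≠ 0 ∧ |(σ.nat 3 0 : ℝ) / (σ.nat 3 1 : ℝ) - Z| ≤ ε * Z}

/-- The set of edges that is output in integer array `3`, as an indicator vector. -/
def outputSet (m : ℕ) (σ : State) : Finset (Fin m) :=
  Finset.univ.filter fun e => σ.nat 3 e = 1

end NetRel

/-!
# Network reliability by cluster popping

The surviving arcs of a directed network are sampled conditioned on root-connectedness by *cluster
popping*: draw all arcs, and as long as there is a minimal cluster, that is, a minimal nonempty set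
of vertices without roots that no surviving arc leaves, choose one and redraw the arcs that start
in it. There is no cluster exactly if every vertex has a path to a root (`Network.rootConn_iff`).

*Exactness.* Whether `C` is a minimal cluster depends only on the arcs that start in `C`, and
distinct minimal clusters are disjoint, so it does not matter which one is popped first
(`Network.popVal_eq`). Inclusion-exclusion over the present minimal clusters gives a linear
recursion for the law of the outcome after exactly `t` pops
(`Network.sum_signedProb_mul_popMean`). Since the final set enters it only through the
inhomogeneous term, the number of pops is independent of the outcome, and the outcome has the
conditional law (`Network.popMean_mul_rootProb`).

*Running time.* Summing the same recursion, the expected number of pops is the probability of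
exactly one minimal cluster divided by the probability of none
(`Network.sum_one_sub_doneProb_le`). In a bi-directed network with `n` vertices, `M` arcs and
failure probabilities at most `q`, this ratio is at most `n M / (1 - q)`: choose an arc that leaves
the set of vertices without a path to the roots, add it, and reverse all arcs in the part of the
network that is reachable from its tail; a vertex of the cluster and the arc allow to undo this
(`Network.exists_encoding`, `Network.IsBidirected.oneProb_le`). A pop takes linear time, as
a minimal cluster is found by two graph searches (`hoare_find`), so that a sample costs
`O(M² n / (1 - q))` steps (`spec_sample`, `sample_cost_le`).

*Undirected networks.* Replace every edge by two anti-parallel arcs. Given the surviving arcs,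
orient each edge towards the root according to the distances to the root, and keep the edges whose
orientation survives. Root-connected arcs yield a connected set of edges, and the root-connected
sets of arcs that yield a given connected set of edges have together the probability of the latter,
as only one direction of each edge matters (`Network.sum_wt_project`, `Network.rel_eq_reach`).
Hence the two probabilities agree, and a sample of arcs turns into a sample of edges
(`sampleConnected_spec`).

*Counting.* Rank the vertices such that each of them, except for the root, has an arc to one of
smaller rank, and let `R k` be the set of the first `k` vertices. The probability of paths to the
root is the product of the probabilities of paths to `R k`, given paths to `R (k + 1)`. These are at
least the survival probability of a single arc (`exists_le_ratio`), and hence can be estimated from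
`O(n ε⁻² / (1 - q))` samples each, by Chebyshev's inequality for the product
(`three_quarters_le_near`, `count_spec`).

Programs are analyzed by weakest preexpectations: `wp τ P f σ` is the expectation of `f` at the end
plus `τ` times the expected number of steps. `Hoare` describes runs without coin tosses, and
`Spec` random runs that realize a given distribution in a given expected time. The number of
iterations of popping is random, and `spec_popping` transfers the two results on popping to
programs.
-/

open scoped ENNReal

set_option linter.unusedSectionVars false

namespace NetRel

/-- The expectation of a nonnegative function under a discrete distribution. -/
noncomputable def ev {α : Type*} (D : PMF α) (g : α → ℝ≥0∞) : ℝ≥0∞ := ∑' a, D a * g a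

section Expectation

variable {α β : Type*}

lemma ev_pure (a : α) (g : α → ℝ≥0∞) : ev (PMF.pure a) g = g a := by
  unfold ev
  rw [tsum_eq_single a]
  · simp
  · intro b hb; simp [PMF.pure_apply, hb]

lemma ev_bind (D : PMF α) (f : α → PMF β) (g : β → ℝ≥0∞) :
    ev (D.bind f) g = ev D fun a => ev (f a) g := by
  unfold ev
  simp only [PMF.bind_apply, ← ENNReal.tsum_mul_right, ← ENNReal.tsum_mul_left]
  rw [ENNReal.tsum_comm]
  simp only [mul_assoc]

lemma ev_map (D : PMF α) (h : α → β) (g : β → ℝ≥0∞) : ev (D.map h) g = ev D (g ∘ h) := by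
  rw [← PMF.bind_pure_comp, ev_bind]
  simp only [Function.comp_def, ev_pure]

lemma ev_mono (D : PMF α) {f g : α → ℝ≥0∞} (h : ∀ a, f a ≤ g a) : ev D f ≤ ev D g :=
  ENNReal.tsum_le_tsum fun a => mul_le_mul_right (h a) _

lemma ev_add (D : PMF α) (f g : α → ℝ≥0∞) : ev D (fun a => f a + g a) = ev D f + ev D g := by
  unfold ev
  simp only [mul_add]
  exact ENNReal.tsum_add

lemma ev_const_mul (D : PMF α) (c : ℝ≥0∞) (f : α → ℝ≥0∞) :
    ev D (fun a => c * f a) = c * ev D f := by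
  unfold ev
  rw [← ENNReal.tsum_mul_left]
  exact tsum_congr fun a => by ring

lemma ev_const (D : PMF α) (c : ℝ≥0∞) : ev D (fun _ => c) = c := by
  unfold ev
  rw [ENNReal.tsum_mul_right, D.tsum_coe, one_mul]

lemma ev_iSup (D : PMF α) (f : ℕ → α → ℝ≥0∞) (hf : Monotone f) :
    ev D (fun a => ⨆ k, f k a) = ⨆ k, ev D (f k) := by
  let _ : MeasurableSpace α := ⊤
  have : MeasurableSingletonClass α := ⟨fun _ => trivial⟩
  unfold ev
  simp only [← MeasureTheory.lintegral_count, ENNReal.mul_iSup]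
  rw [MeasureTheory.lintegral_iSup (fun _ => measurable_from_top)]
  intro i j hij a
  exact mul_le_mul_right (hf hij a) _

lemma ev_eq_sum [Fintype α] (D : PMF α) (g : α → ℝ≥0∞) : ev D g = ∑ a, D a * g a :=
  tsum_fintype _

open Classical in
lemma toOuterMeasure_eq_ev (D : PMF α) (A : Set α) :
    D.toOuterMeasure A = ev D (fun a => if a ∈ A then 1 else 0) := by
  rw [PMF.toOuterMeasure_apply]
  refine tsum_congr fun a => ?_
  by_cases h : a ∈ A <;> simp [h]

end Expectation

/-! ### Valuation of configurations -/

/-- The expected payoff of the first `k` steps from a configuration, where every step pays `τ` and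
halting in memory `σ` pays `f σ`. -/
noncomputable def val (τ : ℝ≥0∞) (f : State → ℝ≥0∞) : ℕ → Config → ℝ≥0∞
  | _, ([], σ) => f σ
  | 0, (_ :: _, _) => 0
  | k + 1, (P :: K, σ) => τ + ev (step (P :: K, σ)) (val τ f k)

/-- The expected total payoff from a configuration. For `τ = 0` this is the expectation of `f` at
the end (where not halting counts as `0`); for `τ = 1` the expected number of steps is added. -/
noncomputable def valC (τ : ℝ≥0∞) (f : State → ℝ≥0∞) (c : Config) : ℝ≥0∞ := ⨆ k, val τ f k c

section Valuation

variable (τ : ℝ≥0∞) (f : State → ℝ≥0∞)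

@[simp] lemma val_nil (k : ℕ) (σ : State) : val τ f k ([], σ) = f σ := by cases k <;> rfl

lemma val_mono_succ (k : ℕ) (c : Config) : val τ f k c ≤ val τ f (k + 1) c := by
  induction k generalizing c with
  | zero =>
    obtain ⟨_ | ⟨P, K⟩, σ⟩ := c
    · simp
    · simp [val]
  | succ k ih =>
    obtain ⟨_ | ⟨P, K⟩, σ⟩ := c
    · simp
    · exact add_le_add le_rfl (ev_mono _ fun c => ih c)

lemma val_mono : Monotone (val τ f) :=
  monotone_nat_of_le_succ fun k c => val_mono_succ τ f k c

@[simp] lemma valC_nil (σ : State) : valC τ f ([], σ) = f σ := by simp [valC]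

lemma valC_cons (P : Prog) (K : List Prog) (σ : State) :
    valC τ f (P :: K, σ) = τ + ev (step (P :: K, σ)) (valC τ f) := by
  have h : valC τ f = fun c => ⨆ k, val τ f k c := rfl
  rw [h, ev_iSup _ _ (val_mono τ f), ENNReal.add_iSup]
  refine le_antisymm (iSup_le fun k => ?_) (iSup_le fun k => ?_)
  · cases k with
    | zero => exact zero_le
    | succ k => exact le_iSup (fun k => τ + ev (step (P :: K, σ)) (val τ f k)) k
  · exact le_iSup (fun k => val τ f k (P :: K, σ)) (k + 1)

/-- Statements that wait at the bottom of the stack do not influence a step. -/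
lemma step_append (P : Prog) (K K' : List Prog) (σ : State) :
    step (P :: K ++ K', σ) = (step (P :: K, σ)).map fun c => (c.1 ++ K', c.2) := by
  cases P <;> simp only [List.cons_append, step, PMF.pure_map, PMF.map_comp, Function.comp_def]
  all_goals split_ifs <;> rfl

lemma valC_append (K K' : List Prog) (σ : State) :
    valC τ f (K ++ K', σ) = valC τ (fun σ' => valC τ f (K', σ')) (K, σ) := by
  apply le_antisymm
  · refine iSup_le fun k => ?_
    induction k generalizing K σ with
    | zero =>
      cases K with
      | nil => simpa [valC] using le_iSup (fun k => val τ f k (K', σ)) 0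
      | cons P K => exact zero_le
    | succ k ih =>
      cases K with
      | nil => simpa [valC] using le_iSup (fun k => val τ f k (K', σ)) (k + 1)
      | cons P K =>
        rw [valC_cons]
        change τ + ev (step (P :: K ++ K', σ)) (val τ f k) ≤ _
        rw [step_append, ev_map]
        exact add_le_add le_rfl (ev_mono _ fun c => ih c.1 c.2)
  · refine iSup_le fun k => ?_
    induction k generalizing K σ with
    | zero =>
      cases K with
      | nil => simp
      | cons P K => exact zero_le
    | succ k ih =>
      cases K with
      | nil => simp
      | cons P K =>
        rw [List.cons_append, valC_cons, ← List.cons_append, step_append, ev_map]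
        exact add_le_add le_rfl (ev_mono _ fun c => ih c.1 c.2)

open Classical in
lemma haltProb_eq_valC (P : Prog) (σ : State) (A : Set State) :
    haltProb P σ A = valC 0 (fun σ' => if σ' ∈ A then 1 else 0) ([P], σ) := by
  refine iSup_congr fun k => ?_
  generalize ([P], σ) = c
  rw [toOuterMeasure_eq_ev]
  induction k generalizing c with
  | zero =>
    obtain ⟨_ | ⟨Q, K⟩, σ⟩ := c
    · simp [runFor, ev_pure]
    · simp [runFor, ev_pure, val]
  | succ k ih =>
    rw [runFor, ev_bind]
    simp only [ih]
    obtain ⟨_ | ⟨Q, K⟩, σ⟩ := c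
    · simp [step, ev_pure]
    · simp [val]

open Classical in
lemma expectedTime_eq_valC (P : Prog) (σ : State) :
    expectedTime P σ = valC 1 (fun _ => 0) ([P], σ) := by
  rw [expectedTime, ENNReal.tsum_eq_iSup_nat]
  refine iSup_congr fun k => ?_
  generalize ([P], σ) = c
  induction k generalizing c with
  | zero =>
    obtain ⟨_ | ⟨Q, K⟩, σ⟩ := c <;> simp [val]
  | succ k ih =>
    obtain ⟨_ | ⟨Q, K⟩, σ⟩ := c
    · simp only [val_nil]
      refine Finset.sum_eq_zero fun i _ => ?_
      have h : ∀ i, runFor i ([], σ) = PMF.pure ([], σ) := by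
        intro i
        induction i with
        | zero => rfl
        | succ i ih => rw [runFor]; simp [step, ih]
      rw [h, toOuterMeasure_eq_ev, ev_pure]
      simp
    · rw [Finset.sum_range_succ', val, add_comm]
      congr 1
      · rw [toOuterMeasure_eq_ev, runFor, ev_pure]; simp
      · have h : val 1 (fun _ => 0) k = fun c => ∑ a ∈ Finset.range k,
            (runFor a c).toOuterMeasure {c | c.1 ≠ []} := by
          funext c; exact (ih c).symm
        rw [h]
        simp only [runFor, toOuterMeasure_eq_ev, ev_bind]
        unfold ev
        simp only [Finset.mul_sum]
        rw [Summable.tsum_finsetSum fun _ _ => ENNReal.summable]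

end Valuation

/-! ### Weakest preexpectations -/

set_option linter.deprecated false in
lemma coin_true {p : ℝ} (h1 : p ≤ 1) : coin p true = ENNReal.ofReal p := by
  rw [coin, PMF.bernoulli_apply]
  simp [h1, ENNReal.ofReal]

set_option linter.deprecated false in
lemma coin_false {p : ℝ} (h0 : 0 ≤ p) (h1 : p ≤ 1) : coin p false = ENNReal.ofReal (1 - p) := by
  rw [coin, PMF.bernoulli_apply, ENNReal.ofReal_sub _ h0]
  simp [h1, ENNReal.ofReal]

/-- The expected total payoff of a program. -/
noncomputable def wp (τ : ℝ≥0∞) (P : Prog) (f : State → ℝ≥0∞) (σ : State) : ℝ≥0∞ :=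
  valC τ f ([P], σ)

section WP

variable (τ : ℝ≥0∞) (f : State → ℝ≥0∞) (σ : State)

lemma valC_two (P Q : Prog) : valC τ f ([P, Q], σ) = wp τ P (wp τ Q f) σ :=
  valC_append τ f [P] [Q] σ

lemma wp_skip : wp τ .skip f σ = τ + f σ := by
  rw [wp, valC_cons]; simp [step, ev_pure]

lemma wp_setNat (a : ℕ) (i x : NatExp) :
    wp τ (.setNat a i x) f σ = τ + f (σ.writeNat a (i.eval σ) (x.eval σ)) := by
  rw [wp, valC_cons]; simp [step, ev_pure]

lemma wp_setReal (a : ℕ) (i : NatExp) (x : RealExp) :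
    wp τ (.setReal a i x) f σ = τ + f (σ.writeReal a (i.eval σ) (x.eval σ)) := by
  rw [wp, valC_cons]; simp [step, ev_pure]

lemma wp_toss (a : ℕ) (i : NatExp) (p : RealExp) (h0 : 0 ≤ p.eval σ) (h1 : p.eval σ ≤ 1) :
    wp τ (.toss a i p) f σ = τ + (ENNReal.ofReal (p.eval σ) * f (σ.writeNat a (i.eval σ) 1) +
      ENNReal.ofReal (1 - p.eval σ) * f (σ.writeNat a (i.eval σ) 0)) := by
  rw [wp, valC_cons, step, ev_map, ev, tsum_fintype, Fintype.sum_bool]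
  simp [coin_true h1, coin_false h0 h1]

lemma wp_seq (P Q : Prog) : wp τ (.seq P Q) f σ = τ + wp τ P (wp τ Q f) σ := by
  rw [wp, valC_cons]; simp [step, ev_pure, valC_two]

lemma wp_ite_pos {b : Test} (P Q : Prog) (h : b.Holds σ) :
    wp τ (.ite b P Q) f σ = τ + wp τ P f σ := by
  rw [wp, valC_cons]; simp [step, ev_pure, h, wp]

lemma wp_ite_neg {b : Test} (P Q : Prog) (h : ¬ b.Holds σ) :
    wp τ (.ite b P Q) f σ = τ + wp τ Q f σ := by
  rw [wp, valC_cons]; simp [step, ev_pure, h, wp]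

lemma wp_loop_pos {b : Test} (P : Prog) (h : b.Holds σ) :
    wp τ (.loop b P) f σ = τ + wp τ P (wp τ (.loop b P) f) σ := by
  rw [wp, valC_cons]; simp [step, ev_pure, h, valC_two]

lemma wp_loop_neg {b : Test} (P : Prog) (h : ¬ b.Holds σ) :
    wp τ (.loop b P) f σ = τ + f σ := by
  rw [wp, valC_cons]; simp [step, ev_pure, h]

variable {τ f}

/-- Every prefixed point of the loop functional bounds the payoff of the loop: `I` need only be
one step of the loop ahead of itself. -/
lemma wp_loop_le {b : Test} {P : Prog} {I : State → ℝ≥0∞}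
    (h1 : ∀ σ, b.Holds σ → τ + wp τ P I σ ≤ I σ) (h2 : ∀ σ, ¬ b.Holds σ → τ + f σ ≤ I σ) :
    wp τ (.loop b P) f σ ≤ I σ := by
  have key : ∀ k K σ, val τ f k (K ++ [.loop b P], σ) ≤ valC τ I (K, σ) := by
    intro k
    induction k with
    | zero => intro K σ; cases K <;> exact zero_le
    | succ k ih =>
      intro K σ
      cases K with
      | nil =>
        simp only [List.nil_append, val, valC_nil, step, ev_pure]
        by_cases h : b.Holds σ
        · rw [if_pos h]
          exact (add_le_add le_rfl (ih [P] σ)).trans (h1 σ h)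
        · rw [if_neg h, val_nil]
          exact h2 σ h
      | cons Q K =>
        rw [valC_cons]
        change τ + ev (step (Q :: K ++ [.loop b P], σ)) (val τ f k) ≤ _
        rw [step_append, ev_map]
        exact add_le_add le_rfl (ev_mono _ fun c => ih c.1 c.2)
  exact iSup_le fun k => by simpa using key k [] σ

end WP

/-! ### Variables that a program may modify -/

/-- The integer arrays into which a program writes. -/
def Prog.natMods : Prog → List ℕ
  | .skip => []
  | .setNat a _ _ => [a]
  | .setReal _ _ _ => []
  | .toss a _ _ => [a]
  | .seq P Q => P.natMods ++ Q.natMods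
  | .ite _ P Q => P.natMods ++ Q.natMods
  | .loop _ P => P.natMods

/-- The real arrays into which a program writes. -/
def Prog.realMods : Prog → List ℕ
  | .skip => []
  | .setNat _ _ _ => []
  | .setReal a _ _ => [a]
  | .toss _ _ _ => []
  | .seq P Q => P.realMods ++ Q.realMods
  | .ite _ P Q => P.realMods ++ Q.realMods
  | .loop _ P => P.realMods

/-- The arrays that are not modified by `P` are the same in two memories. -/
structure Prog.Frame (P : Prog) (σ σ' : State) : Prop where
  nat : ∀ a, a ∉ P.natMods → σ'.nat a = σ.nat a
  real : ∀ a, a ∉ P.realMods → σ'.real a = σ.real a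

/-- The payoff depends only on the final memories that respect the frame. -/
lemma wp_congr_frame {τ : ℝ≥0∞} {P : Prog} {σ : State} {f g : State → ℝ≥0∞}
    (h : ∀ σ', P.Frame σ σ' → f σ' = g σ') : wp τ P f σ = wp τ P g σ := by
  have key : ∀ (A B : List ℕ) (σ₀ : State) (f g : State → ℝ≥0∞),
      (∀ σ', (∀ a, a ∉ A → σ'.nat a = σ₀.nat a) → (∀ a, a ∉ B → σ'.real a = σ₀.real a) →
        f σ' = g σ') →
      ∀ k K σ, (∀ P ∈ K, P.natMods ⊆ A ∧ P.realMods ⊆ B) →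
        (∀ a, a ∉ A → σ.nat a = σ₀.nat a) → (∀ a, a ∉ B → σ.real a = σ₀.real a) →
        val τ f k (K, σ) = val τ g k (K, σ) := by
    intro A B σ₀ f g hfg k
    induction k with
    | zero =>
      intro K σ hK h1 h2
      cases K with
      | nil => simpa using hfg σ h1 h2
      | cons Q K => rfl
    | succ k ih =>
      intro K σ hK h1 h2
      cases K with
      | nil => simpa using hfg σ h1 h2
      | cons Q K =>
        simp only [val]
        congr 1
        obtain ⟨⟨hQ1, hQ2⟩, hK'⟩ := List.forall_mem_cons.1 hK
        have hw : ∀ a i v, a ∈ A → ∀ b, b ∉ A → (σ.writeNat a i v).nat b = σ₀.nat b := by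
          intro a i v ha b hb
          have : b ≠ a := fun e => hb (e ▸ ha)
          simp [State.writeNat, Function.update_of_ne this, h1 b hb]
        have hwr : ∀ a i v, a ∈ B → ∀ b, b ∉ B → (σ.writeReal a i v).real b = σ₀.real b := by
          intro a i v ha b hb
          have : b ≠ a := fun e => hb (e ▸ ha)
          simp [State.writeReal, Function.update_of_ne this, h2 b hb]
        cases Q with
        | skip => simp only [step, ev_pure]; exact ih _ _ hK' h1 h2
        | setNat a i x =>
          simp only [step, ev_pure]
          exact ih _ _ hK' (hw _ _ _ (hQ1 (by simp [Prog.natMods]))) h2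
        | setReal a i x =>
          simp only [step, ev_pure]
          exact ih _ _ hK' h1 (hwr _ _ _ (hQ2 (by simp [Prog.realMods])))
        | toss a i p =>
          simp only [step, ev_map]
          refine tsum_congr fun b => ?_
          simp only [Function.comp]
          rw [ih _ _ hK' (hw _ _ _ (hQ1 (by simp [Prog.natMods]))) h2]
        | seq P Q =>
          simp only [step, ev_pure]
          simp only [Prog.natMods, Prog.realMods, List.append_subset] at hQ1 hQ2
          exact ih _ _ (by simp only [List.mem_cons, forall_eq_or_imp]
                           exact ⟨⟨hQ1.1, hQ2.1⟩, ⟨hQ1.2, hQ2.2⟩, hK'⟩) h1 h2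
        | ite b P Q =>
          simp only [step, ev_pure]
          simp only [Prog.natMods, Prog.realMods, List.append_subset] at hQ1 hQ2
          split_ifs
          · exact ih _ _ (by simp only [List.mem_cons, forall_eq_or_imp]
                             exact ⟨⟨hQ1.1, hQ2.1⟩, hK'⟩) h1 h2
          · exact ih _ _ (by simp only [List.mem_cons, forall_eq_or_imp]
                             exact ⟨⟨hQ1.2, hQ2.2⟩, hK'⟩) h1 h2
        | loop b P =>
          simp only [step, ev_pure]
          split_ifs
          · exact ih _ _ (by simp only [List.mem_cons, forall_eq_or_imp]
                             exact ⟨⟨hQ1, hQ2⟩, ⟨hQ1, hQ2⟩, hK'⟩) h1 h2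
          · exact ih _ _ hK' h1 h2
  exact iSup_congr fun k => key P.natMods P.realMods σ f g (fun σ' h1 h2 => h σ' ⟨h1, h2⟩) k [P] σ
    (by simp) (fun _ _ => rfl) (fun _ _ => rfl)

/-! ### Deterministic executions -/

/-- `Big P σ σ' t`: without tossing coins, `P` leads from memory `σ` to memory `σ'` in `t` steps. -/
inductive Big : Prog → State → State → ℕ → Prop
  | skip (σ) : Big .skip σ σ 1
  | setNat (σ a i x) : Big (.setNat a i x) σ (σ.writeNat a (i.eval σ) (x.eval σ)) 1
  | setReal (σ a i x) : Big (.setReal a i x) σ (σ.writeReal a (i.eval σ) (x.eval σ)) 1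
  | seq {P Q σ₁ σ₂ σ₃ s t} : Big P σ₁ σ₂ s → Big Q σ₂ σ₃ t → Big (.seq P Q) σ₁ σ₃ (1 + s + t)
  | ite_pos {b P Q σ σ' t} : b.Holds σ → Big P σ σ' t → Big (.ite b P Q) σ σ' (1 + t)
  | ite_neg {b P Q σ σ' t} : ¬ b.Holds σ → Big Q σ σ' t → Big (.ite b P Q) σ σ' (1 + t)
  | loop_pos {b P σ₁ σ₂ σ₃ s t} : b.Holds σ₁ → Big P σ₁ σ₂ s → Big (.loop b P) σ₂ σ₃ t →
      Big (.loop b P) σ₁ σ₃ (1 + s + t)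
  | loop_neg {b P σ} : ¬ b.Holds σ → Big (.loop b P) σ σ 1

lemma Big.wp_eq {P : Prog} {σ σ' : State} {t : ℕ} (h : Big P σ σ' t) (τ : ℝ≥0∞)
    (f : State → ℝ≥0∞) : wp τ P f σ = τ * t + f σ' := by
  induction h generalizing f with
  | skip => simp [wp_skip]
  | setNat => simp [wp_setNat]
  | setReal => simp [wp_setReal]
  | seq _ _ ih₁ ih₂ => rw [wp_seq, ih₁, ih₂]; push_cast; ring
  | ite_pos hb _ ih => rw [wp_ite_pos _ _ _ _ _ hb, ih]; push_cast; ring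
  | ite_neg hb _ ih => rw [wp_ite_neg _ _ _ _ _ hb, ih]; push_cast; ring
  | loop_pos hb _ _ ih₁ ih₂ => rw [wp_loop_pos _ _ _ _ hb, ih₁, ih₂]; push_cast; ring
  | loop_neg hb => rw [wp_loop_neg _ _ _ _ hb]; simp

lemma Big.frame {P : Prog} {σ σ' : State} {t : ℕ} (h : Big P σ σ' t) : P.Frame σ σ' := by
  classical
  -- the payoff `0` on the frame and `∞` off it vanishes
  have h1 := h.wp_eq 0 (fun σ' => if P.Frame σ σ' then 0 else ⊤)
  rw [wp_congr_frame (g := fun _ => 0) (fun σ' h' => if_pos h'), h.wp_eq] at h1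
  by_contra h2
  simp [h2] at h1

/-- `P` started on `σ` halts within `T` steps, without tossing coins, in a memory satisfying `Q`. -/
def Hoare (P : Prog) (σ : State) (T : ℕ) (Q : State → Prop) : Prop :=
  ∃ σ' t, Big P σ σ' t ∧ t ≤ T ∧ Q σ'

namespace Hoare

variable {P P' : Prog} {σ : State} {T T' : ℕ} {Q Q' : State → Prop}

lemma mono (h : Hoare P σ T Q) (hT : T ≤ T') (hQ : ∀ σ', Q σ' → Q' σ') : Hoare P σ T' Q' := by
  obtain ⟨σ', t, h1, h2, h3⟩ := h
  exact ⟨σ', t, h1, h2.trans hT, hQ _ h3⟩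

lemma conseq (h : Hoare P σ T Q) (hQ : ∀ σ', Q σ' → Q' σ') : Hoare P σ T Q' := h.mono le_rfl hQ

lemma frame (h : Hoare P σ T Q) : Hoare P σ T (fun σ' => Q σ' ∧ P.Frame σ σ') := by
  obtain ⟨σ', t, h1, h2, h3⟩ := h
  exact ⟨σ', t, h1, h2, h3, h1.frame⟩

lemma seq (h : Hoare P σ T Q) (h' : ∀ σ', Q σ' → Hoare P' σ' T' Q') :
    Hoare (.seq P P') σ (1 + T + T') Q' := by
  obtain ⟨σ', t, h1, h2, h3⟩ := h
  obtain ⟨σ'', t', h1', h2', h3'⟩ := h' σ' h3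
  exact ⟨σ'', _, h1.seq h1', by lia, h3'⟩

lemma ite {b : Test} (h : b.Holds σ → Hoare P σ T Q) (h' : ¬ b.Holds σ → Hoare P' σ T Q) :
    Hoare (.ite b P P') σ (1 + T) Q := by
  by_cases hb : b.Holds σ
  · obtain ⟨σ', t, h1, h2, h3⟩ := h hb
    exact ⟨σ', _, h1.ite_pos hb, by lia, h3⟩
  · obtain ⟨σ', t, h1, h2, h3⟩ := h' hb
    exact ⟨σ', _, h1.ite_neg hb, by lia, h3⟩

/-- The rule for loops with an invariant `J`, a bound `μ` on the number of iterations, and auxiliary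
data `γ` that need not be stored in the memory. -/
lemma loop_ghost {γ : Type*} {b : Test} (J : γ → State → Prop) (μ : γ → ℕ)
    (h : ∀ c σ', P.Frame σ σ' → J c σ' → b.Holds σ' →
      Hoare P σ' T (fun σ'' => ∃ c', J c' σ'' ∧ μ c' < μ c))
    (c : γ) (hJ : J c σ) :
    Hoare (.loop b P) σ ((T + 1) * μ c + 1) (fun σ' => ∃ c', J c' σ' ∧ ¬ b.Holds σ') := by
  suffices ∀ n c σ', μ c = n → P.Frame σ σ' → J c σ' → Hoare (.loop b P) σ' ((T + 1) * n + 1)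
      (fun σ' => ∃ c', J c' σ' ∧ ¬ b.Holds σ') from
    this _ c σ rfl ⟨fun _ _ => rfl, fun _ _ => rfl⟩ hJ
  intro n
  induction n using Nat.strong_induction_on with
  | _ n ih =>
    intro c σ' hn hF hJ
    by_cases hb : b.Holds σ'
    · obtain ⟨σ₁, t, h1, h2, c', h3, h4⟩ := h c σ' hF hJ hb
      have hF' : P.Frame σ σ₁ := ⟨fun a ha => (h1.frame.nat a ha).trans (hF.nat a ha),
        fun a ha => (h1.frame.real a ha).trans (hF.real a ha)⟩
      obtain ⟨σ₂, t', h1', h2', h3'⟩ := ih (μ c') (hn ▸ h4) c' σ₁ rfl hF' h3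
      refine ⟨σ₂, _, h1.loop_pos hb h1', ?_, h3'⟩
      have : (T + 1) * (μ c' + 1) ≤ (T + 1) * n := Nat.mul_le_mul_left _ (hn ▸ h4)
      lia
    · exact ⟨σ', 1, .loop_neg hb, by lia, c, hJ, hb⟩

/-- The rule for loops with a counter: `J k` is the invariant before iteration `k`. -/
lemma loop_count {b : Test} (J : ℕ → State → Prop) (N : ℕ)
    (h : ∀ k < N, ∀ σ', P.Frame σ σ' → J k σ' → b.Holds σ' ∧ Hoare P σ' T (J (k + 1)))
    (hN : ∀ σ', P.Frame σ σ' → J N σ' → ¬ b.Holds σ') (hJ : J 0 σ) :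
    Hoare (.loop b P) σ ((T + 1) * N + 1) (J N) := by
  refine (loop_ghost (P := P) (T := T) (b := b) (fun k σ' => k ≤ N ∧ J k σ') (fun k => N - k) ?_ 0
    ⟨Nat.zero_le _, hJ⟩).frame.conseq ?_
  · rintro k σ' hF ⟨hk, hJk⟩ hb
    have hk' : k < N := by
      rcases hk.lt_or_eq with h | rfl
      · exact h
      · exact absurd hb (hN σ' hF hJk)
    exact (h k hk' σ' hF hJk).2.conseq fun σ' h' => ⟨k + 1, ⟨hk', h'⟩, by lia⟩
  · rintro σ' ⟨⟨k, ⟨hk, hJk⟩, hb⟩, hF⟩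
    rcases hk.lt_or_eq with h' | rfl
    · exact absurd (h k h' σ' ⟨hF.nat, hF.real⟩ hJk).1 hb
    · exact hJk

end Hoare

/-! ### Straight-line programs -/

/-- There are neither loops nor coin tosses. -/
def Prog.Straight : Prog → Bool
  | .seq P Q => P.Straight && Q.Straight
  | .ite _ P Q => P.Straight && Q.Straight
  | .toss _ _ _ => false
  | .loop _ _ => false
  | _ => true

/-- The number of statements. -/
def Prog.size : Prog → ℕ
  | .seq P Q => 1 + P.size + Q.size
  | .ite _ P Q => 1 + P.size + Q.size
  | .loop _ P => 1 + P.size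
  | _ => 1

open Classical in
/-- The final memory of a straight-line program. -/
noncomputable def Prog.run : Prog → State → State
  | .setNat a i x, σ => σ.writeNat a (i.eval σ) (x.eval σ)
  | .setReal a i x, σ => σ.writeReal a (i.eval σ) (x.eval σ)
  | .seq P Q, σ => Q.run (P.run σ)
  | .ite b P Q, σ => if b.Holds σ then P.run σ else Q.run σ
  | _, σ => σ

lemma Prog.Straight.hoare_size {P : Prog} (hP : P.Straight = true) {σ : State} {Q : State → Prop}
    (h : Q (P.run σ)) : Hoare P σ P.size Q := by
  induction P generalizing σ Q with
  | skip => exact ⟨_, _, .skip σ, le_rfl, h⟩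
  | setNat a i x => exact ⟨_, _, .setNat σ a i x, le_rfl, h⟩
  | setReal a i x => exact ⟨_, _, .setReal σ a i x, le_rfl, h⟩
  | toss => simp [Prog.Straight] at hP
  | loop => simp [Prog.Straight] at hP
  | seq P P' ih ih' =>
    simp only [Prog.Straight, Bool.and_eq_true] at hP
    exact Hoare.seq (ih hP.1 (Q := fun σ' => Q (P'.run σ')) h) fun σ' h' => ih' hP.2 h'
  | ite b P P' ih ih' =>
    simp only [Prog.Straight, Bool.and_eq_true] at hP
    refine Hoare.mono (Hoare.ite (T := P.size + P'.size) ?_ ?_) (by simp [Prog.size]; lia)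
      (fun _ h => h)
    · intro hb
      rw [Prog.run, if_pos hb] at h
      exact (ih hP.1 h).mono (by lia) fun _ h => h
    · intro hb
      rw [Prog.run, if_neg hb] at h
      exact (ih' hP.2 h).mono (by lia) fun _ h => h

lemma Hoare.of_run {P : Prog} (hP : P.Straight = true) {σ : State} {T : ℕ} (hT : P.size ≤ T)
    {Q : State → Prop} (h : Q (P.run σ)) : Hoare P σ T Q :=
  (Prog.Straight.hoare_size hP h).mono hT fun _ h => h

@[simp] lemma State.nat_writeNat_self (σ : State) (a i v : ℕ) :
    (σ.writeNat a i v).nat a = Function.update (σ.nat a) i v := by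
  simp [State.writeNat]

@[simp] lemma State.nat_writeNat_of_ne (σ : State) {a b : ℕ} (i v : ℕ) (h : b ≠ a) :
    (σ.writeNat a i v).nat b = σ.nat b := by
  simp [State.writeNat, h]

@[simp] lemma State.real_writeNat (σ : State) (a i v : ℕ) : (σ.writeNat a i v).real = σ.real := rfl

@[simp] lemma State.nat_writeReal (σ : State) (a i : ℕ) (v : ℝ) :
    (σ.writeReal a i v).nat = σ.nat := rfl

@[simp] lemma State.real_writeReal_self (σ : State) (a i : ℕ) (v : ℝ) :
    (σ.writeReal a i v).real a = Function.update (σ.real a) i v := by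
  simp [State.writeReal]

@[simp] lemma State.real_writeReal_of_ne (σ : State) {a b : ℕ} (i : ℕ) (v : ℝ) (h : b ≠ a) :
    (σ.writeReal a i v).real b = σ.real b := by
  simp [State.writeReal, h]

attribute [simp] NatExp.eval RealExp.eval Test.Holds Prog.run

/-! ### Randomized executions -/

/-- `P`, started on `σ`, almost surely halts, with a random memory that realizes a random element
of `α` with distribution `D`, and with expected running time at most `T`. Here `Q a σ'` says that
the memory `σ'` realizes `a`. The statement is phrased by the expectations of payoffs: a payoff is at
least (at most) the expectation of `g` under `D` if it is at least (at most) `g a` on every memory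
that realizes `a`. -/
structure Spec {α : Type*} (P : Prog) (σ : State) (D : PMF α) (Q : α → State → Prop)
    (T : ℝ≥0∞) : Prop where
  low : ∀ (f : State → ℝ≥0∞) (g : α → ℝ≥0∞), (∀ a σ', Q a σ' → g a ≤ f σ') →
    ev D g ≤ wp 0 P f σ
  high : ∀ (f : State → ℝ≥0∞) (g : α → ℝ≥0∞), (∀ a σ', Q a σ' → f σ' ≤ g a) →
    wp 1 P f σ ≤ T + ev D g

namespace Spec

variable {α β : Type*} {P P' : Prog} {σ : State} {D : PMF α} {Q : α → State → Prop} {T T' : ℝ≥0∞}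

lemma mono {Q' : α → State → Prop} (h : Spec P σ D Q T) (hT : T ≤ T')
    (hQ : ∀ a σ', Q a σ' → Q' a σ') : Spec P σ D Q' T' where
  low f g hfg := h.low f g fun a σ' hq => hfg a σ' (hQ a σ' hq)
  high f g hfg := (h.high f g fun a σ' hq => hfg a σ' (hQ a σ' hq)).trans (add_le_add hT le_rfl)

lemma map {Q' : β → State → Prop} (h : Spec P σ D Q T) (φ : α → β)
    (hQ : ∀ a σ', Q a σ' → Q' (φ a) σ') : Spec P σ (D.map φ) Q' T where
  low f g hfg := by rw [ev_map]; exact h.low f _ fun a σ' hq => hfg _ σ' (hQ a σ' hq)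
  high f g hfg := by rw [ev_map]; exact h.high f _ fun a σ' hq => hfg _ σ' (hQ a σ' hq)

lemma frame (h : Spec P σ D Q T) : Spec P σ D (fun a σ' => Q a σ' ∧ P.Frame σ σ') T where
  low f g hfg := by
    classical
    rw [wp_congr_frame (g := fun σ' => if P.Frame σ σ' then f σ' else ⊤)
      (fun σ' h' => (if_pos h').symm)]
    refine h.low _ _ fun a σ' hq => ?_
    split_ifs with hF
    · exact hfg a σ' ⟨hq, hF⟩
    · exact le_top
  high f g hfg := by
    classical
    rw [wp_congr_frame (g := fun σ' => if P.Frame σ σ' then f σ' else 0)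
      (fun σ' h' => (if_pos h').symm)]
    refine h.high _ _ fun a σ' hq => ?_
    split_ifs with hF
    · exact hfg a σ' ⟨hq, hF⟩
    · exact zero_le

lemma bind {D' : α → PMF β} {Q' : β → State → Prop} (h : Spec P σ D Q T)
    (h' : ∀ a σ', Q a σ' → Spec P' σ' (D' a) Q' T') :
    Spec (.seq P P') σ (D.bind D') Q' (1 + T + T') where
  low f g hfg := by
    rw [ev_bind, wp_seq, zero_add]
    exact h.low _ _ fun a σ' hq => (h' a σ' hq).low f g hfg
  high f g hfg := by
    rw [ev_bind, wp_seq]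
    have := h.high (wp 1 P' f) (fun a => T' + ev (D' a) g) fun a σ' hq => (h' a σ' hq).high f g hfg
    rw [ev_add, ev_const] at this
    calc _ ≤ 1 + (T + (T' + ev D fun a => ev (D' a) g)) := add_le_add le_rfl this
      _ = _ := by ring

lemma _root_.NetRel.Hoare.spec {Q : State → Prop} {T : ℕ} (h : Hoare P σ T Q) (a : α) :
    Spec P σ (PMF.pure a) (fun a' σ' => a' = a ∧ Q σ') T := by
  obtain ⟨σ', t, h1, h2, h3⟩ := h
  constructor
  · intro f g hfg
    rw [ev_pure, h1.wp_eq]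
    simpa using hfg a σ' ⟨rfl, h3⟩
  · intro f g hfg
    rw [ev_pure, h1.wp_eq, one_mul]
    exact add_le_add (by exact_mod_cast h2) (hfg a σ' ⟨rfl, h3⟩)

lemma seq_hoare {Q' : α → State → Prop} {T' : ℕ} (h : Spec P σ D Q T)
    (h' : ∀ a σ', Q a σ' → Hoare P' σ' T' (Q' a)) :
    Spec (.seq P P') σ D Q' (1 + T + T') := by
  have := h.bind (P' := P') (T' := T') (Q' := Q') (D' := PMF.pure) fun a σ' hq =>
    ((h' a σ' hq).spec a).mono le_rfl fun a' σ'' ⟨e, h⟩ => e ▸ h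
  rwa [PMF.bind_pure] at this

lemma _root_.NetRel.Hoare.seq_spec {Q₀ : State → Prop} {T₀ : ℕ} (h : Hoare P σ T₀ Q₀)
    (h' : ∀ σ', Q₀ σ' → Spec P' σ' D Q T) : Spec (.seq P P') σ D Q (1 + T₀ + T) := by
  have := (h.spec ()).bind (P' := P') (T' := T) (Q' := Q) (D' := fun _ => D)
    fun a σ' hq => h' σ' hq.2
  rwa [PMF.pure_bind] at this

lemma ite {b : Test} (h : b.Holds σ → Spec P σ D Q T) (h' : ¬ b.Holds σ → Spec P' σ D Q T) :
    Spec (.ite b P P') σ D Q (1 + T) := by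
  by_cases hb : b.Holds σ
  · constructor
    · intro f g hfg
      rw [wp_ite_pos _ _ _ _ _ hb, zero_add]
      exact (h hb).low f g hfg
    · intro f g hfg
      rw [wp_ite_pos _ _ _ _ _ hb, add_assoc]
      exact add_le_add le_rfl ((h hb).high f g hfg)
  · constructor
    · intro f g hfg
      rw [wp_ite_neg _ _ _ _ _ hb, zero_add]
      exact (h' hb).low f g hfg
    · intro f g hfg
      rw [wp_ite_neg _ _ _ _ _ hb, add_assoc]
      exact add_le_add le_rfl ((h' hb).high f g hfg)

/-- The distribution after running the kernels `κ (k - 1), …, κ 0` one after the other. -/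
noncomputable def _root_.NetRel.iter (κ : ℕ → α → PMF α) : ℕ → α → PMF α
  | 0, a => PMF.pure a
  | k + 1, a => (κ k a).bind (iter κ k)

/-- The rule for loops whose number of iterations is fixed: `J k a σ` is the invariant when there
are `k` more iterations. -/
lemma loop_count {b : Test} (κ : ℕ → α → PMF α) (J : ℕ → α → State → Prop)
    (h : ∀ k a σ, J (k + 1) a σ → b.Holds σ ∧ Spec P σ (κ k a) (J k) T)
    (h0 : ∀ a σ, J 0 a σ → ¬ b.Holds σ) (k : ℕ) (a : α) (σ : State) (hJ : J k a σ) :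
    Spec (.loop b P) σ (iter κ k a) (J 0) (k * (T + 1) + 1) := by
  induction k generalizing a σ with
  | zero =>
    have := (Hoare.spec (P := .loop b P) (σ := σ) (T := 1) (Q := fun σ' => σ' = σ)
      ⟨σ, 1, .loop_neg (h0 a σ hJ), le_rfl, rfl⟩ a)
    exact this.mono (by simp) fun a' σ' ⟨e, e'⟩ => by subst e e'; exact hJ
  | succ k ih =>
    obtain ⟨hb, hs⟩ := h k a σ hJ
    have hs' := hs.bind (P' := .loop b P) fun a' σ' h' => ih a' σ' h'
    constructor
    · intro f g hfg
      have := hs'.low f g hfg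
      rwa [wp_seq, zero_add, ← zero_add (wp 0 P _ _), ← wp_loop_pos _ _ _ _ hb] at this
    · intro f g hfg
      have := hs'.high f g hfg
      rw [wp_seq, ← wp_loop_pos _ _ _ _ hb] at this
      refine this.trans (le_of_eq ?_)
      rw [iter]
      push_cast
      ring

end Spec

open Classical in
lemma Spec.le_haltProb {α : Type*} {P : Prog} {σ : State} {D : PMF α} {Q : α → State → Prop}
    {T : ℝ≥0∞} (h : Spec P σ D Q T) (A : Set State) (B : Set α)
    (hAB : ∀ a ∈ B, ∀ σ', Q a σ' → σ' ∈ A) :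
    ev D (fun a => if a ∈ B then 1 else 0) ≤ haltProb P σ A := by
  rw [haltProb_eq_valC]
  refine h.low _ _ fun a σ' hq => ?_
  by_cases ha : a ∈ B
  · simp [ha, hAB a ha σ' hq]
  · simp [ha]

lemma Spec.expectedTime_le {α : Type*} {P : Prog} {σ : State} {D : PMF α} {Q : α → State → Prop}
    {T : ℝ≥0∞} (h : Spec P σ D Q T) : expectedTime P σ ≤ T := by
  rw [expectedTime_eq_valC]
  have := h.high (fun _ => 0) (fun _ => 0) fun _ _ _ => le_rfl
  rwa [ev_const, add_zero] at this

lemma haltProb_le_one (P : Prog) (σ : State) (A : Set State) : haltProb P σ A ≤ 1 := by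
  classical
  refine iSup_le fun k => ?_
  rw [toOuterMeasure_eq_ev]
  refine (ev_mono _ (g := fun _ => 1) fun a => ?_).trans_eq (ev_const _ 1)
  split_ifs
  exacts [le_rfl, zero_le_one]

/-! ### Minimal clusters -/

namespace Network

section Clusters

open Classical

variable {V E : Type}

/-- There is a surviving directed path from `u` to `v`. -/
def Reaches (G : Network V E) (S : Finset E) : V → V → Prop := Relation.ReflTransGen (G.Arc S)

/-- Every vertex has a surviving directed path to the set `R` of roots. -/
def RootConn (G : Network V E) (R : Finset V) (S : Finset E) : Prop :=
  ∀ v, ∃ r ∈ R, G.Reaches S v r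

/-- A minimal cluster: a nonempty set of vertices without roots that no surviving arc leaves, and
that is minimal with these properties, which is expressed by its being strongly connected. -/
structure MinCluster (G : Network V E) (R : Finset V) (S : Finset E) (C : Finset V) : Prop where
  nonempty : C.Nonempty
  notMem_root : ∀ v ∈ C, v ∉ R
  closed : ∀ u ∈ C, ∀ v, G.Arc S u v → v ∈ C
  conn : ∀ u ∈ C, ∀ v ∈ C, G.Reaches S u v

/-- Resampling: the arcs that start in `C` are as in `S'`, the others as in `S`. -/
noncomputable def mix (G : Network V E) (C : Finset V) (S S' : Finset E) : Finset E :=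
  S.filter (fun e => G.fst e ∉ C) ∪ S'.filter (fun e => G.fst e ∈ C)

variable {G : Network V E} {R : Finset V} {S S' : Finset E} {C D : Finset V}

lemma mem_mix {e : E} : e ∈ G.mix C S S' ↔ if G.fst e ∈ C then e ∈ S' else e ∈ S := by
  unfold mix
  by_cases h : G.fst e ∈ C <;> simp [h]

lemma mix_mix_swap : G.mix C (G.mix C S S') (G.mix C S' S) = S := by
  ext e
  simp only [mem_mix]
  split_ifs <;> rfl

lemma mix_comm (hCD : Disjoint C D) (S S' S'' : Finset E) :
    G.mix C (G.mix D S S') S'' = G.mix D (G.mix C S S'') S' := by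
  ext e
  simp only [mem_mix]
  split_ifs with h1 h2
  · exact absurd h2 (Finset.disjoint_left.1 hCD h1)
  all_goals rfl

lemma Reaches.mem_of_closed {u v : V} (h : G.Reaches S u v)
    (hC : ∀ u ∈ C, ∀ v, G.Arc S u v → v ∈ C) (hu : u ∈ C) : v ∈ C := by
  induction h with
  | refl => exact hu
  | tail _ h ih => exact hC _ ih _ h

/-- A path that starts in a closed set uses only arcs that start in this set. -/
lemma Reaches.congr_of_closed {u v : V} (h : G.Reaches S u v)
    (hC : ∀ u ∈ C, ∀ v, G.Arc S u v → v ∈ C) (hu : u ∈ C)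
    (hS : ∀ e, G.fst e ∈ C → e ∈ S → e ∈ S') : G.Reaches S' u v := by
  have : G.Reaches S' u v ∧ v ∈ C := by
    induction h with
    | refl => exact ⟨.refl, hu⟩
    | tail _ h ih =>
      obtain ⟨e, he, rfl, rfl⟩ := h
      exact ⟨ih.1.tail ⟨e, hS e ih.2 he, rfl, rfl⟩, hC _ ih.2 _ ⟨e, he, rfl, rfl⟩⟩
  exact this.1

lemma MinCluster.congr (h : G.MinCluster R S C) (hS : ∀ e, G.fst e ∈ C → (e ∈ S ↔ e ∈ S')) :
    G.MinCluster R S' C where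
  nonempty := h.nonempty
  notMem_root := h.notMem_root
  closed := by
    rintro u hu v ⟨e, he, rfl, rfl⟩
    exact h.closed _ hu _ ⟨e, (hS e hu).2 he, rfl, rfl⟩
  conn u hu v hv :=
    (h.conn u hu v hv).congr_of_closed h.closed hu fun e h1 h2 => (hS e h1).1 h2

lemma minCluster_mix_self : G.MinCluster R (G.mix C S' S) C ↔ G.MinCluster R S C :=
  ⟨fun h => h.congr fun e he => by simp [mem_mix, he],
    fun h => h.congr fun e he => by simp [mem_mix, he]⟩

lemma minCluster_mix_of_disjoint (hCD : Disjoint C D) :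
    G.MinCluster R (G.mix C S S') D ↔ G.MinCluster R S D := by
  have : ∀ e, G.fst e ∈ D → (e ∈ S ↔ e ∈ G.mix C S S') := fun e he => by
    simp [mem_mix, Finset.disjoint_right.1 hCD he]
  exact ⟨fun h => h.congr fun e he => (this e he).symm, fun h => h.congr this⟩

/-- Distinct minimal clusters are disjoint. This is what makes the order of popping immaterial. -/
lemma MinCluster.disjoint (hC : G.MinCluster R S C) (hD : G.MinCluster R S D) (h : C ≠ D) :
    Disjoint C D := by
  rw [Finset.disjoint_left]
  intro z hzC hzD
  apply h
  ext x
  exact ⟨fun hx => (hC.conn z hzC x hx).mem_of_closed hD.closed hzD,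
    fun hx => (hD.conn z hzD x hx).mem_of_closed hC.closed hzC⟩

section Vertices

variable [Fintype V]

/-- The set of vertices that can be reached from `u`. -/
noncomputable def reachSet (G : Network V E) (S : Finset E) (u : V) : Finset V :=
  Finset.univ.filter (G.Reaches S u)

lemma mem_reachSet {u v : V} : v ∈ G.reachSet S u ↔ G.Reaches S u v := by simp [reachSet]

lemma reachSet_closed {u : V} : ∀ x ∈ G.reachSet S u, ∀ v, G.Arc S x v → v ∈ G.reachSet S u :=
  fun _ hx _ h => mem_reachSet.2 ((mem_reachSet.1 hx).tail h)

/-- A nonempty closed set without roots contains a minimal cluster. -/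
lemma exists_minCluster_subset (hne : D.Nonempty) (hR : ∀ v ∈ D, v ∉ R)
    (hD : ∀ u ∈ D, ∀ v, G.Arc S u v → v ∈ D) : ∃ C ⊆ D, G.MinCluster R S C := by
  -- a vertex of `D` from which as few vertices as possible are reachable
  obtain ⟨x, hx, hmin⟩ := D.exists_min_image (fun x => (G.reachSet S x).card) hne
  have hsub : G.reachSet S x ⊆ D := fun y hy => (mem_reachSet.1 hy).mem_of_closed hD hx
  refine ⟨G.reachSet S x, hsub, ⟨x, mem_reachSet.2 .refl⟩, fun v hv => hR v (hsub hv),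
    reachSet_closed, fun u hu v hv => ?_⟩
  have h1 : G.reachSet S u ⊆ G.reachSet S x := fun y hy =>
    mem_reachSet.2 ((mem_reachSet.1 hu).trans (mem_reachSet.1 hy))
  rw [← mem_reachSet, Finset.eq_of_subset_of_card_le h1 (hmin u (hsub hu))]
  exact hv

lemma rootConn_iff : G.RootConn R S ↔ ¬ ∃ C, G.MinCluster R S C := by
  constructor
  · rintro h ⟨C, hC⟩
    obtain ⟨v, hv⟩ := hC.nonempty
    obtain ⟨r, hr, hvr⟩ := h v
    exact hC.notMem_root r (hvr.mem_of_closed hC.closed hv) hr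
  · intro h v
    by_contra hv
    push Not at hv
    obtain ⟨C, -, hC⟩ := exists_minCluster_subset (G := G) (S := S) (R := R)
      (D := G.reachSet S v) ⟨v, mem_reachSet.2 .refl⟩
      (fun u hu hR => hv u hR (mem_reachSet.1 hu)) reachSet_closed
    exact h ⟨C, hC⟩

end Vertices

variable [Fintype E]

lemma wt_eq_prod (G : Network V E) (S : Finset E) :
    G.wt S = ∏ e, if e ∈ S then 1 - G.fail e else G.fail e := by
  rw [wt, ← Finset.prod_mul_prod_compl S]
  congr 1
  · exact Finset.prod_congr rfl fun e he => by simp [he]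
  · exact Finset.prod_congr rfl fun e he => by simp [Finset.mem_compl.1 he]

lemma wt_nonneg (hp : ∀ e, 0 ≤ G.fail e ∧ G.fail e ≤ 1) (S : Finset E) : 0 ≤ G.wt S :=
  mul_nonneg (Finset.prod_nonneg fun e _ => by linarith [hp e])
    (Finset.prod_nonneg fun e _ => (hp e).1)

lemma sum_wt (G : Network V E) : ∑ S, G.wt S = 1 := by
  have := Finset.prod_add (fun e => 1 - G.fail e) G.fail Finset.univ
  simp only [sub_add_cancel, Finset.prod_const_one, Finset.powerset_univ] at this
  rw [this]
  refine Finset.sum_congr rfl fun S _ => ?_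
  rw [wt, Finset.compl_eq_univ_sdiff]

lemma wt_mul_wt (C : Finset V) (S S' : Finset E) :
    G.wt (G.mix C S S') * G.wt (G.mix C S' S) = G.wt S * G.wt S' := by
  simp only [wt_eq_prod, ← Finset.prod_mul_distrib]
  refine Finset.prod_congr rfl fun e _ => ?_
  simp only [mem_mix]
  by_cases h : G.fst e ∈ C
  · simp only [h, if_true]; ring
  · simp only [h, if_false]

lemma sum_sum_mix (C : Finset V) (F : Finset E → Finset E → ℝ) :
    ∑ S, ∑ S', G.wt S * G.wt S' * F (G.mix C S S') (G.mix C S' S) =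
      ∑ S, ∑ S', G.wt S * G.wt S' * F S S' := by
  simp only [← Fintype.sum_prod_type', ← Finset.univ_product_univ]
  refine Finset.sum_nbij' (fun x => (G.mix C x.1 x.2, G.mix C x.2 x.1))
    (fun x => (G.mix C x.1 x.2, G.mix C x.2 x.1)) ?_ ?_ ?_ ?_ ?_
  · simp
  · simp
  · simp [mix_mix_swap]
  · simp [mix_mix_swap]
  · simp [wt_mul_wt]

/-- What is resampled is independent of what is not. -/
lemma sum_mul_resample (C : Finset V) (f g : Finset E → ℝ)
    (hg : ∀ S S', g (G.mix C S' S) = g S) :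
    ∑ S, G.wt S * (g S * ∑ S', G.wt S' * f (G.mix C S S')) =
      (∑ S, G.wt S * g S) * ∑ S, G.wt S * f S := by
  have h := sum_sum_mix (G := G) C (fun X Y => g Y * f X)
  simp only [hg] at h
  calc _ = ∑ S, ∑ S', G.wt S * G.wt S' * (g S * f (G.mix C S S')) := by
        refine Finset.sum_congr rfl fun S _ => ?_
        simp only [Finset.mul_sum]
        exact Finset.sum_congr rfl fun S' _ => by ring
    _ = _ := by
        rw [h, Finset.sum_comm, Finset.sum_mul_sum]
        refine Finset.sum_congr rfl fun S _ => Finset.sum_congr rfl fun S' _ => ?_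
        ring

end Clusters

end Network

/-! ### The law of cluster popping -/

namespace Network

section Popping

open Classical

variable {V E : Type} [Fintype E] {G : Network V E} {R : Finset V} {S : Finset E} {C : Finset V}

/-- The expectation of `h` at the end, on the event that the surviving arcs become root-connected
after popping exactly `t` clusters, when the arcs that survive at first are `S` and `w` is
the probability function by which arcs are resampled. The cluster to be popped is
chosen arbitrarily, and this choice does not matter by `popVal_eq`. -/
noncomputable def popVal {𝕜 : Type*} [CommSemiring 𝕜] (G : Network V E) (R : Finset V)
    (w h : Finset E → 𝕜) : ℕ → Finset E → 𝕜
  | 0, S => if ∃ C, G.MinCluster R S C then 0 else h S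
  | t + 1, S => if hC : ∃ C, G.MinCluster R S C then
      ∑ S', w S' * popVal G R w h t (G.mix hC.choose S S') else 0

/-- Any minimal cluster may be popped first. -/
lemma popVal_eq {𝕜 : Type*} [CommSemiring 𝕜] (w h : Finset E → 𝕜) (t : ℕ)
    (hC : G.MinCluster R S C) :
    G.popVal R w h (t + 1) S = ∑ S', w S' * G.popVal R w h t (G.mix C S S') := by
  induction t generalizing S C with
  | zero =>
    have hex : ∃ C, G.MinCluster R S C := ⟨C, hC⟩
    rw [popVal, dif_pos hex]
    by_cases hne : C = hex.choose
    · rw [← hne]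
    · have hdis := hC.disjoint hex.choose_spec hne
      have h1 : ∀ S', G.popVal R w h 0 (G.mix hex.choose S S') = 0 := fun S' => if_pos
        ⟨C, (minCluster_mix_of_disjoint hdis.symm).2 hC⟩
      have h2 : ∀ S', G.popVal R w h 0 (G.mix C S S') = 0 := fun S' => if_pos
        ⟨_, (minCluster_mix_of_disjoint hdis).2 hex.choose_spec⟩
      simp [h1, h2]
  | succ t ih =>
    have hex : ∃ C, G.MinCluster R S C := ⟨C, hC⟩
    rw [popVal, dif_pos hex]
    by_cases hne : C = hex.choose
    · rw [← hne]
    · have hdis := hC.disjoint hex.choose_spec hne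
      have h1 : ∀ S', G.popVal R w h (t + 1) (G.mix hex.choose S S') = _ := fun S' =>
        ih ((minCluster_mix_of_disjoint hdis.symm).2 hC)
      have h2 : ∀ S', G.popVal R w h (t + 1) (G.mix C S S') = _ := fun S' =>
        ih ((minCluster_mix_of_disjoint hdis).2 hex.choose_spec)
      simp only [h1, h2, Finset.mul_sum]
      -- both sides now pop the two disjoint clusters, in opposite orders
      rw [Finset.sum_comm]
      refine Finset.sum_congr rfl fun S' _ => Finset.sum_congr rfl fun S'' _ => ?_
      rw [mix_comm hdis]
      ring

section Real

variable (G R)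

/-- All sets in `I` are minimal clusters. -/
noncomputable def allMin (I : Finset (Finset V)) (S : Finset E) : ℝ :=
  if ∀ C ∈ I, G.MinCluster R S C then 1 else 0

/-- The probability that all sets in `I` are minimal clusters. -/
noncomputable def allMinProb (I : Finset (Finset V)) : ℝ := ∑ S, G.wt S * G.allMin R I S

/-- The expectation of `popVal` for random arcs. -/
noncomputable def popMean (h : Finset E → ℝ) (t : ℕ) : ℝ := ∑ S, G.wt S * G.popVal R G.wt h t S

variable {G R}

lemma allMin_insert (I : Finset (Finset V)) (S : Finset E) :
    G.allMin R (insert C I) S = G.allMin R {C} S * G.allMin R I S := by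
  simp only [allMin, Finset.mem_insert, forall_eq_or_imp, Finset.mem_singleton, forall_eq]
  by_cases h : G.MinCluster R S C <;> simp [h]

/-- On the event that the sets in `I` are minimal clusters, all of them may be popped first. What
comes after these `I.card` pops is a run from fresh arcs: whether `C` is a minimal cluster depends
only on the arcs that start in `C`, and these are resampled. -/
lemma sum_allMin_mul_popVal (h : Finset E → ℝ) (I : Finset (Finset V)) (t : ℕ) :
    ∑ S, G.wt S * (G.allMin R I S * G.popVal R G.wt h t S) =
      G.allMinProb R I * if I.card ≤ t then G.popMean R h (t - I.card) else 0 := by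
  induction I using Finset.induction_on generalizing t with
  | empty => simp [allMin, allMinProb, popMean, sum_wt]
  | insert C I hCI ih =>
    by_cases hdis : ∀ D ∈ I, Disjoint C D
    · have hself : ∀ S S', G.allMin R {C} (G.mix C S' S) = G.allMin R {C} S := fun S S' => by
        simp only [allMin, Finset.mem_singleton, forall_eq, minCluster_mix_self]
      have hother : ∀ S S', G.allMin R I (G.mix C S S') = G.allMin R I S := fun S S' => by
        unfold allMin
        refine if_congr (forall₂_congr fun D hD => ?_) rfl rfl
        exact minCluster_mix_of_disjoint (hdis D hD)
      have hprob : G.allMinProb R (insert C I) = G.allMinProb R {C} * G.allMinProb R I := by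
        rw [allMinProb, allMinProb, allMinProb, ← sum_mul_resample C _ _ hself]
        refine Finset.sum_congr rfl fun S _ => ?_
        simp only [hother, ← Finset.sum_mul, sum_wt, one_mul, allMin_insert]
      rw [Finset.card_insert_of_notMem hCI]
      cases t with
      | zero =>
        rw [if_neg (by lia), mul_zero]
        refine Finset.sum_eq_zero fun S _ => ?_
        unfold allMin
        split_ifs with h'
        · rw [popVal, if_pos ⟨C, h' C (Finset.mem_insert_self _ _)⟩]; simp
        · simp
      | succ t =>
        have h1 : ∀ S, G.allMin R (insert C I) S * G.popVal R G.wt h (t + 1) S =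
            G.allMin R {C} S * ∑ S', G.wt S' *
              (G.allMin R I (G.mix C S S') * G.popVal R G.wt h t (G.mix C S S')) := fun S => by
          rw [allMin_insert]
          simp only [hother]
          by_cases hC : G.MinCluster R S C
          · rw [popVal_eq _ _ _ hC, mul_assoc, Finset.mul_sum (a := G.allMin R I S)]
            congr 1
            exact Finset.sum_congr rfl fun S' _ => by ring
          · simp [allMin, hC]
        simp only [h1]
        rw [sum_mul_resample C (fun X => G.allMin R I X * G.popVal R G.wt h t X) _ hself, ih,
          hprob, ← allMinProb, mul_assoc]
        simp only [Nat.add_le_add_iff_right, Nat.add_sub_add_right]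
    · push Not at hdis
      obtain ⟨D, hD, hCD⟩ := hdis
      have h0 : ∀ S, G.allMin R (insert C I) S = 0 := fun S => if_neg fun h' =>
        hCD ((h' C (Finset.mem_insert_self _ _)).disjoint (h' D (Finset.mem_insert_of_mem hD))
          fun e => hCI (e ▸ hD))
      simp [h0, allMinProb]

variable [Fintype V]

variable (G R) in
/-- The signed probabilities of the inclusion-exclusion formula. -/
noncomputable def signedProb (I : Finset (Finset V)) : ℝ := (-1) ^ I.card * G.allMinProb R I

variable (G R) in
/-- The probability that every vertex has a path to the roots `R`. -/
noncomputable def rootProb : ℝ := ∑ S, if G.RootConn R S then G.wt S else 0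

variable (G R) in
/-- The set of minimal clusters. -/
noncomputable def clusters (S : Finset E) : Finset (Finset V) :=
  Finset.univ.filter (G.MinCluster R S)

lemma clusters_eq_empty : G.clusters R S = ∅ ↔ G.RootConn R S := by
  rw [rootConn_iff, clusters, Finset.filter_eq_empty_iff]
  simp

lemma sum_allMin_mul (f : Finset (Finset V) → ℝ) (S : Finset E) :
    ∑ I, f I * G.allMin R I S = ∑ I ∈ (G.clusters R S).powerset, f I := by
  have : ∀ I, f I * G.allMin R I S = if I ⊆ G.clusters R S then f I else 0 := fun I => by
    simp only [allMin, clusters, Finset.subset_iff, Finset.mem_filter, Finset.mem_univ, true_and]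
    split_ifs <;> simp
  simp only [this, Finset.sum_ite, Finset.sum_const_zero, add_zero]
  refine Finset.sum_congr ?_ fun _ _ => rfl
  ext I; simp

/-- Inclusion-exclusion. -/
lemma sum_sign_allMin (S : Finset E) :
    ∑ I, (-1) ^ I.card * G.allMin R I S = if G.RootConn R S then 1 else 0 := by
  rw [sum_allMin_mul]
  have := @Finset.sum_powerset_neg_one_pow_card _ _ (G.clusters R S)
  have h2 : ∑ I ∈ (G.clusters R S).powerset, (-1 : ℝ) ^ I.card =
      ((∑ I ∈ (G.clusters R S).powerset, (-1) ^ I.card : ℤ) : ℝ) := by push_cast; rfl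
  rw [h2, this]
  simp only [clusters_eq_empty]
  split_ifs <;> simp

lemma sum_signedProb : ∑ I, G.signedProb R I = G.rootProb R := by
  simp only [signedProb, allMinProb, Finset.mul_sum, rootProb]
  rw [Finset.sum_comm]
  refine Finset.sum_congr rfl fun S _ => ?_
  have := sum_sign_allMin (G := G) (R := R) S
  calc _ = G.wt S * ∑ I, (-1) ^ I.card * G.allMin R I S := by
        rw [Finset.mul_sum]; exact Finset.sum_congr rfl fun I _ => by ring
    _ = _ := by rw [this]; split_ifs <;> simp

/-- The recursion for the probabilities of popping exactly `t` clusters. It is inclusion-exclusion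
over the sets of minimal clusters, and the right-hand side says that a run of `t` pops from a
root-connected set happens only for `t = 0`. -/
lemma sum_signedProb_mul_popMean (h : Finset E → ℝ) (t : ℕ) :
    ∑ I, G.signedProb R I * (if I.card ≤ t then G.popMean R h (t - I.card) else 0) =
      if t = 0 then ∑ S, (if G.RootConn R S then G.wt S * h S else 0) else 0 := by
  have h1 : ∀ I, G.signedProb R I * (if I.card ≤ t then G.popMean R h (t - I.card) else 0) =
      ∑ S, (-1) ^ I.card * G.allMin R I S * (G.wt S * G.popVal R G.wt h t S) := fun I => by
    rw [signedProb, mul_assoc, ← sum_allMin_mul_popVal, Finset.mul_sum]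
    exact Finset.sum_congr rfl fun S _ => by ring
  simp only [h1]
  rw [Finset.sum_comm]
  simp only [← Finset.sum_mul, sum_sign_allMin]
  cases t with
  | zero =>
    rw [if_pos rfl]
    refine Finset.sum_congr rfl fun S _ => ?_
    split_ifs with hS
    · rw [popVal, if_neg (rootConn_iff.1 hS), one_mul]
    · simp
  | succ t =>
    rw [if_neg (by lia)]
    refine Finset.sum_eq_zero fun S _ => ?_
    split_ifs with hS
    · rw [popVal, dif_neg (rootConn_iff.1 hS)]; simp
    · simp

/-- The number of popped clusters is independent of the final set of arcs, and the latter has the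
law of the surviving arcs conditioned on root-connectedness: the recursion for `popMean h` is
linear, and depends on `h` only by its inhomogeneous term. -/
lemma popMean_mul_rootProb (h : Finset E → ℝ) (t : ℕ) :
    G.popMean R h t * G.rootProb R =
      G.popMean R (fun _ => 1) t * ∑ S, (if G.RootConn R S then G.wt S * h S else 0) := by
  induction t using Nat.strong_induction_on with
  | _ t ih =>
    have key : ∀ h : Finset E → ℝ, G.popMean R h t =
        (if t = 0 then ∑ S, (if G.RootConn R S then G.wt S * h S else 0) else 0) -
        ∑ I ∈ Finset.univ.erase ∅, G.signedProb R I *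
          (if I.card ≤ t then G.popMean R h (t - I.card) else 0) := fun h => by
      rw [← sum_signedProb_mul_popMean, ← Finset.add_sum_erase _ _ (Finset.mem_univ ∅)]
      simp [signedProb, allMinProb, allMin, sum_wt]
    rw [key h, key (fun _ => 1), sub_mul, sub_mul, Finset.sum_mul, Finset.sum_mul]
    congr 1
    · split_ifs
      · simp only [mul_one]; rw [rootProb]; ring
      · simp
    · refine Finset.sum_congr rfl fun I hI => ?_
      have hI' : 0 < I.card := Finset.card_pos.2 (Finset.nonempty_iff_ne_empty.2
        (Finset.ne_of_mem_erase hI))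
      split_ifs with hIt
      · rw [mul_assoc, ih _ (by lia), mul_assoc]
      · simp

end Real

end Popping

end Network

/-! ### The number of pops -/

namespace Network

section Termination

open Classical Filter Topology

variable {V E : Type} [Fintype E] [Fintype V] {G : Network V E} {R : Finset V} {S : Finset E}

variable (G R) in
/-- The probability that there is exactly one minimal cluster. -/
noncomputable def oneProb : ℝ := ∑ S, if (G.clusters R S).card = 1 then G.wt S else 0

lemma sum_powerset_sign_mul_card {α : Type*} (M : Finset α) :
    ∑ I ∈ M.powerset, (-1 : ℝ) ^ I.card * I.card = if M.card = 1 then -1 else 0 := by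
  induction M using Finset.induction_on with
  | empty => simp
  | insert C M hC ih =>
    have h0 : ∑ I ∈ M.powerset, (-1 : ℝ) ^ I.card = if M = ∅ then 1 else 0 := by
      have := @Finset.sum_powerset_neg_one_pow_card _ _ M
      have h2 : ∑ I ∈ M.powerset, (-1 : ℝ) ^ I.card =
        ((∑ I ∈ M.powerset, (-1) ^ I.card : ℤ) : ℝ) := by push_cast; rfl
      rw [h2, this]; split_ifs <;> simp
    rw [Finset.sum_powerset_insert hC, ← Finset.sum_add_distrib]
    have : ∀ I ∈ M.powerset, (-1 : ℝ) ^ I.card * I.card +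
        (-1 : ℝ) ^ (insert C I).card * (insert C I).card = - (-1 : ℝ) ^ I.card := fun I hI => by
      rw [Finset.card_insert_of_notMem fun h => hC (Finset.mem_powerset.1 hI h)]
      push_cast; ring
    rw [Finset.sum_congr rfl this, Finset.sum_neg_distrib, h0,
      Finset.card_insert_of_notMem hC]
    simp only [Nat.add_eq_right, Finset.card_eq_zero]
    split_ifs <;> simp

lemma sum_signedProb_mul_card : ∑ I, G.signedProb R I * I.card = - G.oneProb R := by
  simp only [signedProb, allMinProb, Finset.mul_sum, Finset.sum_mul, oneProb]
  rw [Finset.sum_comm, ← Finset.sum_neg_distrib]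
  refine Finset.sum_congr rfl fun S _ => ?_
  calc _ = G.wt S * ∑ I : Finset (Finset V), ((-1) ^ I.card * (I.card : ℝ)) * G.allMin R I S := by
        rw [Finset.mul_sum]; exact Finset.sum_congr rfl fun I _ => by ring
    _ = _ := by
        rw [sum_allMin_mul, sum_powerset_sign_mul_card]; split_ifs <;> simp

/-- The probability that root-connectedness is reached after fewer than `N` pops. -/
noncomputable def doneProb (G : Network V E) (R : Finset V) (N : ℕ) : ℝ :=
  ∑ t ∈ Finset.range N, G.popMean R (fun _ => 1) t

lemma sum_range_ite_sub (a : ℕ → ℝ) (k N : ℕ) :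
    ∑ t ∈ Finset.range N, (if k ≤ t then a (t - k) else 0) =
      ∑ t ∈ Finset.range (N - k), a t := by
  induction N with
  | zero => simp
  | succ N ih =>
    rw [Finset.sum_range_succ, ih]
    split_ifs with h
    · rw [Nat.sub_add_comm h, Finset.sum_range_succ]
    · rw [show N - k = 0 by lia, show N + 1 - k = 0 by lia]; simp

lemma sum_signedProb_mul_doneProb (N : ℕ) :
    ∑ I, G.signedProb R I * G.doneProb R (N + 1 - I.card) = G.rootProb R := by
  simp only [doneProb, ← sum_range_ite_sub, Finset.mul_sum]
  rw [Finset.sum_comm]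
  simp only [sum_signedProb_mul_popMean]
  rw [Finset.sum_ite_eq' (Finset.range (N + 1)) 0]
  simp [rootProb]

section

variable (hp : ∀ e, 0 ≤ G.fail e ∧ G.fail e ≤ 1)
include hp

lemma popVal_nonneg {h : Finset E → ℝ} (hh : ∀ S, 0 ≤ h S) (t : ℕ) (S : Finset E) :
    0 ≤ G.popVal R G.wt h t S := by
  induction t generalizing S with
  | zero => rw [popVal]; split_ifs; exacts [le_rfl, hh _]
  | succ t ih =>
    rw [popVal]
    split_ifs
    · exact Finset.sum_nonneg fun _ _ => mul_nonneg (wt_nonneg hp _) (ih _)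
    · exact le_rfl

lemma sum_popVal_le_one (N : ℕ) (S : Finset E) :
    ∑ t ∈ Finset.range N, G.popVal R G.wt (fun _ => 1) t S ≤ 1 := by
  induction N generalizing S with
  | zero => simp
  | succ N ih =>
    rw [Finset.sum_range_succ']
    by_cases hC : ∃ C, G.MinCluster R S C
    · simp only [popVal, dif_pos hC, if_pos hC, add_zero]
      rw [Finset.sum_comm]
      simp only [← Finset.mul_sum]
      calc _ ≤ ∑ S', G.wt S' * 1 :=
            Finset.sum_le_sum fun S' _ => mul_le_mul_of_nonneg_left (ih _) (wt_nonneg hp _)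
        _ = 1 := by simp [sum_wt]
    · simp [popVal, hC]

lemma popMean_nonneg {h : Finset E → ℝ} (hh : ∀ S, 0 ≤ h S) (t : ℕ) : 0 ≤ G.popMean R h t :=
  Finset.sum_nonneg fun _ _ => mul_nonneg (wt_nonneg hp _) (popVal_nonneg hp hh _ _)

lemma doneProb_le_one (N : ℕ) : G.doneProb R N ≤ 1 := by
  unfold doneProb popMean
  rw [Finset.sum_comm]
  simp only [← Finset.mul_sum]
  calc _ ≤ ∑ S', G.wt S' * 1 := Finset.sum_le_sum fun S' _ =>
        mul_le_mul_of_nonneg_left (sum_popVal_le_one hp _ _) (wt_nonneg hp _)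
    _ = 1 := by simp [sum_wt]

lemma doneProb_mono : Monotone (G.doneProb R) := monotone_nat_of_le_succ fun N => by
  rw [doneProb, doneProb, Finset.sum_range_succ]
  linarith [popMean_nonneg (R := R) hp (h := fun _ => 1) (fun _ => zero_le_one) N]

variable (hZ : 0 < G.rootProb R)
include hZ

/-- Popping terminates almost surely. -/
lemma tendsto_doneProb : Tendsto (G.doneProb R) atTop (𝓝 1) := by
  have h1 := tendsto_atTop_ciSup (doneProb_mono (R := R) hp)
    ⟨1, by rintro _ ⟨N, rfl⟩; exact doneProb_le_one hp N⟩
  set L := ⨆ N, G.doneProb R N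
  have h2 : Tendsto (fun N => ∑ I, G.signedProb R I * G.doneProb R (N + 1 - I.card)) atTop
      (𝓝 (∑ I, G.signedProb R I * L)) := by
    refine tendsto_finsetSum _ fun I _ => Tendsto.const_mul _ (h1.comp ?_)
    exact (tendsto_sub_atTop_nat _).comp (tendsto_add_atTop_nat 1)
  simp only [sum_signedProb_mul_doneProb] at h2
  -- the limit `L` satisfies `rootProb * L = rootProb`
  have h3 := tendsto_nhds_unique h2 tendsto_const_nhds
  rw [← Finset.sum_mul, sum_signedProb] at h3
  have : L = 1 := by nlinarith
  rwa [this] at h1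

/-- The expected number of popped clusters is at most (in fact equal to) the probability that there
is exactly one minimal cluster, divided by the probability that there is none. -/
lemma sum_one_sub_doneProb_le (N : ℕ) :
    (∑ T ∈ Finset.range N, (1 - G.doneProb R (T + 1))) * G.rootProb R ≤ G.oneProb R := by
  set D : ℕ → ℝ := fun N => ∑ T ∈ Finset.range N, (1 - G.doneProb R (T + 1)) with hD
  have hnn : ∀ T, 0 ≤ 1 - G.doneProb R (T + 1) := fun T => by
    linarith [doneProb_le_one (R := R) hp (T + 1)]
  have hmono : Monotone D := monotone_nat_of_le_succ fun N => by
    simp only [hD, Finset.sum_range_succ]; linarith [hnn N]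
  have hshift : ∀ k N, k ≤ N → ∑ T ∈ Finset.range N, (1 - G.doneProb R (T + 1 - k)) =
      k + D (N - k) := fun k N hkN => by
    have e : ∀ T ∈ Finset.range N, 1 - G.doneProb R (T + 1 - k) =
        1 - if k ≤ T then G.doneProb R (T - k + 1) else 0 := fun T _ => by
      split_ifs with hkT
      · rw [Nat.sub_add_comm hkT]
      · rw [show T + 1 - k = 0 by lia]; simp [doneProb]
    rw [Finset.sum_congr rfl e, Finset.sum_sub_distrib,
      sum_range_ite_sub (fun t => G.doneProb R (t + 1)), hD]
    simp only [Finset.sum_sub_distrib, Finset.sum_const, Finset.card_range, nsmul_eq_mul, mul_one]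
    push_cast [Nat.cast_sub hkN]; ring
  set K := Fintype.card (Finset V)
  have hcard : ∀ I : Finset (Finset V), I.card ≤ K := fun I => Finset.card_le_univ I
  -- the summed recursion: shifting by `I.card` costs `I.card`, and these costs add up to `oneProb`
  have hsum : ∀ N, K ≤ N → ∑ I, G.signedProb R I * D (N - I.card) = G.oneProb R := fun N hN => by
    have h1 : ∑ I, G.signedProb R I * (I.card + D (N - I.card)) = 0 := by
      have : ∀ I ∈ Finset.univ, G.signedProb R I * (I.card + D (N - I.card)) =
          ∑ T ∈ Finset.range N, (G.signedProb R I -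
            G.signedProb R I * G.doneProb R (T + 1 - I.card)) := fun I _ => by
        rw [← hshift _ _ ((hcard I).trans hN), Finset.mul_sum]
        exact Finset.sum_congr rfl fun T _ => by ring
      rw [Finset.sum_congr rfl this, Finset.sum_comm]
      refine Finset.sum_eq_zero fun T _ => ?_
      rw [Finset.sum_sub_distrib, sum_signedProb, sum_signedProb_mul_doneProb, sub_self]
    simp only [mul_add, Finset.sum_add_distrib, sum_signedProb_mul_card] at h1
    linarith
  -- the summands tend to `0`, so all the `D (N - I.card)` are asymptotically equal
  have hlim : Tendsto (fun N => 1 - G.doneProb R (N + 1)) atTop (𝓝 0) := by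
    have := (tendsto_doneProb hp hZ).comp (tendsto_add_atTop_nat 1)
    simpa using this.const_sub 1
  have hdiff : ∀ k, Tendsto (fun N => D (N + K) - D (N + K - k)) atTop (𝓝 0) ∨ K < k := by
    intro k
    induction k with
    | zero => left; simp
    | succ k ih =>
      rcases ih with ih | ih
      · by_cases hk : K < k + 1
        · exact Or.inr hk
        · left
          have h2 : ∀ N, D (N + K) - D (N + K - (k + 1)) = (D (N + K) - D (N + K - k)) +
              (1 - G.doneProb R (N + K - (k + 1) + 1)) := fun N => by
            have : D (N + K - k) = D (N + K - (k + 1)) +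
                (1 - G.doneProb R (N + K - (k + 1) + 1)) := by
              rw [show N + K - k = N + K - (k + 1) + 1 by lia]
              simp only [hD, Finset.sum_range_succ]
            rw [this]; ring
          simp only [h2]
          have h3 := hlim.comp ((tendsto_sub_atTop_nat (k + 1)).comp (tendsto_add_atTop_nat K))
          simpa using ih.add h3
      · right; lia
  have hconv : Tendsto (fun N => D (N + K) * G.rootProb R) atTop (𝓝 (G.oneProb R)) := by
    have h1 : Tendsto (fun N => G.oneProb R +
        ∑ I, G.signedProb R I * (D (N + K) - D (N + K - I.card))) atTop
        (𝓝 (G.oneProb R + ∑ I : Finset (Finset V), G.signedProb R I * 0)) := by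
      refine tendsto_const_nhds.add (tendsto_finsetSum _ fun I _ => Tendsto.const_mul _ ?_)
      exact (hdiff I.card).resolve_right (by simpa using hcard I)
    simp only [mul_zero, Finset.sum_const_zero, add_zero] at h1
    refine h1.congr fun N => ?_
    simp only [mul_sub, Finset.sum_sub_distrib]
    rw [hsum (N + K) (by lia), ← Finset.sum_mul, sum_signedProb]
    ring
  refine ge_of_tendsto hconv (eventually_atTop.2 ⟨N, fun M hM => ?_⟩)
  exact mul_le_mul_of_nonneg_right (hmono (by lia)) hZ.le

end

end Termination

end Network

/-! ### Bi-directed networks have few pops -/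

namespace Network

section Reversal

open Classical

variable {V E : Type} {G : Network V E} {R W : Finset V} {S : Finset E} {τ : E → E}

/-- Arcs inside `W` are replaced by their twins. -/
noncomputable def twinIn (G : Network V E) (τ : E → E) (W : Finset V) (e : E) : E :=
  if G.fst e ∈ W ∧ G.snd e ∈ W then τ e else e

lemma Reaches.mono {S' : Finset E} (h : S ⊆ S') {u v : V} (huv : G.Reaches S u v) :
    G.Reaches S' u v :=
  Relation.ReflTransGen.mono (fun _ _ ⟨e, he, h1, h2⟩ => ⟨e, h he, h1, h2⟩) _ _ huv

lemma exists_arc_leaving {u v : V} {U : Set V} (h : G.Reaches S u v) (hu : u ∈ U) (hv : v ∉ U) :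
    ∃ a ∈ S, G.fst a ∈ U ∧ G.snd a ∉ U := by
  induction h with
  | refl => exact absurd hu hv
  | @tail b c _ hbc ih =>
    by_cases hb : b ∈ U
    · obtain ⟨a, ha, rfl, rfl⟩ := hbc
      exact ⟨a, ha, hb, hv⟩
    · exact ih hb

section

variable (hτ : Function.Involutive τ)
  (hG : ∀ e, G.fst (τ e) = G.snd e ∧ G.snd (τ e) = G.fst e ∧ G.fail (τ e) = G.fail e)
include hτ hG

lemma twinIn_involutive (W : Finset V) : Function.Involutive (G.twinIn τ W) := by
  intro e
  unfold twinIn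
  by_cases h : G.fst e ∈ W ∧ G.snd e ∈ W
  · rw [if_pos h, if_pos ⟨by rw [(hG e).1]; exact h.2, by rw [(hG e).2.1]; exact h.1⟩, hτ e]
  · rw [if_neg h, if_neg h]

variable [Fintype E]

/-- The arcs inside `W` are reversed. -/
noncomputable def reverseIn (G : Network V E) (τ : E → E) (W : Finset V)
    (S : Finset E) : Finset E :=
  Finset.univ.filter fun e => G.twinIn τ W e ∈ S

omit hτ hG in
lemma mem_reverseIn {e : E} : e ∈ G.reverseIn τ W S ↔ G.twinIn τ W e ∈ S := by simp [reverseIn]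

omit hτ hG in
lemma mem_reverseIn_of_notMem {e : E} (h : G.fst e ∉ W ∨ G.snd e ∉ W) :
    e ∈ G.reverseIn τ W S ↔ e ∈ S := by
  rw [mem_reverseIn, twinIn, if_neg]
  tauto

lemma reverseIn_reverseIn : G.reverseIn τ W (G.reverseIn τ W S) = S := by
  ext e
  rw [mem_reverseIn, mem_reverseIn, twinIn_involutive hτ hG]

lemma wt_reverseIn : G.wt (G.reverseIn τ W S) = G.wt S := by
  rw [wt_eq_prod, wt_eq_prod]
  refine Fintype.prod_equiv (twinIn_involutive hτ hG W).toPerm _ _ fun e => ?_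
  have h : G.fail (G.twinIn τ W e) = G.fail e := by
    unfold twinIn; split_ifs; exacts [(hG e).2.2, rfl]
  simp [mem_reverseIn, h]

variable [Fintype V]

/-- The map by which the expected number of popped clusters is bounded: a set `S` of arcs with a
unique minimal cluster `C` is encoded by a root-connected set `S'`, a vertex `u` and an arc `a`.
The arc `a` leaves the set of vertices without path to the roots, `S'` arises from `S` by
reversing all arcs inside the set `W` of vertices that are reachable from the tail of `a`, and by
adding `a`; and `u` is a vertex of `C`, which serves to find `W` again when `S'` and `a` are given. -/
lemma exists_encoding (hconn : G.RootConn R Finset.univ) {q : ℝ}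
    (hp : ∀ e, 0 ≤ G.fail e ∧ G.fail e ≤ q) (hq : q ≤ 1) {C : Finset V}
    (hC : G.MinCluster R S C) (huniq : ∀ D, G.MinCluster R S D → D = C) :
    ∃ x : Finset E × V × E, G.RootConn R x.1 ∧ (1 - q) * G.wt S ≤ G.wt x.1 ∧
      G.reverseIn τ (G.reachSet (x.1.erase x.2.2) x.2.1) (x.1.erase x.2.2) = S := by
  obtain ⟨u, hu⟩ := hC.nonempty
  -- the vertices without a path to the roots; all of them lead to the only minimal cluster
  set U : Set V := {v | ¬ ∃ r ∈ R, G.Reaches S v r} with hU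
  have hCreach : ∀ x ∈ U, ∀ y ∈ C, G.Reaches S x y := fun x hx y hy => by
    obtain ⟨D, hD, hD'⟩ := exists_minCluster_subset (G := G) (R := R) (D := G.reachSet S x)
      ⟨x, mem_reachSet.2 .refl⟩ (fun v hv hR => hx ⟨v, hR, mem_reachSet.1 hv⟩) reachSet_closed
    rw [huniq D hD'] at hD
    exact mem_reachSet.1 (hD hy)
  have huU : u ∈ U := fun ⟨r, hr, hur⟩ => hC.notMem_root r (hur.mem_of_closed hC.closed hu) hr
  obtain ⟨r₀, hr₀, hur₀⟩ := hconn u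
  obtain ⟨a, -, ha1, ha2⟩ := exists_arc_leaving hur₀ huU
    (fun h : r₀ ∈ U => h ⟨r₀, hr₀, .refl⟩)
  have ha2' : ∃ r ∈ R, G.Reaches S (G.snd a) r := by simpa [hU] using ha2
  have haS : a ∉ S := fun h => by
    obtain ⟨r, hr, h'⟩ := ha2'
    exact ha1 ⟨r, hr, .head ⟨a, h, rfl, rfl⟩ h'⟩
  set W := G.reachSet S (G.fst a) with hW
  have hWcl : ∀ x ∈ W, ∀ v, G.Arc S x v → v ∈ W := reachSet_closed
  have hWU : ∀ x ∈ W, x ∈ U := fun x hx ⟨r, hr, hxr⟩ =>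
    ha1 ⟨r, hr, (mem_reachSet.1 hx).trans hxr⟩
  have hCW : ∀ y ∈ C, y ∈ W := fun y hy => mem_reachSet.2 (hCreach _ ha1 y hy)
  have haF : a ∉ G.reverseIn τ W S := by
    rw [mem_reverseIn_of_notMem (Or.inr fun h => ha2 (hWU _ h))]; exact haS
  -- paths inside `W` are reversed
  have hrev : ∀ x ∈ W, ∀ y, G.Reaches S x y → G.Reaches (G.reverseIn τ W S) y x := by
    intro x hx y hxy
    induction hxy with
    | refl => exact .refl
    | @tail b c hxb hbc ih =>
      have hb : b ∈ W := Reaches.mem_of_closed hxb hWcl hx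
      have hc : c ∈ W := hWcl b hb c hbc
      obtain ⟨e, he, rfl, rfl⟩ := hbc
      refine .head ⟨τ e, ?_, (hG e).1, (hG e).2.1⟩ ih
      rw [mem_reverseIn, twinIn, if_pos ⟨by rw [(hG e).1]; exact hc, by rw [(hG e).2.1]; exact hb⟩,
        hτ e]
      exact he
  -- no arc leaves `W`, before or after the reversal, so `W` is what `u` reaches afterwards
  have hFcl : ∀ x ∈ W, ∀ v, G.Arc (G.reverseIn τ W S) x v → v ∈ W := by
    rintro x hx v ⟨e, he, rfl, rfl⟩
    by_contra hv
    rw [mem_reverseIn_of_notMem (Or.inr hv)] at he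
    exact hv (hWcl _ hx _ ⟨e, he, rfl, rfl⟩)
  have hWeq : G.reachSet (G.reverseIn τ W S) u = W := by
    ext x
    rw [mem_reachSet]
    refine ⟨fun h => h.mem_of_closed hFcl (hCW u hu), fun hx => ?_⟩
    exact hrev x hx u (hCreach x (hWU x hx) u hu)
  have hdec : (insert a (G.reverseIn τ W S)).erase a = G.reverseIn τ W S :=
    Finset.erase_insert haF
  have hsub : G.reverseIn τ W S ⊆ insert a (G.reverseIn τ W S) := Finset.subset_insert _ _
  have hkeep : ∀ x y, x ∉ W → G.Arc S x y → G.Arc (insert a (G.reverseIn τ W S)) x y := by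
    rintro x y hx ⟨e, he, rfl, rfl⟩
    exact ⟨e, hsub ((mem_reverseIn_of_notMem (Or.inl hx)).2 he), rfl, rfl⟩
  refine ⟨(insert a (G.reverseIn τ W S), u, a), ?_, ?_, ?_⟩
  · have hout : ∀ x, ∀ r ∈ R, G.Reaches S x r →
        G.Reaches (insert a (G.reverseIn τ W S)) x r := by
      intro x r hr hxr
      induction hxr using Relation.ReflTransGen.head_induction_on with
      | refl => exact .refl
      | @head b c hbc hcr ih =>
        exact .head (hkeep b c (fun hb => hWU b hb ⟨r, hr, .head hbc hcr⟩) hbc) ih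
    obtain ⟨r, hr, har⟩ := ha2'
    -- after the reversal, `W` leads to the tail of `a`, and on by `a`
    have hin : ∀ x ∈ W, G.Reaches (insert a (G.reverseIn τ W S)) x r := fun x hx =>
      ((hrev _ (mem_reachSet.2 .refl) x (mem_reachSet.1 hx)).mono hsub).trans
        (.head ⟨a, Finset.mem_insert_self _ _, rfl, rfl⟩ (hout _ r hr har))
    intro v
    by_cases hv : v ∈ U
    · refine ⟨r, hr, ?_⟩
      have hvu := hCreach v hv u hu
      induction hvu using Relation.ReflTransGen.head_induction_on with
      | refl => exact hin u (hCW u hu)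
      | @head b c hbc hcu ih =>
        by_cases hb : b ∈ W
        · exact hin b hb
        · refine .head (hkeep b c hb hbc) (ih ?_)
          rintro ⟨r', hr', hcr'⟩
          exact hv ⟨r', hr', .head hbc hcr'⟩
    · have hv' : ∃ r ∈ R, G.Reaches S v r := by simpa [hU] using hv
      obtain ⟨r', hr', hvr'⟩ := hv'
      exact ⟨r', hr', hout v r' hr' hvr'⟩
  -- the reversal preserves the weight, and adding `a` changes its factor `fail a` to `1 - fail a`
  · have h1 : G.wt (insert a (G.reverseIn τ W S)) * G.fail a = G.wt S * (1 - G.fail a) := by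
      rw [← wt_reverseIn hτ hG (W := W) (S := S), wt_eq_prod, wt_eq_prod,
        ← Finset.mul_prod_erase _ _ (Finset.mem_univ a),
        ← Finset.mul_prod_erase Finset.univ (fun e => if e ∈ G.reverseIn τ W S then _ else _)
          (Finset.mem_univ a)]
      simp only [Finset.mem_insert_self, if_true, haF, if_false]
      have : ∀ e ∈ Finset.univ.erase a, (if e ∈ insert a (G.reverseIn τ W S) then
          1 - G.fail e else G.fail e) = if e ∈ G.reverseIn τ W S then
          1 - G.fail e else G.fail e := fun e he => by
        simp [Finset.ne_of_mem_erase he]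
      rw [Finset.prod_congr rfl this]
      ring
    have hw := wt_nonneg (G := G) (fun e => ⟨(hp e).1, (hp e).2.trans hq⟩) S
    have hw' := wt_nonneg (G := G) (fun e => ⟨(hp e).1, (hp e).2.trans hq⟩)
      (insert a (G.reverseIn τ W S))
    calc (1 - q) * G.wt S ≤ G.wt S * (1 - G.fail a) := by nlinarith [(hp a).2]
      _ = G.wt (insert a (G.reverseIn τ W S)) * G.fail a := h1.symm
      _ ≤ _ := by nlinarith [(hp a).2]
  · simp only [hdec, hWeq]
    exact reverseIn_reverseIn hτ hG

end

variable [Fintype E] [Fintype V]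

/-- In a bi-directed network, having exactly one minimal cluster is not much more likely than
having none: the encoding `exists_encoding` is injective, and loses at most the factor `1 - q`. -/
lemma IsBidirected.oneProb_le (hbi : G.IsBidirected) (hconn : G.RootConn R Finset.univ) {q : ℝ}
    (hp : ∀ e, 0 ≤ G.fail e ∧ G.fail e ≤ q) (hq : q ≤ 1) :
    (1 - q) * G.oneProb R ≤ Fintype.card V * Fintype.card E * G.rootProb R := by
  obtain ⟨τ, hτ, hG⟩ := hbi
  have hp' : ∀ e, 0 ≤ G.fail e ∧ G.fail e ≤ 1 := fun e => ⟨(hp e).1, (hp e).2.trans hq⟩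
  have henc : ∀ S ∈ Finset.univ.filter (fun S => (G.clusters R S).card = 1),
      ∃ x : Finset E × V × E, G.RootConn R x.1 ∧ (1 - q) * G.wt S ≤ G.wt x.1 ∧
      G.reverseIn τ (G.reachSet (x.1.erase x.2.2) x.2.1) (x.1.erase x.2.2) = S := by
    intro S hS
    obtain ⟨C, hC⟩ := Finset.card_eq_one.1 (Finset.mem_filter.1 hS).2
    have hmem : ∀ D, G.MinCluster R S D ↔ D = C := fun D => by
      rw [← Finset.mem_singleton, ← hC]; simp [clusters]
    exact exists_encoding hτ hG hconn hp hq ((hmem C).2 rfl) fun D hD => (hmem D).1 hD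
  rw [oneProb, ← Finset.sum_filter, Finset.mul_sum]
  rcases (Finset.univ.filter (fun S => (G.clusters R S).card = 1)).eq_empty_or_nonempty with
    h0 | ⟨S₀, hS₀⟩
  · rw [h0, Finset.sum_empty, rootProb, ← Finset.sum_filter]
    have := Finset.sum_nonneg fun S (_ : S ∈ Finset.univ.filter (G.RootConn R)) =>
      wt_nonneg hp' S
    positivity
  obtain ⟨x₀, -⟩ := henc S₀ hS₀
  have : Nonempty (Finset E × V × E) := ⟨x₀⟩
  choose! φ h1 h2 h3 using henc
  calc _ ≤ ∑ S ∈ Finset.univ.filter (fun S => (G.clusters R S).card = 1), G.wt (φ S).1 :=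
        Finset.sum_le_sum fun S hS => h2 S hS
    _ = ∑ x ∈ (Finset.univ.filter (fun S => (G.clusters R S).card = 1)).image φ, G.wt x.1 := by
        rw [Finset.sum_image]
        intro S hS S' hS' h
        rw [← h3 S hS, ← h3 S' hS', h]
    _ ≤ ∑ x ∈ (Finset.univ.filter (G.RootConn R)) ×ˢ (Finset.univ : Finset (V × E)),
          G.wt x.1 := by
        refine Finset.sum_le_sum_of_subset_of_nonneg ?_ fun x _ _ => wt_nonneg hp' _
        intro x hx
        obtain ⟨S, hS, rfl⟩ := Finset.mem_image.1 hx
        simpa using h1 S hS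
    _ = _ := by
        rw [Finset.sum_product, rootProb, ← Finset.sum_filter, Finset.mul_sum]
        simp

end Reversal

end Network

/-! ### Programs that pop clusters -/

namespace Network

section Sampling

open Classical Filter Topology

variable {V E : Type} [Fintype E] [Fintype V] {G : Network V E} {R : Finset V}

/-- The distribution of the surviving arcs. -/
noncomputable def wtPMF (G : Network V E) (hp : ∀ e, 0 ≤ G.fail e ∧ G.fail e ≤ 1) :
    PMF (Finset E) :=
  PMF.ofFintype (fun S => ENNReal.ofReal (G.wt S)) (by
    rw [← ENNReal.ofReal_sum_of_nonneg fun S _ => wt_nonneg hp S, sum_wt, ENNReal.ofReal_one])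

lemma wtPMF_apply (hp : ∀ e, 0 ≤ G.fail e ∧ G.fail e ≤ 1) (S : Finset E) :
    G.wtPMF hp S = ENNReal.ofReal (G.wt S) := rfl

/-- The distribution of the surviving arcs, conditioned on root-connectedness. -/
noncomputable def condPMF (G : Network V E) (R : Finset V) (hp : ∀ e, 0 ≤ G.fail e ∧ G.fail e ≤ 1)
    (hZ : 0 < G.rootProb R) : PMF (Finset E) :=
  PMF.ofFintype (fun S => ENNReal.ofReal (if G.RootConn R S then G.wt S / G.rootProb R else 0)) (by
    rw [← ENNReal.ofReal_sum_of_nonneg fun S _ => by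
      split_ifs; exacts [div_nonneg (wt_nonneg hp S) hZ.le, le_rfl]]
    have : ∑ S, (if G.RootConn R S then G.wt S / G.rootProb R else 0) =
        G.rootProb R / G.rootProb R := by
      conv_rhs => rw [rootProb.eq_1 G R, Finset.sum_div]
      refine Finset.sum_congr rfl fun S _ => ?_
      split_ifs <;> simp [rootProb]
    rw [this, div_self hZ.ne', ENNReal.ofReal_one])

lemma condPMF_apply (hp : ∀ e, 0 ≤ G.fail e ∧ G.fail e ≤ 1) (hZ : 0 < G.rootProb R)
    (S : Finset E) : G.condPMF R hp hZ S =
      ENNReal.ofReal (if G.RootConn R S then G.wt S / G.rootProb R else 0) := rfl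

variable (hp : ∀ e, 0 ≤ G.fail e ∧ G.fail e ≤ 1)
include hp

lemma popVal_ennreal (g : Finset E → ℝ≥0∞) (t : ℕ) (S : Finset E) :
    G.popVal R (G.wtPMF hp) g t S = ∑ S', g S' *
      ENNReal.ofReal (G.popVal R G.wt (fun X => if X = S' then 1 else 0) t S) := by
  have hδ : ∀ S' X : Finset E, (0 : ℝ) ≤ if X = S' then 1 else 0 := fun S' X => by
    split_ifs <;> norm_num
  induction t generalizing S with
  | zero =>
    simp only [popVal]
    split_ifs with h
    · simp
    · rw [Finset.sum_eq_single S]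
      · simp
      · intro S' _ h'; simp [h'.symm]
      · simp
  | succ t ih =>
    simp only [popVal]
    split_ifs with h
    · simp only [ih, Finset.mul_sum]
      rw [Finset.sum_comm]
      refine Finset.sum_congr rfl fun S' _ => ?_
      rw [ENNReal.ofReal_sum_of_nonneg fun X _ => mul_nonneg (wt_nonneg hp _)
        (popVal_nonneg hp (hδ S') _ _), Finset.mul_sum]
      refine Finset.sum_congr rfl fun X _ => ?_
      rw [ENNReal.ofReal_mul (wt_nonneg hp _), wtPMF_apply]
      ring
    · simp

lemma ev_sum_popVal (hZ : 0 < G.rootProb R) (g : Finset E → ℝ≥0∞) (N : ℕ) :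
    ev (G.wtPMF hp) (fun S => ∑ t ∈ Finset.range N, G.popVal R (G.wtPMF hp) g t S) =
      ENNReal.ofReal (G.doneProb R N) * ev (G.condPMF R hp hZ) g := by
  have hδ : ∀ S' X : Finset E, (0 : ℝ) ≤ if X = S' then 1 else 0 := fun S' X => by
    split_ifs <;> norm_num
  rw [ev_eq_sum, ev_eq_sum, doneProb, ENNReal.ofReal_sum_of_nonneg fun t _ =>
    popMean_nonneg hp (fun _ => zero_le_one) t, Finset.sum_mul]
  simp only [Finset.mul_sum]
  rw [Finset.sum_comm]
  refine Finset.sum_congr rfl fun t _ => ?_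
  simp only [popVal_ennreal, Finset.mul_sum]
  rw [Finset.sum_comm]
  refine Finset.sum_congr rfl fun S' _ => ?_
  have h1 : G.popMean R (fun X => if X = S' then 1 else 0) t =
      G.popMean R (fun _ => 1) t *
        (if G.RootConn R S' then G.wt S' / G.rootProb R else 0) := by
    have h2 := popMean_mul_rootProb (G := G) (R := R) (fun X => if X = S' then 1 else 0) t
    rw [Finset.sum_eq_single S'] at h2
    · rw [← eq_div_iff hZ.ne', if_pos rfl, mul_one] at h2
      rw [h2]; split_ifs <;> simp [mul_div_assoc]
    · intro b _ hb; simp [hb]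
    · simp
  rw [condPMF_apply, ← mul_assoc, ← ENNReal.ofReal_mul (popMean_nonneg hp (fun _ => zero_le_one) t),
    ← h1, popMean, ENNReal.ofReal_sum_of_nonneg fun X _ => mul_nonneg (wt_nonneg hp _)
        (popVal_nonneg hp (hδ S') _ _), Finset.sum_mul]
  refine Finset.sum_congr rfl fun X _ => ?_
  rw [ENNReal.ofReal_mul (wt_nonneg hp _), wtPMF_apply]
  ring

/-- The probability that more than `t` clusters have to be popped. -/
noncomputable def stuck (G : Network V E) (R : Finset V) (t : ℕ) (S : Finset E) : ℝ :=
  1 - ∑ s ∈ Finset.range (t + 1), G.popVal R G.wt (fun _ => 1) s S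

lemma stuck_nonneg (t : ℕ) (S : Finset E) : 0 ≤ G.stuck R t S := by
  unfold stuck; linarith [sum_popVal_le_one (R := R) hp (t + 1) S]

omit hp in
lemma stuck_of_rootConn {S : Finset E} (hS : G.RootConn R S) (t : ℕ) : G.stuck R t S = 0 := by
  have h := rootConn_iff.1 hS
  rw [stuck, Finset.sum_range_succ']
  simp only [popVal, dif_neg h, if_neg h]
  simp

omit hp in
lemma stuck_zero {S : Finset E} {C : Finset V} (hC : G.MinCluster R S C) : G.stuck R 0 S = 1 := by
  have h : ∃ C, G.MinCluster R S C := ⟨C, hC⟩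
  simp [stuck, popVal, h]

lemma stuck_succ {S : Finset E} {C : Finset V} (hC : G.MinCluster R S C) (t : ℕ) :
    ENNReal.ofReal (G.stuck R (t + 1) S) =
      ev (G.wtPMF hp) fun S' => ENNReal.ofReal (G.stuck R t (G.mix C S S')) := by
  have h : ∃ C, G.MinCluster R S C := ⟨C, hC⟩
  have h1 : G.stuck R (t + 1) S = ∑ S', G.wt S' * G.stuck R t (G.mix C S S') := by
    rw [stuck, Finset.sum_range_succ']
    simp only [popVal_eq _ _ _ hC, stuck, mul_sub, Finset.sum_sub_distrib, mul_one, sum_wt,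
      Finset.mul_sum]
    rw [Finset.sum_comm]
    simp [popVal, h]
  rw [h1, ev_eq_sum, ENNReal.ofReal_sum_of_nonneg fun X _ => mul_nonneg (wt_nonneg hp _)
    (stuck_nonneg hp _ _)]
  exact Finset.sum_congr rfl fun X _ => ENNReal.ofReal_mul (wt_nonneg hp _)

lemma ev_tsum_stuck_le (hZ : 0 < G.rootProb R) :
    ev (G.wtPMF hp) (fun S => ∑' t, ENNReal.ofReal (G.stuck R t S)) ≤
      ENNReal.ofReal (G.oneProb R / G.rootProb R) := by
  have h1 : ev (G.wtPMF hp) (fun S => ∑' t, ENNReal.ofReal (G.stuck R t S)) =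
      ∑' t, ENNReal.ofReal (1 - G.doneProb R (t + 1)) := by
    unfold ev
    simp only [← ENNReal.tsum_mul_left]
    rw [ENNReal.tsum_comm]
    refine tsum_congr fun t => ?_
    have : 1 - G.doneProb R (t + 1) = ∑ S, G.wt S * G.stuck R t S := by
      simp only [stuck, mul_sub, Finset.sum_sub_distrib, mul_one, sum_wt, doneProb, popMean,
        Finset.mul_sum]
      rw [Finset.sum_comm]
    rw [this, tsum_fintype, ENNReal.ofReal_sum_of_nonneg fun X _ => mul_nonneg (wt_nonneg hp _)
      (stuck_nonneg hp _ _)]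
    exact Finset.sum_congr rfl fun X _ => (ENNReal.ofReal_mul (wt_nonneg hp _)).symm
  rw [h1]
  refine ENNReal.tsum_le_of_sum_range_le fun N => ?_
  rw [← ENNReal.ofReal_sum_of_nonneg fun T _ => by
    linarith [doneProb_le_one (R := R) hp (T + 1)]]
  refine ENNReal.ofReal_le_ofReal ?_
  rw [le_div_iff₀ hZ]
  exact sum_one_sub_doneProb_le hp hZ N

/-- Cluster popping as a program: if `P` resamples the arcs that start in the current cluster and
then finds a new minimal cluster, or that there is none, then the repetition of `P` samples from
the surviving arcs conditioned on root-connectedness. Here `J S C σ` says that the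
memory `σ` represents the set `S` of surviving arcs and the cluster `C`. -/
theorem spec_popping (hZ : 0 < G.rootProb R) {P : Prog} {b : Test} {σ₀ : State} {T : ℝ≥0∞}
    (J : Finset E → Finset V → State → Prop)
    (hJ : ∀ S C σ, J S C σ → (b.Holds σ ∧ G.MinCluster R S C) ∨ (¬ b.Holds σ ∧ G.RootConn R S))
    (hP : ∀ S C σ, J S C σ → b.Holds σ →
      Spec P σ (G.wtPMF hp) (fun S' σ' => ∃ C', J (G.mix C S S') C' σ') T)
    (hP₀ : Spec P σ₀ (G.wtPMF hp) (fun S σ => ∃ C, J S C σ) T) :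
    Spec (.seq P (.loop b P)) σ₀ (G.condPMF R hp hZ)
      (fun S σ => G.RootConn R S ∧ ∃ C, J S C σ)
      (2 + T + (T + 1) * ENNReal.ofReal (G.oneProb R / G.rootProb R)) where
  low f g hfg := by
    have key : ∀ N S C σ, J S C σ → ∑ t ∈ Finset.range N, G.popVal R (G.wtPMF hp) g t S ≤
        wp 0 (.loop b P) f σ := by
      intro N
      induction N with
      | zero => intro S C σ _; simp
      | succ N ih =>
        intro S C σ hσ
        rw [Finset.sum_range_succ']
        rcases hJ S C σ hσ with ⟨hb, hC⟩ | ⟨hb, hS⟩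
        · have h0 : G.popVal R (G.wtPMF hp) g 0 S = 0 := by rw [popVal, if_pos ⟨C, hC⟩]
          rw [h0, add_zero, wp_loop_pos _ _ _ _ hb, zero_add]
          refine le_trans (le_of_eq ?_) ((hP S C σ hσ hb).low _
            (fun S' => ∑ t ∈ Finset.range N, G.popVal R (G.wtPMF hp) g t (G.mix C S S')) ?_)
          · rw [ev_eq_sum]
            simp only [popVal_eq _ _ _ hC, Finset.mul_sum]
            rw [Finset.sum_comm]
          · rintro S' σ' ⟨C', hσ'⟩
            exact ih _ _ _ hσ'
        · rw [wp_loop_neg _ _ _ _ hb, zero_add]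
          have h := rootConn_iff.1 hS
          simp only [popVal, dif_neg h, if_neg h]
          simpa using hfg S σ ⟨hS, C, hσ⟩
    have h1 : ∀ N, ENNReal.ofReal (G.doneProb R N) * ev (G.condPMF R hp hZ) g ≤
        wp 0 (.seq P (.loop b P)) f σ₀ := fun N => by
      rw [← ev_sum_popVal, wp_seq, zero_add]
      exact hP₀.low _ _ fun S σ ⟨C, hσ⟩ => key N S C σ hσ
    have h2 : Tendsto (fun N => ENNReal.ofReal (G.doneProb R N) * ev (G.condPMF R hp hZ) g) atTop
        (𝓝 (1 * ev (G.condPMF R hp hZ) g)) := by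
      refine ENNReal.Tendsto.mul_const ?_ (Or.inl one_ne_zero)
      rw [← ENNReal.ofReal_one]
      exact (ENNReal.continuous_ofReal.tendsto 1).comp (tendsto_doneProb hp hZ)
    rw [one_mul] at h2
    exact le_of_tendsto' h2 h1
  high f g hfg := by
    -- the expected payoff and time from the set `S` on: each further pop costs `T + 1`
    set B : Finset E → ℝ≥0∞ := fun S => 1 + (∑' t, G.popVal R (G.wtPMF hp) g t S +
      (T + 1) * ∑' t, ENNReal.ofReal (G.stuck R t S)) with hB
    have key : ∀ S C σ, J S C σ → wp 1 (.loop b P) f σ ≤ B S := by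
      -- a memory may represent several pairs `S`, `C`, hence the infimum
      set I : State → ℝ≥0∞ := fun σ => ⨅ (S) (C) (_ : J S C σ), B S with hI
      have hle : ∀ S C σ, J S C σ → I σ ≤ B S := fun S C σ hσ =>
        iInf_le_of_le S (iInf_le_of_le C (iInf_le_of_le hσ le_rfl))
      intro S C σ hσ
      refine (wp_loop_le σ (I := I) ?_ ?_).trans (hle S C σ hσ)
      · intro σ hb
        refine le_iInf fun S => le_iInf fun C => le_iInf fun hσ => ?_
        rcases hJ S C σ hσ with ⟨_, hC⟩ | ⟨hb', _⟩
        swap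
        · exact absurd hb hb'
        have h1 := (hP S C σ hσ hb).high I (fun S' => B (G.mix C S S'))
          fun S' σ' ⟨C', hσ'⟩ => hle _ _ _ hσ'
        have h2 : ev (G.wtPMF hp) (fun S' => B (G.mix C S S')) =
            1 + (∑' t, G.popVal R (G.wtPMF hp) g (t + 1) S +
              (T + 1) * ∑' t, ENNReal.ofReal (G.stuck R (t + 1) S)) := by
          simp only [hB, ev_add, ev_const, ev_const_mul, stuck_succ hp hC, popVal_eq _ _ _ hC]
          congr 2
          · unfold ev
            simp only [← ENNReal.tsum_mul_left]
            rw [ENNReal.tsum_comm]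
            exact tsum_congr fun t => tsum_fintype _
          · congr 1
            unfold ev
            simp only [← ENNReal.tsum_mul_left]
            rw [ENNReal.tsum_comm]
        rw [h2] at h1
        have h3 : ∑' t, G.popVal R (G.wtPMF hp) g t S =
            ∑' t, G.popVal R (G.wtPMF hp) g (t + 1) S := by
          rw [tsum_eq_zero_add' ENNReal.summable]
          simp [popVal, show ∃ C, G.MinCluster R S C from ⟨C, hC⟩]
        have h4 : ∑' t, ENNReal.ofReal (G.stuck R t S) =
            1 + ∑' t, ENNReal.ofReal (G.stuck R (t + 1) S) := by
          rw [tsum_eq_zero_add' ENNReal.summable, stuck_zero hC, ENNReal.ofReal_one]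
        calc _ ≤ 1 + (T + (1 + (∑' t, G.popVal R (G.wtPMF hp) g (t + 1) S +
              (T + 1) * ∑' t, ENNReal.ofReal (G.stuck R (t + 1) S)))) := add_le_add le_rfl h1
          _ = B S := by simp only [hB, h3, h4]; ring
      · intro σ hb
        refine le_iInf fun S => le_iInf fun C => le_iInf fun hσ => ?_
        rcases hJ S C σ hσ with ⟨hb', _⟩ | ⟨_, hS⟩
        · exact absurd hb' hb
        have h := rootConn_iff.1 hS
        have h3 : ∑' t, G.popVal R (G.wtPMF hp) g t S = g S := by
          rw [tsum_eq_zero_add' ENNReal.summable]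
          simp only [popVal, dif_neg h, if_neg h]
          simp
        simp only [hB, h3, stuck_of_rootConn hS]
        simpa using add_le_add (le_refl (1 : ℝ≥0∞)) (hfg S σ ⟨hS, C, hσ⟩)
    have h1 := hP₀.high _ _ fun S σ ⟨C, hσ⟩ => key S C σ hσ
    rw [wp_seq]
    have h2 : ev (G.wtPMF hp) (fun S => ∑' t, G.popVal R (G.wtPMF hp) g t S) ≤
        ev (G.condPMF R hp hZ) g := by
      simp only [ENNReal.tsum_eq_iSup_nat]
      rw [ev_iSup]
      · refine iSup_le fun N => ?_
        rw [ev_sum_popVal hp hZ]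
        refine (mul_le_mul_left (ENNReal.ofReal_le_one.2 (doneProb_le_one hp N)) _).trans_eq ?_
        rw [one_mul]
      · exact monotone_nat_of_le_succ fun N S => by
          simp only [Finset.sum_range_succ]; exact le_self_add
    rw [hB, ev_add, ev_add, ev_const, ev_const_mul] at h1
    calc _ ≤ 1 + (T + (1 + (ev (G.condPMF R hp hZ) g +
          (T + 1) * ENNReal.ofReal (G.oneProb R / G.rootProb R)))) := by
          refine add_le_add le_rfl (h1.trans ?_)
          gcongr
          exact ev_tsum_stuck_le hp hZ
      _ = _ := by ring

end Sampling

end Network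

/-! ### Undirected reliability and bi-directed reachability -/

/-- `d` is the distance to `r` along the arcs of `A`: it is finite, and determined by these local
conditions. -/
structure IsDist {V : Type} (A : V → V → Prop) (r : V) (d : V → ℕ) : Prop where
  zero : ∀ v, d v = 0 ↔ v = r
  step : ∀ z y, A z y → d z ≤ d y + 1
  pred : ∀ z, z ≠ r → ∃ y, A z y ∧ d z = d y + 1

section Distance

variable {V : Type} {A : V → V → Prop} {r : V} {d d' : V → ℕ}

lemma IsDist.le (h : IsDist A r d) (h' : IsDist A r d') (z : V) : d z ≤ d' z := by
  induction hn : d' z using Nat.strong_induction_on generalizing z with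
  | _ n ih =>
    by_cases hz : z = r
    · rw [(h.zero z).2 hz]; exact Nat.zero_le _
    · obtain ⟨y, hy, hd⟩ := h'.pred z hz
      have := h.step z y hy
      have := ih (d' y) (by lia) y rfl
      lia

lemma IsDist.unique (h : IsDist A r d) (h' : IsDist A r d') : d = d' :=
  funext fun z => le_antisymm (h.le h' z) (h'.le h z)

lemma IsDist.reaches (h : IsDist A r d) (z : V) : Relation.ReflTransGen A z r := by
  induction hn : d z using Nat.strong_induction_on generalizing z with
  | _ n ih =>
    by_cases hz : z = r
    · rw [hz]
    · obtain ⟨y, hy, hd⟩ := h.pred z hz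
      exact .head hy (ih (d y) (by lia) y rfl)

/-- There is a path of length `k` from the vertex to `r`. -/
def PathLen (A : V → V → Prop) (r : V) : ℕ → V → Prop
  | 0, v => v = r
  | k + 1, v => ∃ y, A v y ∧ PathLen A r k y

lemma exists_isDist (h : ∀ z, Relation.ReflTransGen A z r) : ∃ d, IsDist A r d := by
  classical
  have hex : ∀ z, ∃ k, PathLen A r k z := fun z => by
    induction h z using Relation.ReflTransGen.head_induction_on with
    | refl => exact ⟨0, rfl⟩
    | head hbc _ ih => obtain ⟨k, hk⟩ := ih; exact ⟨k + 1, _, hbc, hk⟩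
  have hstep : ∀ z y, A z y → Nat.find (hex z) ≤ Nat.find (hex y) + 1 := fun z y hzy =>
    Nat.find_min' _ ⟨y, hzy, Nat.find_spec (hex y)⟩
  refine ⟨fun z => Nat.find (hex z), fun v => ?_, hstep, fun z hz => ?_⟩
  · rw [Nat.find_eq_zero]; rfl
  · have h0 : Nat.find (hex z) ≠ 0 := fun h0 => hz ((Nat.find_eq_zero _).1 h0)
    obtain ⟨k, hk⟩ := Nat.exists_eq_succ_of_ne_zero h0
    have hs := Nat.find_spec (hex z)
    rw [hk] at hs
    obtain ⟨y, hzy, hy⟩ := hs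
    have h1 : Nat.find (hex y) ≤ k := Nat.find_min' _ hy
    have h2 := hstep z y hzy
    exact ⟨y, hzy, by simp only [hk] at h2 ⊢; lia⟩

end Distance

namespace Network

section Bidirection

open Classical

variable {V E : Type} {G : Network V E} {r : V} {d : V → ℕ} {S : Finset (E × Bool)} {T : Finset E}

lemma rootConn_singleton {E : Type} {G : Network V E} {S : Finset E} :
    G.RootConn {r} S ↔ ∀ z, Relation.ReflTransGen (G.Arc S) z r := by
  simp [RootConn, Reaches]

/-- The arcs of `T` in both directions. -/
def bothWays (T : Finset E) : Finset (E × Bool) := T ×ˢ Finset.univ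

lemma arc_bothWays {z y : V} : G.toBidirected.Arc (bothWays T) z y ↔ G.Arc T z y ∨ G.Arc T y z := by
  constructor
  · rintro ⟨⟨e, b⟩, he, rfl, rfl⟩
    have he' : e ∈ T := by simpa [bothWays] using he
    cases b
    · exact Or.inl ⟨e, he', rfl, rfl⟩
    · exact Or.inr ⟨e, he', rfl, rfl⟩
  · rintro (⟨e, he, rfl, rfl⟩ | ⟨e, he, rfl, rfl⟩)
    · exact ⟨(e, false), by simpa [bothWays] using he, rfl, rfl⟩
    · exact ⟨(e, true), by simpa [bothWays] using he, rfl, rfl⟩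

lemma isConnected_iff : G.IsConnected T ↔ G.toBidirected.RootConn {r} (bothWays T) := by
  rw [rootConn_singleton]
  have hadj : ∀ z y, (SimpleGraph.fromRel (G.Arc T)).Adj z y ↔
      z ≠ y ∧ G.toBidirected.Arc (bothWays T) z y := fun z y => by
    rw [arc_bothWays, SimpleGraph.fromRel_adj]
  constructor
  · intro h z
    have := (SimpleGraph.reachable_iff_reflTransGen z r).1 (h.preconnected z r)
    exact Relation.ReflTransGen.mono (fun x y hxy => ((hadj x y).1 hxy).2) _ _ this
  · intro h
    have hr : ∀ z, (SimpleGraph.fromRel (G.Arc T)).Reachable z r := fun z => by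
      induction h z using Relation.ReflTransGen.head_induction_on with
      | refl => exact .refl _
      | @head x y hxy _ ih =>
        by_cases hne : x = y
        · rw [hne]; exact ih
        · exact ((hadj x y).2 ⟨hne, hxy⟩).reachable.trans ih
    have : Nonempty V := ⟨r⟩
    exact ⟨fun x y => (hr x).trans (hr y).symm⟩

/-- The direction in which the edge `e` leads to the end with the smaller value of `d`. -/
def orient (G : Network V E) (d : V → ℕ) (e : E) : Bool := decide (d (G.fst e) ≤ d (G.snd e))

/-- Only the orientation towards the root matters for distances, so that a set of arcs and a set
of edges that agree in this orientation have the same distances. -/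
lemma isDist_iff (h : ∀ e, (e, G.orient d e) ∈ S ↔ e ∈ T) :
    IsDist (G.toBidirected.Arc S) r d ↔ IsDist (G.toBidirected.Arc (bothWays T)) r d := by
  have hor : ∀ a : E × Bool, d (G.toBidirected.snd a) < d (G.toBidirected.fst a) →
      (a ∈ S ↔ a ∈ bothWays T) := by
    rintro ⟨e, b⟩ hlt
    have hb : b = G.orient d e := by
      cases b
      · simp only [toBidirected, Bool.false_eq_true, if_false] at hlt
        simp [orient, hlt]
      · simp only [toBidirected, if_true] at hlt
        simp [orient, hlt.le]
    rw [hb, h e]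
    simp [bothWays]
  have key : ∀ X Y : Finset (E × Bool), (∀ a : E × Bool,
      d (G.toBidirected.snd a) < d (G.toBidirected.fst a) → (a ∈ X ↔ a ∈ Y)) →
      IsDist (G.toBidirected.Arc X) r d → IsDist (G.toBidirected.Arc Y) r d := by
    intro X Y hXY hX
    refine ⟨hX.zero, ?_, ?_⟩
    · rintro z y ⟨a, ha, rfl, rfl⟩
      by_cases hlt : d (G.toBidirected.snd a) < d (G.toBidirected.fst a)
      · exact hX.step _ _ ⟨a, (hXY a hlt).2 ha, rfl, rfl⟩
      · lia
    · intro z hz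
      obtain ⟨y, ⟨a, ha, rfl, rfl⟩, hd⟩ := hX.pred z hz
      exact ⟨_, ⟨a, (hXY a (by lia)).1 ha, rfl, rfl⟩, hd⟩
  exact ⟨key _ _ hor, key _ _ fun a ha => (hor a ha).symm⟩

lemma isDist_rootConn {E : Type} {G : Network V E} {S : Finset E} (h : IsDist (G.Arc S) r d) :
    G.RootConn {r} S := rootConn_singleton.2 h.reaches

variable [Fintype E]

/-- The edges whose orientation towards the root survives. -/
noncomputable def project (G : Network V E) (d : V → ℕ) (S : Finset (E × Bool)) : Finset E :=
  Finset.univ.filter fun e => (e, G.orient d e) ∈ S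

lemma mem_project {e : E} : e ∈ G.project d S ↔ (e, G.orient d e) ∈ S := by simp [project]

/-- Exactly one direction of every edge is prescribed, so the other directions sum out. -/
lemma sum_wt_orientation (G : Network V E) (o : E → Bool) (T : Finset E) :
    ∑ S : Finset (E × Bool), (if ∀ e, (e, o e) ∈ S ↔ e ∈ T then G.toBidirected.wt S else 0) =
      G.wt T := by
  set join : Finset E × Finset E → Finset (E × Bool) := fun x =>
    Finset.univ.filter fun a => if a.2 = o a.1 then a.1 ∈ x.1 else a.1 ∈ x.2 with hjoin
  have hmem : ∀ x a, a ∈ join x ↔ if a.2 = o a.1 then a.1 ∈ x.1 else a.1 ∈ x.2 := fun x a => by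
    simp [hjoin]
  have hwt : ∀ x, G.toBidirected.wt (join x) = G.wt x.1 * G.wt x.2 := fun x => by
    simp only [wt_eq_prod, ← Finset.prod_mul_distrib]
    rw [Fintype.prod_prod_type]
    refine Finset.prod_congr rfl fun e _ => ?_
    rw [Fintype.prod_bool]
    simp only [hmem, toBidirected]
    cases o e <;> simp [mul_comm]
  have hsum : ∑ S : Finset (E × Bool),
      (if ∀ e, (e, o e) ∈ S ↔ e ∈ T then G.toBidirected.wt S else 0) =
      ∑ x : Finset E × Finset E, if x.1 = T then G.wt x.1 * G.wt x.2 else 0 := by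
    refine Finset.sum_nbij' (fun S => (Finset.univ.filter fun e => (e, o e) ∈ S,
      Finset.univ.filter fun e => (e, !o e) ∈ S)) join (by simp) (by simp) ?_ ?_ ?_
    · intro S _
      ext ⟨e, b⟩
      rw [hmem]
      by_cases hb : b = o e
      · simp [hb]
      · have : b = !o e := by cases b <;> cases h : o e <;> simp_all
        simp [this]
    · intro x _
      ext e <;> simp [hmem]
    · intro S _
      have h1 : join (Finset.univ.filter fun e => (e, o e) ∈ S,
          Finset.univ.filter fun e => (e, !o e) ∈ S) = S := by
        ext ⟨e, b⟩
        rw [hmem]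
        by_cases hb : b = o e
        · simp [hb]
        · have : b = !o e := by cases b <;> cases h : o e <;> simp_all
          simp [this]
      have h2 : (∀ e, (e, o e) ∈ S ↔ e ∈ T) ↔
          (Finset.univ.filter fun e => (e, o e) ∈ S) = T := by
        rw [Finset.ext_iff]; simp
      simp only [h2]
      refine if_congr Iff.rfl ?_ rfl
      exact (congrArg _ h1.symm).trans (hwt _)
  rw [hsum, Fintype.sum_prod_type]
  simp [← Finset.mul_sum, sum_wt]

/-- If `S` is a random set of arcs, then the edges whose orientation towards the root is in `S`
form a random set of edges. -/
lemma sum_wt_project (r : V) (D : Finset (E × Bool) → V → ℕ)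
    (hD : ∀ S, G.toBidirected.RootConn {r} S → IsDist (G.toBidirected.Arc S) r (D S))
    (hT : G.IsConnected T) :
    ∑ S : Finset (E × Bool), (if G.toBidirected.RootConn {r} S ∧ G.project (D S) S = T then
      G.toBidirected.wt S else 0) = G.wt T := by
  obtain ⟨d, hd⟩ := exists_isDist (rootConn_singleton.1 ((isConnected_iff (r := r)).1 hT))
  rw [← sum_wt_orientation G (G.orient d) T]
  refine Finset.sum_congr rfl fun S _ => if_congr ⟨?_, fun h => ?_⟩ rfl rfl
  · rintro ⟨hS, rfl⟩
    have h1 := hD S hS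
    have h2 := (isDist_iff (fun e => (mem_project (d := D S)).symm)).1 h1
    rw [hd.unique h2]
    exact fun e => mem_project.symm
  · have h1 := (isDist_iff (r := r) h).2 hd
    have h2 := isDist_rootConn h1
    refine ⟨h2, ?_⟩
    rw [(hD S h2).unique h1]
    ext e
    rw [mem_project, h]

lemma isConnected_project {D : Finset (E × Bool) → V → ℕ} (r : V)
    (hD : IsDist (G.toBidirected.Arc S) r (D S)) : G.IsConnected (G.project (D S) S) :=
  (isConnected_iff (r := r)).2 (isDist_rootConn ((isDist_iff fun _ => mem_project.symm).1 hD))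

variable [Fintype V]

lemma reach_eq_rootProb (G : Network V E) (r : V) : G.reach r = G.rootProb {r} := by
  rw [reach, rootProb, Finset.sum_filter]
  refine Finset.sum_congr rfl fun S _ => if_congr ?_ rfl rfl
  rw [rootConn_singleton, IsRootConnected]

/-- All-terminal reliability is reachability in the bi-directed network. -/
theorem rel_eq_reach (G : Network V E) (r : V) : G.rel = G.toBidirected.reach r := by
  have hex : ∀ S, ∃ d, G.toBidirected.RootConn {r} S → IsDist (G.toBidirected.Arc S) r d :=
    fun S => by
      by_cases h : G.toBidirected.RootConn {r} S
      · obtain ⟨d, hd⟩ := exists_isDist (rootConn_singleton.1 h)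
        exact ⟨d, fun _ => hd⟩
      · exact ⟨fun _ => 0, fun h' => absurd h' h⟩
  choose D hD using hex
  rw [reach_eq_rootProb, rootProb, rel]
  rw [Finset.sum_congr rfl fun T hT => (sum_wt_project r D hD (Finset.mem_filter.1 hT).2).symm,
    Finset.sum_comm]
  refine Finset.sum_congr rfl fun S _ => ?_
  split_ifs with hS
  · simp only [hS, true_and]
    rw [Finset.sum_ite_eq, if_pos]
    exact Finset.mem_filter.2 ⟨Finset.mem_univ _, isConnected_project r (hD S hS)⟩
  · simp [hS]

end Bidirection

section Reindex

open Classical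

variable {V E E' : Type}

/-- The same network with other names for the edges. -/
def reindex (G : Network V E) (φ : E' ≃ E) : Network V E' where
  fst e := G.fst (φ e)
  snd e := G.snd (φ e)
  fail e := G.fail (φ e)

variable {G : Network V E} {φ : E' ≃ E} {S : Finset E'}

lemma arc_reindex : (G.reindex φ).Arc S = G.Arc (S.map φ.toEmbedding) := by
  funext u v
  simp only [Arc, reindex, Finset.mem_map, Equiv.coe_toEmbedding, eq_iff_iff]
  constructor
  · rintro ⟨e, he, h⟩; exact ⟨φ e, ⟨e, he, rfl⟩, h⟩
  · rintro ⟨_, ⟨e, he, rfl⟩, h⟩; exact ⟨e, he, h⟩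

lemma rootConn_reindex {R : Finset V} :
    (G.reindex φ).RootConn R S ↔ G.RootConn R (S.map φ.toEmbedding) := by
  simp only [RootConn, Reaches, arc_reindex]

variable [Fintype E] [Fintype E']

lemma wt_reindex : (G.reindex φ).wt S = G.wt (S.map φ.toEmbedding) := by
  rw [wt_eq_prod, wt_eq_prod]
  refine Fintype.prod_equiv φ _ _ fun e => ?_
  simp [reindex]

lemma sum_reindex (φ : E' ≃ E) (f : Finset E → ℝ) :
    ∑ S : Finset E', f (S.map φ.toEmbedding) = ∑ S, f S :=
  Fintype.sum_equiv φ.finsetCongr _ _ fun _ => rfl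

lemma rootProb_reindex [Fintype V] {R : Finset V} :
    (G.reindex φ).rootProb R = G.rootProb R := by
  simp only [rootProb, wt_reindex, rootConn_reindex]
  exact sum_reindex φ fun S => if G.RootConn R S then G.wt S else 0

end Reindex

end Network

/-! ### Memory layout

Names for the arrays; the last four are arrays of real numbers, the others of natural numbers. Of
the arrays called registers only cell `0` is used. Cells `0`, `1`, `2` of `arrSize` hold the numbers
of vertices and of edges, and the root. The arcs that start (end) at a vertex are kept in linked
lists with heads `arrTailTop` (`arrHeadTop`) and links `arrTailNext` (`arrHeadNext`), in which `0`
means the end and `k + 1` the arc `k`.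
-/

notation "arrSize" => (0 : ℕ)
notation "arrFst" => (1 : ℕ)
notation "arrSnd" => (2 : ℕ)
notation "arrOut" => (3 : ℕ)
notation "arrTail" => (4 : ℕ)
notation "arrHead" => (5 : ℕ)
notation "regArcs" => (6 : ℕ)
notation "arrTailTop" => (7 : ℕ)
notation "arrTailNext" => (8 : ℕ)
notation "arrHeadTop" => (9 : ℕ)
notation "arrHeadNext" => (10 : ℕ)
notation "arrRank" => (11 : ℕ)
notation "regCount" => (12 : ℕ)
notation "regThr" => (13 : ℕ)
notation "arrAlive" => (14 : ℕ)
notation "arrFresh" => (15 : ℕ)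
notation "arrMask" => (16 : ℕ)
notation "regFlag" => (17 : ℕ)
notation "arrMark" => (18 : ℕ)
notation "arrQueue" => (19 : ℕ)
notation "regHead" => (20 : ℕ)
notation "regTail" => (21 : ℕ)
notation "regCur" => (22 : ℕ)
notation "regCand" => (23 : ℕ)
notation "regLast" => (24 : ℕ)
notation "regI" => (25 : ℕ)
notation "regJ" => (26 : ℕ)
notation "regK" => (27 : ℕ)
notation "regGood" => (28 : ℕ)
notation "regSamples" => (29 : ℕ)
notation "regA" => (30 : ℕ)
notation "regB" => (31 : ℕ)
notation "regX" => (32 : ℕ)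
notation "regY" => (33 : ℕ)
notation "regZ" => (34 : ℕ)
notation "arrDist" => (35 : ℕ)
notation "arrFailIn" => (1 : ℕ)
notation "arrFail" => (2 : ℕ)
notation "regMin" => (3 : ℕ)
notation "regAcc" => (4 : ℕ)

/-! ### Graph search -/

/-- The content of a register, which is cell `0` of the integer array `a`. -/
abbrev reg (a : ℕ) : NatExp := .get a (.lit 0)

/-- Assignment to a register. -/
abbrev setReg (a : ℕ) (x : NatExp) : Prog := .setNat a (.lit 0) x

/-- The largest `k ≤ M` with `key (k - 1) = y`, or `0`: the list of the arcs with key `y` in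
decreasing order is traversed by passing from `k` to `prevArc key y (k - 1)`. -/
def prevArc (key : ℕ → ℕ) (y : ℕ) : ℕ → ℕ
  | 0 => 0
  | k + 1 => if key k = y then k + 1 else prevArc key y k

lemma prevArc_le (key : ℕ → ℕ) (y k : ℕ) : prevArc key y k ≤ k := by
  induction k with
  | zero => simp [prevArc]
  | succ k ih => rw [prevArc]; split_ifs <;> lia

lemma key_prevArc (key : ℕ → ℕ) (y k : ℕ) (h : prevArc key y k ≠ 0) :
    key (prevArc key y k - 1) = y := by
  induction k with
  | zero => simp [prevArc] at h
  | succ k ih =>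
    rw [prevArc] at h ⊢
    split_ifs at h ⊢ with h'
    · simpa using h'
    · exact ih h

lemma lt_prevArc (key : ℕ → ℕ) (y k a : ℕ) (ha : a < k) (hk : key a = y) :
    a < prevArc key y k := by
  induction k with
  | zero => lia
  | succ k ih =>
    rw [prevArc]
    split_ifs with h'
    · lia
    · refine ih ?_
      rcases Nat.lt_succ_iff_lt_or_eq.1 ha with h | rfl
      · exact h
      · exact absurd hk h'

section SearchInvariant

/-- There is a usable arc by which the search passes from `y` to `z`. -/
def SearchArc (M : ℕ) (key oth alive : ℕ → ℕ) (y z : ℕ) : Prop :=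
  ∃ a < M, alive a = 1 ∧ key a = y ∧ oth a = z

/-- The invariant of the search on vertices `0, …, n - 1` and arcs `0, …, M - 1`. The vertices
marked by `mk` are queued in `q 0, …, q (qt - 1)`, those in `q 0, …, q (qh - 1)` have been
scanned, except that the arcs `a < cur` of the last one remain to be scanned; `used` is the set of
arcs that have been scanned. The search starts in `B₀`, and restarts from
each `x ≥ x₀` that is still unmarked when its turn comes. The vertex of the last restart is
`last - 1`, and `old` contains the vertices that were marked before it. -/
structure SearchInv (n M : ℕ) (key oth alive : ℕ → ℕ) (B₀ : Set ℕ) (x₀ l₀ : ℕ)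
    (q mk : ℕ → ℕ) (qh qt cur x last : ℕ) (used : Finset ℕ) (old : Set ℕ) : Prop where
  queue : ∀ i < qt, q i < n ∧ mk (q i) = 1
  mark : ∀ v < n, mk v = 0 ∨ mk v = 1 ∧ ∃ i < qt, q i = v
  inj : ∀ i < qt, ∀ j < qt, q i = q j → i = j
  qh_le : qh ≤ qt
  x_le : x₀ ≤ x ∧ x ≤ n
  cur_spec : cur ≠ 0 → 1 ≤ qh ∧ cur ≤ M ∧ key (cur - 1) = q (qh - 1)
  scanned : ∀ i < qh, ∀ a < M, alive a = 1 → key a = q i → (i + 1 = qh → cur ≤ a) → mk (oth a) = 1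
  used_spec : ∀ a ∈ used, a < M ∧ ∃ i < qh, key a = q i ∧ (i + 1 = qh → cur ≤ a)
  passed : ∀ v, x₀ ≤ v → v < x → mk v = 1
  old_closed : ∀ y ∈ old, ∀ z, SearchArc M key oth alive y z → z ∈ old
  old_marked : ∀ v ∈ old, v < n ∧ mk v = 1
  start_marked : ∀ v ∈ B₀, v < n ∧ mk v = 1
  reached : ∀ v < n, mk v = 1 → v ∈ old ∨ (last = l₀ ∧ old = ∅ ∧
      ∃ b ∈ B₀, Relation.ReflTransGen (SearchArc M key oth alive) b v) ∨
    (x₀ < n ∧ last ≠ 0 ∧ Relation.ReflTransGen (SearchArc M key oth alive) (last - 1) v)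
  last_spec : (last = l₀ ∧ old = ∅) ∨
    (x₀ < n ∧ last ≠ 0 ∧ last - 1 < n ∧ last - 1 ∉ old ∧ B₀ ⊆ old)

namespace SearchInv

variable {n M : ℕ} {key oth alive : ℕ → ℕ} {B₀ : Set ℕ} {x₀ l₀ : ℕ} {q mk : ℕ → ℕ}
  {qh qt cur x last : ℕ} {used : Finset ℕ} {old : Set ℕ}

lemma qt_le (h : SearchInv n M key oth alive B₀ x₀ l₀ q mk qh qt cur x last used old) :
    qt ≤ n := by
  have : (Finset.range qt).card ≤ (Finset.range n).card :=
    Finset.card_le_card_of_injOn q (fun i hi => by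
      simpa using (h.queue i (by simpa using hi)).1) fun i hi j hj hij =>
        h.inj i (by simpa using hi) j (by simpa using hj) hij
  simpa using this

lemma card_used_le (h : SearchInv n M key oth alive B₀ x₀ l₀ q mk qh qt cur x last used old) :
    used.card ≤ M := by
  have : used ⊆ Finset.range M := fun a ha => by simpa using (h.used_spec a ha).1
  simpa using Finset.card_le_card this

lemma notMem_used (h : SearchInv n M key oth alive B₀ x₀ l₀ q mk qh qt cur x last used old)
    (hc : cur ≠ 0) : cur - 1 ∉ used := fun hu => by
  obtain ⟨_, i, hi, hki, hic⟩ := h.used_spec _ hu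
  obtain ⟨h1, _, h3⟩ := h.cur_spec hc
  have := h.inj i (by have := h.qh_le; lia) (qh - 1) (by have := h.qh_le; lia) (hki.symm.trans h3)
  have := hic (by lia)
  lia

/-- Marking the unmarked end of a usable arc, or a vertex of a restart. -/
lemma push (h : SearchInv n M key oth alive B₀ x₀ l₀ q mk qh qt cur x last used old) {w : ℕ}
    (hw : w < n) (hmw : mk w = 0) (last' : ℕ) (old' : Set ℕ)
    (hold : (last' = last ∧ old' = old ∧ ∃ y < n, mk y = 1 ∧ y ∉ old ∧
        SearchArc M key oth alive y w) ∨
      (x₀ < n ∧ last' = w + 1 ∧ old' = {v | v < n ∧ mk v = 1} ∧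
        ∀ y ∈ old', ∀ z, SearchArc M key oth alive y z → z ∈ old')) :
    SearchInv n M key oth alive B₀ x₀ l₀ (Function.update q qt w) (Function.update mk w 1)
      qh (qt + 1) cur x last' used old' := by
  have hmk1 : ∀ v, mk v = 1 → Function.update mk w 1 v = 1 := fun v hv => by
    by_cases hvw : v = w <;> simp [hvw, hv]
  have hqi : ∀ i < qt, Function.update q qt w i = q i := fun i hi =>
    Function.update_of_ne (by lia) _ _
  have hnew : ∀ i < qt, q i ≠ w := fun i hi e => by
    have := (h.queue i hi).2
    rw [e, hmw] at this
    lia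
  have hqh := h.qh_le
  refine ⟨?_, ?_, ?_, by lia, h.x_le, ?_, ?_, ?_, ?_, ?_, ?_, ?_, ?_, ?_⟩
  · intro i hi
    rcases Nat.lt_succ_iff_lt_or_eq.1 hi with hi | rfl
    · rw [hqi i hi]; exact ⟨(h.queue i hi).1, hmk1 _ (h.queue i hi).2⟩
    · simpa using hw
  · intro v hv
    by_cases hvw : v = w
    · right; exact ⟨by simp [hvw], qt, by lia, by simp [hvw]⟩
    · rcases h.mark v hv with h0 | ⟨h1, i, hi, hiv⟩
      · left; simp [hvw, h0]
      · right; exact ⟨hmk1 v h1, i, by lia, by rw [hqi i hi, hiv]⟩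
  · intro i hi j hj hij
    rcases Nat.lt_succ_iff_lt_or_eq.1 hi with hi | rfl <;>
      rcases Nat.lt_succ_iff_lt_or_eq.1 hj with hj | rfl
    · rw [hqi i hi, hqi j hj] at hij; exact h.inj i hi j hj hij
    · rw [hqi i hi] at hij; simp at hij; exact absurd hij (hnew i hi)
    · rw [hqi j hj] at hij; simp at hij; exact absurd hij.symm (hnew j hj)
    · rfl
  · intro hc
    obtain ⟨h1, h2, h3⟩ := h.cur_spec hc
    exact ⟨h1, h2, by rw [hqi _ (by lia)]; exact h3⟩
  · intro i hi a ha hal hk hic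
    rw [hqi i (by lia)] at hk
    exact hmk1 _ (h.scanned i hi a ha hal hk hic)
  · intro a ha
    obtain ⟨h1, i, hi, h2, h3⟩ := h.used_spec a ha
    exact ⟨h1, i, hi, by rw [hqi i (by lia)]; exact h2, h3⟩
  · exact fun v h1 h2 => hmk1 v (h.passed v h1 h2)
  · rcases hold with ⟨_, rfl, _⟩ | ⟨_, _, _, hcl⟩
    · exact h.old_closed
    · exact hcl
  · rcases hold with ⟨_, rfl, _⟩ | ⟨_, _, rfl, _⟩
    · exact fun v hv => ⟨(h.old_marked v hv).1, hmk1 v (h.old_marked v hv).2⟩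
    · exact fun v hv => ⟨hv.1, hmk1 v hv.2⟩
  · exact fun v hv => ⟨(h.start_marked v hv).1, hmk1 v (h.start_marked v hv).2⟩
  · intro v hv hmv
    rcases hold with ⟨rfl, rfl, y, hy, hmy, hyo, hyw⟩ | ⟨hx, rfl, rfl, _⟩
    · by_cases hvw : v = w
      · subst hvw
        right
        rcases h.reached y hy hmy with ho | ⟨h1, h2, b, hb, hby⟩ | ⟨h1, h2, hby⟩
        · exact absurd ho hyo
        · exact Or.inl ⟨h1, h2, b, hb, hby.tail hyw⟩
        · exact Or.inr ⟨h1, h2, hby.tail hyw⟩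
      · rw [Function.update_of_ne hvw] at hmv
        exact h.reached v hv hmv
    · by_cases hvw : v = w
      · subst hvw
        exact Or.inr (Or.inr ⟨hx, by lia, by simpa using .refl⟩)
      · rw [Function.update_of_ne hvw] at hmv
        exact Or.inl ⟨hv, hmv⟩
  · rcases hold with ⟨rfl, rfl, _⟩ | ⟨hx, rfl, rfl, _⟩
    · exact h.last_spec
    · right
      exact ⟨hx, by lia, by simpa using hw, by simp [hmw], fun v hv => h.start_marked v hv⟩

/-- The arc `cur - 1` has been scanned. -/
lemma advance (h : SearchInv n M key oth alive B₀ x₀ l₀ q mk qh qt cur x last used old)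
    (hc : cur ≠ 0) (hmk : alive (cur - 1) = 1 → mk (oth (cur - 1)) = 1) :
    SearchInv n M key oth alive B₀ x₀ l₀ q mk qh qt (prevArc key (key (cur - 1)) (cur - 1)) x last
      (insert (cur - 1) used) old := by
  obtain ⟨h1, h2, h3⟩ := h.cur_spec hc
  have hle := prevArc_le key (key (cur - 1)) (cur - 1)
  refine ⟨h.queue, h.mark, h.inj, h.qh_le, h.x_le, ?_, ?_, ?_, h.passed, h.old_closed,
    h.old_marked, h.start_marked, h.reached, h.last_spec⟩
  · intro hp
    exact ⟨h1, by lia, by rw [key_prevArc _ _ _ hp, h3]⟩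
  · intro i hi a ha hal hk hic
    by_cases hiq : i + 1 = qh
    · rcases lt_trichotomy a (cur - 1) with hlt | heq | hgt
      · have hi' : i = qh - 1 := by lia
        have := lt_prevArc key (key (cur - 1)) (cur - 1) a hlt (by rw [hk, h3, hi'])
        have := hic hiq
        lia
      · rw [heq] at hal ⊢; exact hmk hal
      · exact h.scanned i hi a ha hal hk fun _ => by lia
    · exact h.scanned i hi a ha hal hk fun e => absurd e hiq
  · intro a ha
    rcases Finset.mem_insert.1 ha with rfl | ha
    · exact ⟨by lia, qh - 1, by lia, h3, fun _ => hle⟩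
    · obtain ⟨h4, i, hi, h5, h6⟩ := h.used_spec a ha
      exact ⟨h4, i, hi, h5, fun e => by have := h6 e; lia⟩

/-- The arcs of the next vertex in the queue are going to be scanned. -/
lemma pop (h : SearchInv n M key oth alive B₀ x₀ l₀ q mk qh qt 0 x last used old)
    (hq : qh < qt) :
    SearchInv n M key oth alive B₀ x₀ l₀ q mk (qh + 1) qt (prevArc key (q qh) M) x last used old := by
  refine ⟨h.queue, h.mark, h.inj, hq, h.x_le, ?_, ?_, ?_, h.passed, h.old_closed,
    h.old_marked, h.start_marked, h.reached, h.last_spec⟩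
  · intro hp
    exact ⟨by lia, prevArc_le _ _ _, by rw [key_prevArc _ _ _ hp]; simp⟩
  · intro i hi a ha hal hk hic
    rcases Nat.lt_succ_iff_lt_or_eq.1 hi with hi | rfl
    · exact h.scanned i hi a ha hal hk fun _ => Nat.zero_le _
    · have := lt_prevArc key (q i) M a ha hk
      have := hic rfl
      lia
  · intro a ha
    obtain ⟨h4, i, hi, h5, h6⟩ := h.used_spec a ha
    exact ⟨h4, i, by lia, h5, fun e => by lia⟩

/-- When everything has been scanned, no arc leads from a marked vertex to an unmarked one. -/
lemma marked_closed (h : SearchInv n M key oth alive B₀ x₀ l₀ q mk qt qt 0 x last used old)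
    {y z : ℕ} (hy : y < n) (hmy : mk y = 1) (hyz : SearchArc M key oth alive y z) : mk z = 1 := by
  obtain ⟨a, ha, hal, rfl, rfl⟩ := hyz
  rcases h.mark _ hy with h0 | ⟨_, i, hi, hiv⟩
  · lia
  · exact h.scanned i hi a ha hal hiv.symm fun _ => Nat.zero_le _

/-- The search restarts from `x` or goes on to the next candidate. -/
lemma next (h : SearchInv n M key oth alive B₀ x₀ l₀ q mk qh qt cur x last used old)
    (hx : x < n) (hm : mk x = 1) :
    SearchInv n M key oth alive B₀ x₀ l₀ q mk qh qt cur (x + 1) last used old :=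
  ⟨h.queue, h.mark, h.inj, h.qh_le, ⟨by have := h.x_le; lia, hx⟩, h.cur_spec, h.scanned, h.used_spec, fun v h1 h2 => by
    rcases Nat.lt_succ_iff_lt_or_eq.1 h2 with h2 | rfl
    exacts [h.passed v h1 h2, hm], h.old_closed,
    h.old_marked, h.start_marked, h.reached, h.last_spec⟩

end SearchInv

end SearchInvariant

/-- One step of the search, with lists `top`, `next` of the arcs at a vertex, the array `oth` of
their other ends and the array `mk` of marks: scan an arc, or take the next vertex from the queue,
or try the next candidate for a restart. -/
def searchStep (top next oth mk : ℕ) : Prog :=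
  .ite (.neg (.natEq (reg regCur) (.lit 0)))
    (.seq
      (.ite (.conj (.natEq (.get arrAlive (.sub (reg regCur) (.lit 1))) (.lit 1))
          (.natEq (.get mk (.get oth (.sub (reg regCur) (.lit 1)))) (.lit 0)))
        (.seq (.setNat arrQueue (reg regTail) (.get oth (.sub (reg regCur) (.lit 1))))
          (.seq (.setNat mk (.get oth (.sub (reg regCur) (.lit 1))) (.lit 1))
            (setReg regTail (.add (reg regTail) (.lit 1)))))
        .skip)
      (setReg regCur (.get next (.sub (reg regCur) (.lit 1)))))
    (.ite (.natLt (reg regHead) (reg regTail))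
      (.seq (setReg regCur (.get top (.get arrQueue (reg regHead))))
        (setReg regHead (.add (reg regHead) (.lit 1))))
      (.seq
        (.ite (.natEq (.get mk (reg regCand)) (.lit 0))
          (.seq (.setNat arrQueue (reg regTail) (reg regCand))
            (.seq (.setNat mk (reg regCand) (.lit 1))
              (.seq (setReg regTail (.add (reg regTail) (.lit 1)))
                (setReg regLast (.add (reg regCand) (.lit 1))))))
          .skip)
        (setReg regCand (.add (reg regCand) (.lit 1)))))

/-- There is nothing left to be searched. -/
def searchDone : Test :=
  .conj (.natEq (reg regCur) (.lit 0))
    (.conj (.neg (.natLt (reg regHead) (reg regTail)))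
      (.neg (.natLt (reg regCand) (.get arrSize (.lit 0)))))

/-- The search. -/
def search (top next oth mk : ℕ) : Prog :=
  .loop (.neg searchDone) (searchStep top next oth mk)

/-- The invariant of the search, read off from the memory. -/
def SearchState (n M : ℕ) (key oth alive : ℕ → ℕ) (B₀ : Set ℕ) (x₀ l₀ mk : ℕ) (σ : State)
    (used : Finset ℕ) (old : Set ℕ) : Prop :=
  SearchInv n M key oth alive B₀ x₀ l₀ (σ.nat arrQueue) (σ.nat mk) (σ.nat regHead 0)
    (σ.nat regTail 0) (σ.nat regCur 0) (σ.nat regCand 0) (σ.nat regLast 0) used old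

lemma hoare_search {n M : ℕ} {key oth alive : ℕ → ℕ} {B₀ : Set ℕ} {x₀ l₀ : ℕ}
    {top next aoth mk : ℕ} {σ : State}
    (htop : 0 < top ∧ top < 14) (hnext : 0 < next ∧ next < 14) (hoth : 0 < aoth ∧ aoth < 14)
    (hmk : 14 < mk ∧ mk < 19)
    (hn : σ.nat arrSize 0 = n) (hT : ∀ y < n, σ.nat top y = prevArc key y M)
    (hN : ∀ a < M, σ.nat next a = prevArc key (key a) a) (hO : ∀ a < M, σ.nat aoth a = oth a)
    (hO' : ∀ a < M, oth a < n) (hA : ∀ a < M, σ.nat arrAlive a = alive a)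
    (hkey : ∀ a < M, key a < n)
    {used : Finset ℕ} {old : Set ℕ}
    (h : SearchState n M key oth alive B₀ x₀ l₀ mk σ used old) :
    Hoare (search top next aoth mk) σ (21 * (2 * n + M) + 1) (fun σ' => ∃ used old,
      SearchState n M key oth alive B₀ x₀ l₀ mk σ' used old ∧ σ'.nat regCur 0 = 0 ∧
        σ'.nat regHead 0 = σ'.nat regTail 0 ∧ σ'.nat regCand 0 = n) := by
  obtain ⟨ht1, ht2⟩ := htop
  obtain ⟨hn1, hn2⟩ := hnext
  obtain ⟨ho1, ho2⟩ := hoth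
  obtain ⟨hm1, hm2⟩ := hmk
  have key_inv := Hoare.loop_ghost (P := searchStep top next aoth mk) (b := .neg searchDone)
    (σ := σ) (T := 20) (γ := (Finset ℕ × Set ℕ) × ℕ × ℕ)
    (fun c σ' => SearchState n M key oth alive B₀ x₀ l₀ mk σ' c.1.1 c.1.2 ∧
      σ'.nat regHead 0 = c.2.1 ∧ σ'.nat regCand 0 = c.2.2)
    (fun c => (M - c.1.1.card) + (n - c.2.1) + (n - c.2.2)) ?_
    ((used, old), σ.nat regHead 0, σ.nat regCand 0) ⟨h, rfl, rfl⟩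
  · refine key_inv.frame.mono ?_ ?_
    · have : (20 + 1) * (M - used.card + (n - σ.nat regHead 0) + (n - σ.nat regCand 0)) ≤
          (20 + 1) * (2 * n + M) := Nat.mul_le_mul_left _ (by lia)
      lia
    · rintro σ' ⟨⟨c, ⟨h1, h2, h3⟩, h4⟩, hF⟩
      have hsz : σ'.nat arrSize = σ.nat arrSize := hF.nat _ (by
        simp [Prog.natMods, searchStep]; lia)
      simp only [Test.Holds, searchDone, NatExp.eval, not_not, hsz, hn] at h4
      refine ⟨c.1.1, c.1.2, h1, h4.1, le_antisymm h1.qh_le (by lia), le_antisymm h1.x_le.2 (by lia)⟩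
  · rintro ⟨⟨used, old⟩, qh, x⟩ σ' hF ⟨hS, hqh, hx⟩ hb
    dsimp only at hS hqh hx
    subst hqh hx
    have hfr : ∀ a, a ≠ mk → (a < 19 ∨ 24 < a) → σ'.nat a = σ.nat a := fun a h1 h2 => hF.nat a (by
      simp [Prog.natMods, searchStep]; lia)
    have hsz : σ'.nat arrSize 0 = n := by rw [hfr _ (by lia) (by lia), hn]
    have hT' : ∀ y < n, σ'.nat top y = prevArc key y M := by
      rw [hfr _ (by lia) (by lia)]; exact hT
    have hN' : ∀ a < M, σ'.nat next a = prevArc key (key a) a := by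
      rw [hfr _ (by lia) (by lia)]; exact hN
    have hO'' : ∀ a < M, σ'.nat aoth a = oth a := by
      rw [hfr _ (by lia) (by lia)]; exact hO
    have hA' : ∀ a < M, σ'.nat arrAlive a = alive a := by
      rw [hfr _ (by lia) (by lia)]; exact hA
    have e1 : mk ≠ 19 := by lia
    have e2 : mk ≠ 20 := by lia
    have e3 : mk ≠ 21 := by lia
    have e4 : mk ≠ 22 := by lia
    have e5 : mk ≠ 23 := by lia
    have e6 : mk ≠ 24 := by lia
    have e7 : mk ≠ aoth := by lia
    have e8 : mk ≠ next := by lia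
    have f1 : aoth ≠ 19 := by lia
    have f2 : aoth ≠ 21 := by lia
    have f3 : next ≠ 19 := by lia
    have f4 : next ≠ 21 := by lia
    have f5 : mk ≠ 14 := by lia
    refine Hoare.mono (T := 1 + 19) (Hoare.ite (Q := fun σ'' => ∃ c' : (Finset ℕ × Set ℕ) × ℕ × ℕ,
      (SearchState n M key oth alive B₀ x₀ l₀ mk σ'' c'.1.1 c'.1.2 ∧
      σ''.nat regHead 0 = c'.2.1 ∧ σ''.nat regCand 0 = c'.2.2) ∧
      (M - c'.1.1.card) + (n - c'.2.1) + (n - c'.2.2) < (M - used.card) +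
        (n - σ'.nat regHead 0) + (n - σ'.nat regCand 0)) ?_ ?_) le_rfl fun _ h => h
    · intro hc
      simp only [Test.Holds, NatExp.eval] at hc
      obtain ⟨c1, c2, c3⟩ := hS.cur_spec hc
      set cur := σ'.nat regCur 0 with hcur
      have hlt : cur - 1 < M := by lia
      have hcard : (insert (cur - 1) used).card = used.card + 1 :=
        Finset.card_insert_of_notMem (hS.notMem_used hc)
      have hO1 := hO'' _ hlt
      have hA1 := hA' _ hlt
      have hN1 := hN' _ hlt
      refine Hoare.of_run (by rfl) (by simp [Prog.size]) ?_
      by_cases hif : alive (cur - 1) = 1 ∧ σ'.nat mk (oth (cur - 1)) = 0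
      · have h0 := hS.push (hO' _ hlt) hif.2 (σ'.nat regLast 0) old (by
          by_cases hk : key (cur - 1) ∈ old
          · have := (hS.old_marked _ (hS.old_closed _ hk _ ⟨_, hlt, hif.1, rfl, rfl⟩)).2
            lia
          · refine Or.inl ⟨rfl, rfl, key (cur - 1), hkey _ hlt, ?_, hk, _, hlt, hif.1, rfl, rfl⟩
            rw [c3]
            exact (hS.queue _ (by have := hS.qh_le; lia)).2)
        have h1 := h0.advance hc (fun _ => Function.update_self _ _ _)
        refine ⟨((insert (cur - 1) used, old), σ'.nat regHead 0, σ'.nat regCand 0),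
          ⟨?_, ?_, ?_⟩, ?_⟩
        · simpa [SearchState, ← hcur, hO1, hA1, hN1, hif.1, hif.2, e1, e1.symm, e2.symm, e3, e3.symm, e4, e4.symm,
            e5.symm, e6.symm, e7.symm, e8.symm, f1, f2, f3, f4] using h1
        · simp [← hcur, hO1, hA1, hif.1, hif.2, e2.symm]
        · simp [← hcur, hO1, hA1, hif.1, hif.2, e5.symm]
        · have := h1.card_used_le
          rw [hcard] at this
          simp only [hcard]
          lia
      · have h1 := hS.advance hc (fun hal => by
          rcases hS.mark _ (hO' _ hlt) with h0 | h1
          · exact absurd ⟨hal, h0⟩ hif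
          · exact h1.1)
        refine ⟨((insert (cur - 1) used, old), σ'.nat regHead 0, σ'.nat regCand 0),
          ⟨?_, ?_, ?_⟩, ?_⟩
        · simpa [SearchState, ← hcur, hO1, hA1, hN1, hif, e4] using h1
        · simp [← hcur, hO1, hA1, hif]
        · simp [← hcur, hO1, hA1, hif]
        · have := h1.card_used_le
          rw [hcard] at this
          simp only [hcard]
          lia
    · intro hc
      simp only [Test.Holds, NatExp.eval, not_not] at hc
      have hle := hS.qt_le
      rw [SearchState, hc] at hS
      refine Hoare.mono (T := 1 + 18) (Hoare.ite ?_ ?_) le_rfl fun _ h => h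
      · intro hq
        simp only [Test.Holds, NatExp.eval] at hq
        have h1 := hS.pop hq
        have hqn := (hS.queue _ hq).1
        refine Hoare.of_run (by rfl) (by simp [Prog.size]) ?_
        refine ⟨((used, old), σ'.nat regHead 0 + 1, σ'.nat regCand 0), ⟨?_, ?_, ?_⟩, ?_⟩
        · simpa [SearchState, hT' _ hqn, e2, e4] using h1
        · simp
        · simp
        · lia
      · intro hq
        simp only [Test.Holds, NatExp.eval] at hq
        have hqe : σ'.nat regHead 0 = σ'.nat regTail 0 := le_antisymm hS.qh_le (by lia)
        have hxn : σ'.nat regCand 0 < n := by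
          by_contra hxn
          apply hb
          simp only [Test.Holds, searchDone, NatExp.eval, hsz]
          exact ⟨hc, hq, hxn⟩
        refine Hoare.of_run (by rfl) (by simp [Prog.size]) ?_
        rcases hS.mark _ hxn with hm0 | ⟨hm1, -⟩
        · have h0 := hS.push hxn hm0 (σ'.nat regCand 0 + 1) {v | v < n ∧ σ'.nat mk v = 1}
            (Or.inr ⟨lt_of_le_of_lt hS.x_le.1 hxn, rfl, rfl, fun y hy z hyz => by
              rw [hqe] at hS
              refine ⟨?_, hS.marked_closed hy.1 hy.2 hyz⟩
              obtain ⟨a, ha, _, _, rfl⟩ := hyz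
              exact hO' a ha⟩)
          have h1 := h0.next hxn (by simp)
          refine ⟨((used, {v | v < n ∧ σ'.nat mk v = 1}), σ'.nat regHead 0,
            σ'.nat regCand 0 + 1), ⟨?_, ?_, ?_⟩, ?_⟩
          · simpa [SearchState, hm0, hc, e1, e1.symm, e2.symm, e3, e3.symm, e4.symm, e5, e5.symm,
              e6, e6.symm] using h1
          · simp [hm0, e2.symm]
          · simp [hm0, e5.symm]
          · lia
        · have h1 := hS.next hxn hm1
          refine ⟨((used, old), σ'.nat regHead 0, σ'.nat regCand 0 + 1), ⟨?_, ?_, ?_⟩, ?_⟩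
          · simpa [SearchState, hm1, hc, e5] using h1
          · simp [hm1]
          · simp [hm1]
          · lia

/-! ### Finding a minimal cluster -/

/-- The memory contains the network `G`, read as a directed graph, and for each vertex
the lists of the arcs that start, and that end, there. -/
structure Encodes {n M : ℕ} (G : Network (Fin n) (Fin M)) (σ : State) : Prop where
  size : σ.nat arrSize 0 = n
  arcs : σ.nat regArcs 0 = M
  tail : ∀ a : Fin M, σ.nat arrTail a = G.fst a
  head : ∀ a : Fin M, σ.nat arrHead a = G.snd a
  fail : ∀ a : Fin M, σ.real arrFail a = G.fail a
  tailTop : ∀ y < n, σ.nat arrTailTop y = prevArc (σ.nat arrTail) y M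
  tailNext : ∀ a < M, σ.nat arrTailNext a = prevArc (σ.nat arrTail) (σ.nat arrTail a) a
  headTop : ∀ y < n, σ.nat arrHeadTop y = prevArc (σ.nat arrHead) y M
  headNext : ∀ a < M, σ.nat arrHeadNext a = prevArc (σ.nat arrHead) (σ.nat arrHead a) a

/-- The roots are the vertices with a positive rank up to the threshold. -/
def RootsAre {n : ℕ} (R : Finset (Fin n)) (σ : State) : Prop :=
  ∀ v : Fin n, v ∈ R ↔ 0 < σ.nat arrRank v ∧ σ.nat arrRank v ≤ σ.nat regThr 0

/-- The entries `1` of the array `a` represent the set `S`. -/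
def IsSet {k : ℕ} (a : ℕ) (S : Finset (Fin k)) (σ : State) : Prop :=
  ∀ x : Fin k, x ∈ S ↔ σ.nat a x = 1

lemma Encodes.congr {n M : ℕ} {G : Network (Fin n) (Fin M)} {σ σ' : State} (h : Encodes G σ)
    (h1 : ∀ a < 11, (a = 0 ∨ 4 ≤ a) → σ'.nat a = σ.nat a) (h2 : σ'.real arrFail = σ.real arrFail) :
    Encodes G σ' := by
  refine ⟨?_, ?_, ?_, ?_, ?_, ?_, ?_, ?_, ?_⟩
  · rw [h1 _ (by lia) (by lia)]; exact h.size
  · rw [h1 _ (by lia) (by lia)]; exact h.arcs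
  · rw [h1 4 (by lia) (by lia)]; exact h.tail
  · rw [h1 5 (by lia) (by lia)]; exact h.head
  · rw [h2]; exact h.fail
  · rw [h1 4 (by lia) (by lia), h1 7 (by lia) (by lia)]; exact h.tailTop
  · rw [h1 4 (by lia) (by lia), h1 8 (by lia) (by lia)]; exact h.tailNext
  · rw [h1 5 (by lia) (by lia), h1 9 (by lia) (by lia)]; exact h.headTop
  · rw [h1 5 (by lia) (by lia), h1 10 (by lia) (by lia)]; exact h.headNext

lemma RootsAre.congr {n : ℕ} {R : Finset (Fin n)} {σ σ' : State} (h : RootsAre R σ)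
    (h1 : σ'.nat arrRank = σ.nat arrRank) (h2 : σ'.nat regThr 0 = σ.nat regThr 0) :
    RootsAre R σ' := by
  unfold RootsAre; rw [h1, h2]; exact h

lemma IsSet.congr {k a : ℕ} {S : Finset (Fin k)} {σ σ' : State} (h : IsSet a S σ)
    (h1 : σ'.nat a = σ.nat a) : IsSet a S σ' := by
  unfold IsSet; rw [h1]; exact h

section

variable {n M : ℕ} {G : Network (Fin n) (Fin M)} {S : Finset (Fin M)} {σ : State}

lemma Encodes.tail_lt (h : Encodes G σ) : ∀ a < M, σ.nat arrTail a < n := fun a ha => by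
  rw [h.tail ⟨a, ha⟩]; exact (G.fst _).2

lemma Encodes.head_lt (h : Encodes G σ) : ∀ a < M, σ.nat arrHead a < n := fun a ha => by
  rw [h.head ⟨a, ha⟩]; exact (G.snd _).2

lemma Encodes.searchArc (h : Encodes G σ) (hS : IsSet arrAlive S σ) {y z : ℕ} :
    SearchArc M (σ.nat arrTail) (σ.nat arrHead) (σ.nat arrAlive) y z ↔
      ∃ u v : Fin n, y = u ∧ z = v ∧ G.Arc S u v := by
  constructor
  · rintro ⟨a, ha, hal, rfl, rfl⟩
    exact ⟨G.fst ⟨a, ha⟩, G.snd ⟨a, ha⟩, h.tail ⟨a, ha⟩, h.head ⟨a, ha⟩, ⟨a, ha⟩,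
      (hS ⟨a, ha⟩).2 hal, rfl, rfl⟩
  · rintro ⟨_, _, rfl, rfl, a, ha, rfl, rfl⟩
    exact ⟨a, a.2, (hS a).1 ha, h.tail a, h.head a⟩

lemma Encodes.searchArc_rev (h : Encodes G σ) (hS : IsSet arrAlive S σ) {y z : ℕ} :
    SearchArc M (σ.nat arrHead) (σ.nat arrTail) (σ.nat arrAlive) y z ↔
      ∃ u v : Fin n, y = u ∧ z = v ∧ G.Arc S v u := by
  constructor
  · rintro ⟨a, ha, hal, rfl, rfl⟩
    exact ⟨G.snd ⟨a, ha⟩, G.fst ⟨a, ha⟩, h.head ⟨a, ha⟩, h.tail ⟨a, ha⟩, ⟨a, ha⟩,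
      (hS ⟨a, ha⟩).2 hal, rfl, rfl⟩
  · rintro ⟨_, _, rfl, rfl, a, ha, rfl, rfl⟩
    exact ⟨a, a.2, (hS a).1 ha, h.head a, h.tail a⟩

lemma reflTransGen_lift {A : Fin n → Fin n → Prop} {A' : ℕ → ℕ → Prop}
    (hA : ∀ y z, A' y z → ∃ u v : Fin n, y = u ∧ z = v ∧ A u v) {b : Fin n} {v : ℕ}
    (h : Relation.ReflTransGen A' b v) : ∃ w : Fin n, v = w ∧ Relation.ReflTransGen A b w := by
  induction h with
  | refl => exact ⟨b, rfl, .refl⟩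
  | tail _ h ih =>
    obtain ⟨w, rfl, hw⟩ := ih
    obtain ⟨u, v, hu, rfl, huv⟩ := hA _ _ h
    obtain rfl := Fin.ext hu
    exact ⟨v, rfl, hw.tail huv⟩

end

/-- Mark and enqueue the roots, and clear the mask. -/
def markRoots : Prog :=
  .seq (setReg regHead (.lit 0)) <| .seq (setReg regTail (.lit 0)) <|
  .seq (setReg regCur (.lit 0)) <| .seq (setReg regCand (.lit 0)) <|
  .seq (setReg regLast (.lit 0)) <| .seq (setReg regI (.lit 0)) <|
  .loop (.natLt (reg regI) (.get arrSize (.lit 0))) <|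
    .seq (.setNat arrMask (reg regI) (.lit 0)) <|
    .seq (.ite (.conj (.natLt (.lit 0) (.get arrRank (reg regI)))
        (.neg (.natLt (reg regThr) (.get arrRank (reg regI)))))
      (.seq (.setNat arrMark (reg regI) (.lit 1)) <|
        .seq (.setNat arrQueue (reg regTail) (reg regI)) <|
        setReg regTail (.add (reg regTail) (.lit 1)))
      (.setNat arrMark (reg regI) (.lit 0))) <|
    setReg regI (.add (reg regI) (.lit 1))

lemma hoare_markRoots {n : ℕ} {σ : State} (hn : σ.nat arrSize 0 = n) :
    Hoare markRoots σ (12 * n + 20) (fun σ' =>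
      (σ'.nat regHead 0 = 0 ∧ σ'.nat regCur 0 = 0 ∧ σ'.nat regCand 0 = 0 ∧ σ'.nat regLast 0 = 0) ∧
      (∀ v < n, σ'.nat arrMask v = 0) ∧
      (∀ v < n, σ'.nat arrMark v =
        if 0 < σ.nat arrRank v ∧ σ.nat arrRank v ≤ σ.nat regThr 0 then 1 else 0) ∧
      (∀ i < σ'.nat regTail 0, σ'.nat arrQueue i < n ∧ σ'.nat arrMark (σ'.nat arrQueue i) = 1) ∧
      (∀ v < n, σ'.nat arrMark v = 1 → ∃ i < σ'.nat regTail 0, σ'.nat arrQueue i = v) ∧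
      (∀ i < σ'.nat regTail 0, ∀ j < σ'.nat regTail 0,
        σ'.nat arrQueue i = σ'.nat arrQueue j → i = j)) := by
  set isRoot : ℕ → Prop := fun v => 0 < σ.nat arrRank v ∧ σ.nat arrRank v ≤ σ.nat regThr 0
    with hroot
  set J : ℕ → State → Prop := fun k σ' =>
      (σ'.nat regHead 0 = 0 ∧ σ'.nat regCur 0 = 0 ∧ σ'.nat regCand 0 = 0 ∧ σ'.nat regLast 0 = 0) ∧
      (∀ v < k, σ'.nat arrMask v = 0) ∧
      (∀ v < k, σ'.nat arrMark v = if isRoot v then 1 else 0) ∧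
      (∀ i < σ'.nat regTail 0, σ'.nat arrQueue i < k ∧ σ'.nat arrMark (σ'.nat arrQueue i) = 1) ∧
      (∀ v < k, σ'.nat arrMark v = 1 → ∃ i < σ'.nat regTail 0, σ'.nat arrQueue i = v) ∧
      (∀ i < σ'.nat regTail 0, ∀ j < σ'.nat regTail 0,
        σ'.nat arrQueue i = σ'.nat arrQueue j → i = j) ∧
      σ'.nat regI 0 = k ∧ σ'.nat arrSize 0 = n ∧ σ'.nat arrRank = σ.nat arrRank ∧
      σ'.nat regThr 0 = σ.nat regThr 0 with hJ
  refine Hoare.mono (T := 1 + 1 + (1 + 1 + (1 + 1 + (1 + 1 + (1 + 1 + (1 + 1 + ((11 + 1) * n + 1)))))))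
    (Q := J n) ?_ (by lia) ?_
  · have hs : ∀ (a : ℕ) (σ' : State), Hoare (setReg a (.lit 0)) σ' 1
        (fun σ'' => σ'' = σ'.writeNat a 0 0) := fun a σ' => Hoare.of_run rfl (by simp [Prog.size])
          (by simp)
    refine (hs _ _).seq fun σ₁ h1 => (hs _ _).seq fun σ₂ h2 => (hs _ _).seq fun σ₃ h3 =>
      (hs _ _).seq fun σ₄ h4 => (hs _ _).seq fun σ₅ h5 => (hs _ _).seq fun σ₆ h6 =>
      Hoare.loop_count J n ?_ ?_ ?_
    · rintro k hk σ' - ⟨⟨g1, g2, g3, g4⟩, g5, g6, g7, g8, g9, gI, gn, gr, gt⟩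
      refine ⟨by simpa [gI, gn] using hk, ?_⟩
      refine Hoare.of_run (by rfl) (by simp [Prog.size]) ?_
      have hqk : ∀ i < σ'.nat regTail 0, σ'.nat arrQueue i ≠ k := fun i hi => (g7 i hi).1.ne
      by_cases hr : isRoot k
      · have hc1 : 0 < σ.nat arrRank k := hr.1
        have hc2 : σ.nat arrRank k ≤ σ.nat regThr 0 := hr.2
        simp only [hJ, Prog.run, NatExp.eval, Test.Holds, gI, gt, gr, not_lt, State.nat_writeNat_self,
          State.nat_writeNat_of_ne, ne_eq, Nat.reduceEqDiff,
          not_false_eq_true, hc1, hc2, and_self, if_true, Function.update_self,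
          OfNat.zero_ne_ofNat]
        refine ⟨⟨g1, g2, g3, g4⟩, ?_, ?_, ?_, ?_, ?_, by simp [gn]⟩
        · intro v hv
          by_cases hvk : v = k
          · simp [hvk]
          · simpa [hvk] using g5 v (by lia)
        · intro v hv
          by_cases hvk : v = k
          · simp [hvk, hr]
          · simpa [hvk] using g6 v (by lia)
        · intro i hi
          by_cases hit : i = σ'.nat regTail 0
          · simp [hit]
          · have := g7 i (by lia)
            have hne := hqk i (by lia)
            simp only [Function.update_of_ne hit, Function.update_of_ne hne]
            exact ⟨by lia, this.2⟩
        · intro v hv hm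
          by_cases hvk : v = k
          · exact ⟨σ'.nat regTail 0, by lia, by simp [hvk]⟩
          · rw [Function.update_of_ne hvk] at hm
            obtain ⟨i, hi, hiv⟩ := g8 v (by lia) hm
            exact ⟨i, by lia, by rw [Function.update_of_ne (by lia)]; exact hiv⟩
        · intro i hi j hj hij
          by_cases hit : i = σ'.nat regTail 0 <;> by_cases hjt : j = σ'.nat regTail 0
          · rw [hit, hjt]
          · rw [hit, Function.update_self, Function.update_of_ne hjt] at hij
            exact absurd hij.symm (hqk j (by lia))
          · rw [hjt, Function.update_self, Function.update_of_ne hit] at hij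
            exact absurd hij (hqk i (by lia))
          · rw [Function.update_of_ne hit, Function.update_of_ne hjt] at hij
            exact g9 i (by lia) j (by lia) hij
      · have hc : ¬ (0 < σ.nat arrRank k ∧ σ.nat arrRank k ≤ σ.nat regThr 0) := hr
        simp only [hJ, Prog.run, NatExp.eval, Test.Holds, gI, gt, gr, not_lt, State.nat_writeNat_self,
          State.nat_writeNat_of_ne, ne_eq, Nat.reduceEqDiff,
          not_false_eq_true, hc, if_false, Function.update_self,
          OfNat.zero_ne_ofNat]
        refine ⟨⟨g1, g2, g3, g4⟩, ?_, ?_, ?_, ?_, g9, by simp [gn]⟩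
        · intro v hv
          by_cases hvk : v = k
          · simp [hvk]
          · simpa [hvk] using g5 v (by lia)
        · intro v hv
          by_cases hvk : v = k
          · simp [hvk, hr]
          · simpa [hvk] using g6 v (by lia)
        · intro i hi
          have := g7 i hi
          rw [Function.update_of_ne (hqk i hi)]
          exact ⟨by lia, this.2⟩
        · intro v hv hm
          by_cases hvk : v = k
          · simp [hvk] at hm
          · rw [Function.update_of_ne hvk] at hm
            exact g8 v (by lia) hm
    · rintro σ' - ⟨-, -, -, -, -, -, gI, gn, -⟩
      simp [gI, gn]
    · subst h6 h5 h4 h3 h2 h1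
      simp [hJ, hn]
  · rintro σ' ⟨g1, g5, g6, g7, g8, g9, -⟩
    exact ⟨g1, g5, g6, g7, g8, g9⟩

/-- Collect in the mask the vertices that are reachable from the vertex of the last restart. -/
def collect : Prog :=
  .seq (.seq (setReg regHead (.lit 0)) <| .seq (setReg regTail (.lit 1)) <|
    .seq (setReg regCur (.lit 0)) <|
    .seq (.setNat arrQueue (.lit 0) (.sub (reg regLast) (.lit 1))) <|
    .setNat arrMask (.sub (reg regLast) (.lit 1)) (.lit 1)) <|
  search arrTailTop arrTailNext arrHead arrMask

/-- Find a minimal cluster. A search against the direction of the arcs starts from the roots, and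
restarts from unmarked vertices as long as there are any. If there was no restart, then all vertices
have paths to the roots. Otherwise the vertices reachable from the vertex of the last restart are a
minimal cluster: they are not marked earlier, so they are found by the search from this vertex. -/
def find : Prog :=
  .seq markRoots <| .seq (search arrHeadTop arrHeadNext arrTail arrMark) <|
  .seq (setReg regFlag (reg regLast)) <|
  .ite (.neg (.natEq (reg regFlag) (.lit 0))) collect .skip

section

variable {n M : ℕ} {G : Network (Fin n) (Fin M)} {S : Finset (Fin M)} {R : Finset (Fin n)}
  {σ : State}

/-- What the search against the direction of the arcs achieves. -/
lemma hoare_restarts (hE : Encodes G σ) (hR : RootsAre R σ) (hS : IsSet arrAlive S σ) :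
    Hoare (.seq markRoots (search arrHeadTop arrHeadNext arrTail arrMark)) σ
      (60 * (n + M + 1)) (fun σ' => σ'.nat regCand 0 = n ∧ (∀ v < n, σ'.nat arrMask v = 0) ∧
        ((σ'.nat regLast 0 = 0 ∧ G.RootConn R S) ∨ (σ'.nat regLast 0 ≠ 0 ∧ ∃ (s : Fin n)
          (old : Set (Fin n)), σ'.nat regLast 0 - 1 = s ∧ s ∉ old ∧ (∀ v ∈ R, v ∈ old) ∧
          (∀ y ∈ old, ∀ z, G.Arc S z y → z ∈ old) ∧
          ∀ v, v ∉ old → G.Reaches S v s))) := by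
  refine Hoare.mono (T := 1 + (12 * n + 20) + (21 * (2 * n + M) + 1)) ?_ (by lia) fun _ h => h
  refine (hoare_markRoots hE.size).frame.seq ?_
  rintro σ₁ ⟨⟨⟨h1, h2, h3, h4⟩, hmask, hmark, hq, hq', hinj⟩, hF⟩
  have hfr : ∀ a, (a < 16 ∨ a = 17) → σ₁.nat a = σ.nat a := fun a ha => hF.nat a (by
    simp [markRoots, Prog.natMods]; omega)
  have hfr' : σ₁.real arrFail = σ.real arrFail := hF.real _ (by simp [markRoots, Prog.realMods])
  have hE₁ : Encodes G σ₁ := hE.congr (fun a ha _ => hfr a (by lia)) hfr'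
  have hS₁ : IsSet arrAlive S σ₁ := hS.congr (hfr _ (by lia))
  set B₀ : Set ℕ := {v | ∃ w : Fin n, v = w ∧ w ∈ R} with hB
  have hmk : ∀ v (hv : v < n), σ₁.nat arrMark v = if (⟨v, hv⟩ : Fin n) ∈ R then 1 else 0 :=
    fun v hv => by rw [hmark v hv]; exact if_congr (hR ⟨v, hv⟩).symm rfl rfl
  have hinit : SearchState n M (σ₁.nat arrHead) (σ₁.nat arrTail) (σ₁.nat arrAlive) B₀ 0 0 arrMark σ₁
      ∅ ∅ := by
    rw [SearchState, h1, h2, h3, h4]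
    refine ⟨hq, fun v hv => ?_, hinj, Nat.zero_le _, ⟨le_rfl, Nat.zero_le _⟩, by simp, by simp,
      by simp, by simp, by simp, by simp, ?_, ?_, Or.inl ⟨rfl, rfl⟩⟩
    · by_cases hvR : (⟨v, hv⟩ : Fin n) ∈ R
      · have : σ₁.nat arrMark v = 1 := by rw [hmk v hv, if_pos hvR]
        exact Or.inr ⟨this, hq' v hv this⟩
      · exact Or.inl (by rw [hmk v hv, if_neg hvR])
    · rintro _ ⟨w, rfl, hw⟩
      exact ⟨w.2, by rw [hmk w w.2, if_pos hw]⟩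
    · intro v hv hm
      rw [hmk v hv] at hm
      have : (⟨v, hv⟩ : Fin n) ∈ R := by
        by_contra h; simp [h] at hm
      exact Or.inr (Or.inl ⟨rfl, rfl, v, ⟨⟨v, hv⟩, rfl, this⟩, .refl⟩)
  refine (hoare_search (by lia) (by lia) (by lia) (by lia) hE₁.size hE₁.headTop hE₁.headNext
    (fun _ _ => rfl) hE₁.tail_lt (fun _ _ => rfl) hE₁.head_lt hinit).frame.conseq ?_
  rintro σ₂ ⟨⟨used, old, hI, c1, c2, c3⟩, hF₂⟩
  have hmask₂ : σ₂.nat arrMask = σ₁.nat arrMask :=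
    hF₂.nat _ (by simp [search, searchStep, Prog.natMods])
  rw [SearchState, c1, c2, c3] at hI
  refine ⟨c3, by rw [hmask₂]; exact hmask, ?_⟩
  have hall : ∀ v < n, σ₂.nat arrMark v = 1 := fun v hv => hI.passed v (Nat.zero_le _) hv
  have hlift : ∀ (b v : Fin n), Relation.ReflTransGen (SearchArc M (σ₁.nat arrHead)
      (σ₁.nat arrTail) (σ₁.nat arrAlive)) b v → G.Reaches S v b := fun b v h => by
    obtain ⟨w, hw, hbw⟩ := reflTransGen_lift (fun y z => (hE₁.searchArc_rev hS₁).1) h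
    obtain rfl := Fin.ext hw
    exact Relation.reflTransGen_swap.1 hbw
  by_cases hl : σ₂.nat regLast 0 = 0
  · refine Or.inl ⟨hl, fun v => ?_⟩
    have hold : old = ∅ := by
      rcases hI.last_spec with h | h
      · exact h.2
      · exact absurd hl h.2.1
    rcases hI.reached v v.2 (hall v v.2) with h | ⟨_, _, b, ⟨w, rfl, hw⟩, hbv⟩ | h
    · simp [hold] at h
    · exact ⟨w, hw, hlift w v hbv⟩
    · exact absurd hl h.2.1
  · refine Or.inr ⟨hl, ?_⟩
    rcases hI.last_spec with h | ⟨_, _, hln, hlo, hBo⟩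
    · exact absurd h.1 hl
    refine ⟨⟨σ₂.nat regLast 0 - 1, hln⟩, {v | (v : ℕ) ∈ old}, rfl, hlo,
      fun v hv => hBo ⟨v, rfl, hv⟩, fun y hy z hzy => ?_, fun v hv => ?_⟩
    · exact hI.old_closed _ hy _ ((hE₁.searchArc_rev hS₁).2 ⟨y, z, rfl, rfl, hzy⟩)
    · rcases hI.reached v v.2 (hall v v.2) with h | ⟨h, _⟩ | ⟨_, _, h⟩
      · exact absurd h hv
      · exact absurd h hl
      · exact hlift ⟨_, hln⟩ v h

/-- The vertices reachable from `s` are collected. -/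
lemma hoare_collect (hE : Encodes G σ) (hS : IsSet arrAlive S σ) {s : Fin n}
    (hx : σ.nat regCand 0 = n) (hmask : ∀ v < n, σ.nat arrMask v = 0)
    (hs : σ.nat regLast 0 - 1 = s) :
    Hoare collect σ (50 * (n + M + 1)) (fun σ' => IsSet arrMask (G.reachSet S s) σ') := by
  refine Hoare.mono (T := 1 + 9 + (21 * (2 * n + M) + 1)) ?_ (by lia) fun _ h => h
  refine Hoare.seq (Q := fun σ₁ => Encodes G σ₁ ∧ IsSet arrAlive S σ₁ ∧ SearchState n M
    (σ₁.nat arrTail) (σ₁.nat arrHead) (σ₁.nat arrAlive) {(s : ℕ)} n (σ.nat regLast 0) arrMask σ₁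
      ∅ ∅) ?_ ?_
  · refine Hoare.of_run (by rfl) (by simp [Prog.size]) ?_
    refine ⟨hE.congr (fun a ha _ => ?_) ?_, hS.congr ?_, ?_⟩
    · simp only [Prog.run]
      repeat rw [State.nat_writeNat_of_ne _ _ _ (by lia)]
    · simp
    · simp
    · have hupd : ∀ v, Function.update (σ.nat arrMask) (s : ℕ) 1 v = 1 → v < n → v = s := by
        intro v hv hvn
        by_contra hne
        rw [Function.update_of_ne hne, hmask v hvn] at hv
        lia
      have : SearchInv n M (σ.nat arrTail) (σ.nat arrHead) (σ.nat arrAlive) {(s : ℕ)} n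
          (σ.nat regLast 0) (Function.update (σ.nat arrQueue) 0 s)
          (Function.update (σ.nat arrMask) s 1) 0 1 0 n (σ.nat regLast 0) ∅ ∅ := by
        refine ⟨?_, fun v hv => ?_, fun i hi j hj _ => by lia, Nat.zero_le _, ⟨le_rfl, le_rfl⟩,
          by simp, by simp, by simp, fun v _ _ => by lia, by simp, by simp, ?_, ?_,
          Or.inl ⟨rfl, rfl⟩⟩
        · intro i hi
          obtain rfl : i = 0 := by lia
          simp
        · by_cases hvs : v = s
          · right; exact ⟨by simp [hvs], 0, by lia, by simp [hvs]⟩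
          · left; rw [Function.update_of_ne hvs]; exact hmask v hv
        · rintro v rfl
          simp
        · intro v hv hm
          exact Or.inr (Or.inl ⟨rfl, rfl, s, rfl, by rw [hupd v hm hv]⟩)
      simpa [SearchState, hx, hs] using this
  · rintro σ₁ ⟨hE₁, hS₁, hI₁⟩
    refine (hoare_search (by lia) (by lia) (by lia) (by lia) hE₁.size hE₁.tailTop hE₁.tailNext
      (fun _ _ => rfl) hE₁.head_lt (fun _ _ => rfl) hE₁.tail_lt hI₁).conseq ?_
    rintro σ₂ ⟨used, old, hI, c1, c2, c3⟩
    rw [SearchState, c1, c2, c3] at hI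
    intro v
    rw [Network.mem_reachSet]
    constructor
    · intro h
      induction h with
      | refl => exact (hI.start_marked s rfl).2
      | @tail b c _ hbc ih =>
        exact hI.marked_closed b.2 ih ((hE₁.searchArc hS₁).2 ⟨b, c, rfl, rfl, hbc⟩)
    · intro hm
      have hold : old = ∅ := by
        rcases hI.last_spec with h | h
        · exact h.2
        · exact absurd h.1 (lt_irrefl n)
      rcases hI.reached v v.2 hm with h | ⟨_, _, b, rfl, h⟩ | h
      · simp [hold] at h
      · obtain ⟨w, hw, hbw⟩ := reflTransGen_lift (fun y z => (hE₁.searchArc hS₁).1) h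
        obtain rfl := Fin.ext hw
        exact hbw
      · exact absurd h.1 (lt_irrefl n)

/-- The outcome of `find`. -/
def Found (G : Network (Fin n) (Fin M)) (R : Finset (Fin n)) (S : Finset (Fin M)) (σ : State) :
    Prop :=
  (σ.nat regFlag 0 = 0 ∧ G.RootConn R S) ∨
    (σ.nat regFlag 0 ≠ 0 ∧ ∃ C, G.MinCluster R S C ∧ IsSet arrMask C σ)

lemma hoare_find (hE : Encodes G σ) (hR : RootsAre R σ) (hS : IsSet arrAlive S σ) :
    Hoare find σ (120 * (n + M + 1)) (Found G R S) := by
  have h1 := (hoare_restarts hE hR hS).frame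
  obtain ⟨σ₁, t, hb, ht, ⟨⟨hx, hmask, hcase⟩, hF⟩⟩ := h1
  -- the two parts of the search are associated differently in `find`
  cases hb with
  | @seq _ _ _ σ₀ _ t₁ t₂ hb₁ hb₂ =>
    have hfr : ∀ a, (a < 16 ∨ a = 17) → σ₁.nat a = σ.nat a := fun a ha => hF.nat a (by
      simp [markRoots, search, searchStep, Prog.natMods]; omega)
    have hfr' : σ₁.real arrFail = σ.real arrFail := hF.real _ (by
      simp [markRoots, search, searchStep, Prog.realMods])
    have hE₁ : Encodes G σ₁ := hE.congr (fun a ha _ => hfr a (by lia)) hfr'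
    have hS₁ : IsSet arrAlive S σ₁ := hS.congr (hfr _ (by lia))
    have h2 : Hoare (.seq (setReg regFlag (reg regLast))
        (.ite (.neg (.natEq (reg regFlag) (.lit 0))) collect .skip)) σ₁
        (1 + 1 + (1 + 50 * (n + M + 1))) (Found G R S) := by
      refine Hoare.seq (Q := fun σ₂ => σ₂ = σ₁.writeNat regFlag 0 (σ₁.nat regLast 0))
        (Hoare.of_run (by rfl) (by simp [Prog.size]) (by simp)) ?_
      rintro σ₂ rfl
      refine Hoare.ite (fun hl => ?_) (fun hl => ?_)
      · simp only [Test.Holds, NatExp.eval, State.nat_writeNat_self, Function.update_self] at hl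
        rcases hcase with h | ⟨_, s, old, hs, hso, hRo, hcl, hre⟩
        · exact absurd h.1 hl
        refine (hoare_collect (s := s) (S := S) (G := G) (hE₁.congr (fun a ha _ =>
          State.nat_writeNat_of_ne _ _ _ (by lia)) rfl) (hS₁.congr (by simp)) (by simp [hx])
          (by simpa using hmask) (by simpa using hs)).frame.conseq ?_
        rintro σ₃ ⟨h3, hF₃⟩
        have hpre : ∀ x v, G.Reaches S x v → v ∈ old → x ∈ old := fun x v h hv => by
          induction h using Relation.ReflTransGen.head_induction_on with
          | refl => exact hv
          | head hbc _ ih => exact hcl _ ih _ hbc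
        have hnot : ∀ v, G.Reaches S s v → v ∉ old := fun v hsv hv => hso (hpre s v hsv hv)
        refine Or.inr ⟨?_, G.reachSet S s, ⟨⟨s, Network.mem_reachSet.2 .refl⟩, fun v hv hvR =>
          hnot v (Network.mem_reachSet.1 hv) (hRo v hvR), Network.reachSet_closed,
          fun u hu v hv => (hre u (hnot u (Network.mem_reachSet.1 hu))).trans
            (Network.mem_reachSet.1 hv)⟩, h3⟩
        rw [hF₃.nat _ (by simp [collect, search, searchStep, Prog.natMods])]
        simpa using hl
      · simp only [Test.Holds, NatExp.eval, State.nat_writeNat_self, Function.update_self,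
          not_not] at hl
        rcases hcase with h | h
        · refine (Hoare.of_run (T := 1) (Q := Found G R S) (by rfl) (by simp [Prog.size])
            ?_).mono (by lia) fun _ h => h
          exact Or.inl ⟨by simpa using hl, h.2⟩
        · exact absurd hl h.1
    obtain ⟨σ₂, t', hb', ht', hfound⟩ := h2
    exact ⟨σ₂, _, hb₁.seq (hb₂.seq hb'), by lia, hfound⟩

end

/-! ### Sampling -/

lemma Spec.toss {σ : State} {a : ℕ} {i : NatExp} {p : RealExp} (h0 : 0 ≤ p.eval σ)
    (h1 : p.eval σ ≤ 1) : Spec (.toss a i p) σ (coin (p.eval σ))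
      (fun b σ' => σ' = σ.writeNat a (i.eval σ) (if b then 1 else 0)) 1 := by
  have hev : ∀ g : Bool → ℝ≥0∞, ev (coin (p.eval σ)) g = ENNReal.ofReal (p.eval σ) * g true +
      ENNReal.ofReal (1 - p.eval σ) * g false := fun g => by
    rw [ev_eq_sum, Fintype.sum_bool, coin_true h1, coin_false h0 h1]
  constructor
  · intro f g hfg
    rw [hev, wp_toss _ _ _ _ _ _ h0 h1, zero_add]
    gcongr
    · simpa using hfg true _ rfl
    · simpa using hfg false _ rfl
  · intro f g hfg
    rw [hev, wp_toss _ _ _ _ _ _ h0 h1]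
    gcongr
    · simpa using hfg true _ rfl
    · simpa using hfg false _ rfl

open Classical in
/-- The kernel that decides whether the arc `M - 1 - k` survives. -/
noncomputable def arcKernel {V : Type} {M : ℕ} (G : Network V (Fin M)) (k : ℕ)
    (S : Finset (Fin M)) : PMF (Finset (Fin M)) :=
  if h : M - 1 - k < M then
    (coin (1 - G.fail ⟨M - 1 - k, h⟩)).map fun b =>
      if b then insert ⟨M - 1 - k, h⟩ S else S.erase ⟨M - 1 - k, h⟩
  else PMF.pure S

open Classical in
lemma iter_arcKernel_apply {V : Type} {M : ℕ} (G : Network V (Fin M))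
    (hp : ∀ e, 0 ≤ G.fail e ∧ G.fail e ≤ 1) (k : ℕ) (hk : k ≤ M) (S T : Finset (Fin M)) :
    iter (arcKernel G) k S T = ∏ x : Fin M, if M - k ≤ (x : ℕ) then
      ENNReal.ofReal (if x ∈ T then 1 - G.fail x else G.fail x) else
      if (x ∈ T ↔ x ∈ S) then 1 else 0 := by
  induction k generalizing S with
  | zero =>
    have : ∀ x : Fin M, ¬ M ≤ x := fun x => by lia
    simp only [iter, PMF.pure_apply, Nat.sub_zero, this, if_false]
    rw [Finset.prod_ite_zero]
    simp [Finset.ext_iff]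
  | succ k ih =>
    have hi : M - 1 - k < M := by lia
    obtain ⟨i, hii⟩ : ∃ i : Fin M, i = ⟨M - 1 - k, hi⟩ := ⟨_, rfl⟩
    have hiv : (i : ℕ) = M - 1 - k := by rw [hii]
    rw [iter, arcKernel, dif_pos hi, ← hii, PMF.bind_map, PMF.bind_apply, tsum_fintype,
      Fintype.sum_bool]
    simp only [Function.comp_apply, if_true, Bool.false_eq_true, if_false]
    rw [ih (by lia), ih (by lia), coin_true (by linarith [hp i]), coin_false (by linarith [hp i])
      (by linarith [hp i]), ← Finset.mul_prod_erase _ _ (Finset.mem_univ i),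
      ← Finset.mul_prod_erase (a := i) Finset.univ _ (Finset.mem_univ i),
      ← Finset.mul_prod_erase (a := i) Finset.univ _ (Finset.mem_univ i)]
    have h1 : ∀ S' : Finset (Fin M), (∀ x, x ≠ i → (x ∈ S' ↔ x ∈ S)) →
        ∏ x ∈ Finset.univ.erase i, (if M - k ≤ (x : ℕ) then
          ENNReal.ofReal (if x ∈ T then 1 - G.fail x else G.fail x) else
          if (x ∈ T ↔ x ∈ S') then 1 else 0) =
        ∏ x ∈ Finset.univ.erase i, (if M - (k + 1) ≤ (x : ℕ) then
          ENNReal.ofReal (if x ∈ T then 1 - G.fail x else G.fail x) else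
          if (x ∈ T ↔ x ∈ S) then 1 else 0) := fun S' hS' =>
      Finset.prod_congr rfl fun x hx => by
        have hxi : x ≠ i := Finset.ne_of_mem_erase hx
        have hxv : (x : ℕ) ≠ i := fun h => hxi (Fin.ext h)
        exact if_congr (by lia) rfl (if_congr (by rw [hS' x hxi]) rfl rfl)
    rw [h1 _ fun x hx => by simp [hx], h1 _ fun x hx => by simp [hx],
      if_neg (show ¬ M - k ≤ (i : ℕ) by lia), if_neg (show ¬ M - k ≤ (i : ℕ) by lia),
      if_pos (show M - (k + 1) ≤ (i : ℕ) by lia)]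
    by_cases hT : i ∈ T <;> simp [hT]

lemma iter_arcKernel {V : Type} [Fintype V] {M : ℕ} (G : Network V (Fin M))
    (hp : ∀ e, 0 ≤ G.fail e ∧ G.fail e ≤ 1) :
    iter (arcKernel G) M ∅ = G.wtPMF hp := by
  classical
  ext T
  rw [iter_arcKernel_apply G hp M le_rfl, Network.wtPMF_apply, Network.wt_eq_prod,
    ENNReal.ofReal_prod_of_nonneg fun x _ => by split_ifs <;> linarith [hp x]]
  refine Finset.prod_congr rfl fun x _ => ?_
  simp only [Nat.sub_self, Nat.zero_le, if_true]
  congr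

/-- Toss a coin for each arc. -/
def tossAll : Prog :=
  .seq (setReg regI (.lit 0)) <|
  .loop (.natLt (reg regI) (reg regArcs)) <|
    .seq (.toss arrFresh (reg regI) (.sub (.lit 1) (.get arrFail (reg regI)))) <|
    setReg regI (.add (reg regI) (.lit 1))

section

variable {n M : ℕ} {G : Network (Fin n) (Fin M)} {S : Finset (Fin M)} {R C : Finset (Fin n)}
  {σ : State} (hp : ∀ e, 0 ≤ G.fail e ∧ G.fail e ≤ 1)
include hp

lemma spec_tossAll (hE : Encodes G σ) :
    Spec tossAll σ (G.wtPMF hp) (fun S σ' => IsSet arrFresh S σ') (4 * M + 3) := by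
  rw [← iter_arcKernel G hp]
  set J : ℕ → Finset (Fin M) → State → Prop := fun k S σ' => k ≤ M ∧ σ'.nat regI 0 = M - k ∧
    σ'.nat regArcs 0 = M ∧ (∀ a : Fin M, σ'.real arrFail a = G.fail a) ∧
    (∀ x : Fin M, (x : ℕ) < M - k → (x ∈ S ↔ σ'.nat arrFresh x = 1)) with hJ
  refine Spec.mono (T := 1 + (1 : ℕ) + (M * (1 + 1 + (1 : ℕ) + 1) + 1)) (Q := J 0) ?_ ?_ ?_
  · refine Hoare.seq_spec (Q₀ := fun σ' => σ' = σ.writeNat regI 0 0)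
      (Hoare.of_run (by rfl) (by simp [Prog.size]) (by simp)) ?_
    rintro _ rfl
    refine Spec.loop_count _ J ?_ ?_ M ∅ _ ⟨le_rfl, by simp, by simp [hE.arcs],
      by simp [hE.fail], fun x hx => by lia⟩
    · rintro k S σ' ⟨hk, hI, hM, hf, hS⟩
      refine ⟨by simp [hI, hM]; lia, ?_⟩
      have hi : M - 1 - k < M := by lia
      have hIi : σ'.nat regI 0 = M - 1 - k := by lia
      have hev : RealExp.eval σ' (.sub (.lit 1) (.get arrFail (reg regI))) =
          1 - G.fail ⟨M - 1 - k, hi⟩ := by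
        simp [hIi, ← hf]
      have h1 := Spec.toss (σ := σ') (a := arrFresh) (i := reg regI)
        (p := .sub (.lit 1) (.get arrFail (reg regI))) (by rw [hev]; linarith [hp ⟨_, hi⟩])
        (by rw [hev]; linarith [hp ⟨_, hi⟩])
      rw [hev] at h1
      rw [arcKernel, dif_pos hi]
      refine Spec.map (Q := fun b σ'' => σ'' = (σ'.writeNat arrFresh (M - 1 - k)
        (if b then 1 else 0)).writeNat regI 0 (M - k)) (h1.seq_hoare ?_) _ ?_
      · rintro b _ rfl
        refine Hoare.of_run (by rfl) (by simp [Prog.size]) ?_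
        simp only [Prog.run, NatExp.eval]
        rw [State.nat_writeNat_of_ne _ _ _ (by lia), hIi, show M - 1 - k + 1 = M - k by lia]
      · rintro b _ rfl
        refine ⟨by lia, by simp, by simpa using hM, by simpa using hf, fun x hx => ?_⟩
        rw [State.nat_writeNat_of_ne _ _ _ (by lia), State.nat_writeNat_self]
        by_cases hxi : (x : ℕ) = M - 1 - k
        · have : x = ⟨M - 1 - k, hi⟩ := Fin.ext hxi
          cases b <;> simp [this]
        · have hne : x ≠ ⟨M - 1 - k, hi⟩ := fun h => hxi (by rw [h])
          rw [Function.update_of_ne hxi, ← hS x (by lia)]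
          cases b <;> simp [hne]
    · rintro S σ' ⟨_, hI, hM, -⟩
      simp [hI, hM]
  · push_cast
    have : (1 : ℝ≥0∞) + 1 + (M * (1 + 1 + 1 + 1) + 1) = 4 * M + 3 := by ring
    exact this.le
  · rintro S σ' ⟨-, -, -, -, h⟩ x
    exact h x (by simp)

omit hp

/-- Replace the arcs that start in the mask by fresh ones. -/
def mixIn : Prog :=
  .seq (setReg regI (.lit 0)) <|
  .loop (.natLt (reg regI) (reg regArcs)) <|
    .seq (.ite (.natEq (.get arrMask (.get arrTail (reg regI))) (.lit 1))
      (.setNat arrAlive (reg regI) (.get arrFresh (reg regI))) .skip) <|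
    setReg regI (.add (reg regI) (.lit 1))

lemma hoare_mixIn {S' : Finset (Fin M)} (hE : Encodes G σ) (hS : IsSet arrAlive S σ)
    (hC : IsSet arrMask C σ) (hS' : IsSet arrFresh S' σ) :
    Hoare mixIn σ (6 * M + 3) (fun σ' => IsSet arrAlive (G.mix C S S') σ') := by
  set J : ℕ → State → Prop := fun k σ' => σ'.nat regI 0 = k ∧
    (∀ x : Fin M, (x : ℕ) < k → (x ∈ G.mix C S S' ↔ σ'.nat arrAlive x = 1)) ∧
    (∀ x : Fin M, k ≤ (x : ℕ) → (x ∈ S ↔ σ'.nat arrAlive x = 1)) with hJ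
  refine Hoare.mono (T := 1 + 1 + ((5 + 1) * M + 1)) (Q := J M) ?_ (by lia)
    fun σ' h x => h.2.1 x x.2
  refine Hoare.seq (Q := fun σ' => σ' = σ.writeNat regI 0 0)
      (Hoare.of_run (by rfl) (by simp [Prog.size]) (by simp)) ?_
  rintro _ rfl
  refine Hoare.loop_count J M ?_ ?_ ⟨by simp, fun x hx => by lia, fun x _ => by simp [hS x]⟩
  · rintro k hk σ' hF ⟨hI, h1, h2⟩
    have hM : σ'.nat regArcs 0 = M := by
      rw [hF.nat _ (by simp [Prog.natMods])]; simpa using hE.arcs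
    have ht : σ'.nat arrTail = σ.nat arrTail := by
      rw [hF.nat _ (by simp [Prog.natMods])]; simp
    have hm : σ'.nat arrMask = σ.nat arrMask := by
      rw [hF.nat _ (by simp [Prog.natMods])]; simp
    have hf : σ'.nat arrFresh = σ.nat arrFresh := by
      rw [hF.nat _ (by simp [Prog.natMods])]; simp
    refine ⟨by simp [hI, hM, hk], Hoare.of_run (by rfl) (by simp [Prog.size]) ?_⟩
    have htk := hE.tail ⟨k, hk⟩
    have hCk := hC (G.fst ⟨k, hk⟩)
    simp only [] at htk
    by_cases hc : G.fst ⟨k, hk⟩ ∈ C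
    · have hc' := hCk.1 hc
      simp only [Prog.run, Test.Holds, NatExp.eval, hI, hm, ht, htk, hc', if_true]
      refine ⟨by simp [hI], fun x hx => ?_, fun x hx => ?_⟩
      · rw [State.nat_writeNat_of_ne _ _ _ (by lia), State.nat_writeNat_self, hf]
        by_cases hxk : (x : ℕ) = k
        · have : x = ⟨k, hk⟩ := Fin.ext hxk
          rw [this, Network.mem_mix, if_pos hc]
          simpa using hS' ⟨k, hk⟩
        · rw [Function.update_of_ne hxk]
          exact h1 x (by lia)
      · rw [State.nat_writeNat_of_ne _ _ _ (by lia), State.nat_writeNat_self, hf,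
          Function.update_of_ne (by lia)]
        exact h2 x (by lia)
    · have hc' : σ.nat arrMask (G.fst ⟨k, hk⟩) ≠ 1 := fun h => hc (hCk.2 h)
      simp only [Prog.run, Test.Holds, NatExp.eval, hI, hm, ht, htk, hc', if_false]
      refine ⟨by simp, fun x hx => ?_, fun x hx => ?_⟩
      · rw [State.nat_writeNat_of_ne _ _ _ (by lia)]
        by_cases hxk : (x : ℕ) = k
        · have : x = ⟨k, hk⟩ := Fin.ext hxk
          rw [this, Network.mem_mix, if_neg hc]
          exact h2 ⟨k, hk⟩ le_rfl
        · exact h1 x (by lia)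
      · rw [State.nat_writeNat_of_ne _ _ _ (by lia)]
        exact h2 x (by lia)
  · rintro σ' hF ⟨hI, -⟩
    have hM : σ'.nat regArcs 0 = M := by
      rw [hF.nat _ (by simp [Prog.natMods])]; simpa using hE.arcs
    simp [hI, hM]

/-- One round of popping: resample the arcs that start in the mask, and find a minimal cluster. -/
def round : Prog := .seq tossAll (.seq mixIn find)

lemma round_natMods {a : ℕ} (ha : a < 14 ∨ 27 ≤ a) : a ∉ round.natMods := by
  simp [round, tossAll, mixIn, find, markRoots, collect, search, searchStep, Prog.natMods]
  omega

/-- The memory between two rounds: the mask is a minimal cluster, unless the flag is down. -/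
def Popping (G : Network (Fin n) (Fin M)) (R : Finset (Fin n)) (S : Finset (Fin M))
    (C : Finset (Fin n)) (σ : State) : Prop :=
  Encodes G σ ∧ RootsAre R σ ∧ IsSet arrAlive S σ ∧
    ((σ.nat regFlag 0 ≠ 0 ∧ G.MinCluster R S C ∧ IsSet arrMask C σ) ∨
      (σ.nat regFlag 0 = 0 ∧ G.RootConn R S))

include hp in
lemma spec_round (hE : Encodes G σ) (hR : RootsAre R σ) (hS : IsSet arrAlive S σ)
    (hC : IsSet arrMask C σ) :
    Spec round σ (G.wtPMF hp) (fun S' σ' => ∃ C', Popping G R (G.mix C S S') C' σ')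
      (130 * (n + M + 1)) := by
  refine Spec.mono (T := 1 + (4 * M + 3) +
    ((1 + (6 * M + 3) + 120 * (n + M + 1) : ℕ) : ℝ≥0∞)) ?_ ?_ (fun _ _ h => h)
  · refine (spec_tossAll hp hE).frame.seq_hoare ?_
    rintro S' σ₁ ⟨hf, hF⟩
    have hfr : ∀ a, (a < 15 ∨ a = 16) → σ₁.nat a = σ.nat a := fun a ha =>
      hF.nat a (by simp [tossAll, Prog.natMods]; omega)
    have hE₁ : Encodes G σ₁ := hE.congr (fun a ha _ => hfr a (by lia))
      (hF.real _ (by simp [tossAll, Prog.realMods]))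
    have hR₁ : RootsAre R σ₁ := hR.congr (hfr _ (by lia)) (by rw [hfr _ (by lia)])
    have hS₁ : IsSet arrAlive S σ₁ := hS.congr (hfr _ (by lia))
    have hC₁ : IsSet arrMask C σ₁ := hC.congr (hfr _ (by lia))
    refine (hoare_mixIn hE₁ hS₁ hC₁ hf).frame.seq ?_
    rintro σ₂ ⟨hm, hF₂⟩
    have hfr₂ : ∀ a, a < 14 → σ₂.nat a = σ₁.nat a := fun a ha =>
      hF₂.nat a (by simp [mixIn, Prog.natMods]; omega)
    have hE₂ : Encodes G σ₂ := hE₁.congr (fun a ha _ => hfr₂ a (by lia))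
      (hF₂.real _ (by simp [mixIn, Prog.realMods]))
    have hR₂ : RootsAre R σ₂ := hR₁.congr (hfr₂ _ (by lia)) (by rw [hfr₂ _ (by lia)])
    refine (hoare_find hE₂ hR₂ hm).frame.conseq ?_
    rintro σ₃ ⟨h3, hF₃⟩
    have hfr₃ : ∀ a, a < 15 → σ₃.nat a = σ₂.nat a := fun a ha => hF₃.nat a (by
      simp [find, markRoots, collect, search, searchStep, Prog.natMods]; omega)
    have hE₃ : Encodes G σ₃ := hE₂.congr (fun a ha _ => hfr₃ a (by lia)) (hF₃.real _ (by
      simp [find, markRoots, collect, search, searchStep, Prog.realMods]))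
    have hR₃ : RootsAre R σ₃ := hR₂.congr (hfr₃ _ (by lia)) (by rw [hfr₃ _ (by lia)])
    have hS₃ : IsSet arrAlive (G.mix C S S') σ₃ := hm.congr (hfr₃ _ (by lia))
    rcases h3 with ⟨h, h'⟩ | ⟨h, C', h', h''⟩
    · exact ⟨∅, hE₃, hR₃, hS₃, Or.inr ⟨h, h'⟩⟩
    · exact ⟨C', hE₃, hR₃, hS₃, Or.inl ⟨h, h', h''⟩⟩
  · exact_mod_cast (show 1 + (4 * M + 3) + (1 + (6 * M + 3) + 120 * (n + M + 1)) ≤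
      130 * (n + M + 1) by lia)

/-- Put all vertices into the mask. -/
def fillMask : Prog :=
  .seq (setReg regI (.lit 0)) <|
  .loop (.natLt (reg regI) (.get arrSize (.lit 0))) <|
    .seq (.setNat arrMask (reg regI) (.lit 1)) <|
    setReg regI (.add (reg regI) (.lit 1))

lemma hoare_fillMask (hn : σ.nat arrSize 0 = n) :
    Hoare fillMask σ (4 * n + 3) (fun σ' => IsSet arrMask (Finset.univ : Finset (Fin n)) σ') := by
  set J : ℕ → State → Prop := fun k σ' => σ'.nat regI 0 = k ∧
    ∀ x < k, σ'.nat arrMask x = 1 with hJ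
  refine Hoare.mono (T := 1 + 1 + ((3 + 1) * n + 1)) (Q := J n) ?_ (by lia)
    fun σ' h x => by simp [h.2 x x.2]
  refine Hoare.seq (Q := fun σ' => σ' = σ.writeNat regI 0 0)
      (Hoare.of_run (by rfl) (by simp [Prog.size]) (by simp)) ?_
  rintro _ rfl
  have hn' : ∀ σ', (Prog.seq (.setNat arrMask (reg regI) (.lit 1)) <|
      setReg regI (.add (reg regI) (.lit 1))).Frame (σ.writeNat regI 0 0) σ' →
      σ'.nat arrSize 0 = n := fun σ' hF => by
    rw [hF.nat _ (by simp [Prog.natMods])]; simpa using hn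
  refine Hoare.loop_count J n ?_ ?_ ⟨by simp, fun x hx => by lia⟩
  · rintro k hk σ' hF ⟨hI, h1⟩
    refine ⟨by simp [hI, hn' σ' hF, hk], Hoare.of_run (by rfl) (by simp [Prog.size]) ?_⟩
    simp only [Prog.run, NatExp.eval, hI]
    refine ⟨by simp [hI], fun x hx => ?_⟩
    rw [State.nat_writeNat_of_ne _ _ _ (by lia), State.nat_writeNat_self]
    by_cases hxk : x = k
    · simp [hxk]
    · rw [Function.update_of_ne hxk]; exact h1 x (by lia)
  · rintro σ' hF ⟨hI, -⟩
    simp [hI, hn' σ' hF]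

/-- Cluster-popping. -/
def sample : Prog :=
  .seq fillMask <| .seq round <| .loop (.neg (.natEq (reg regFlag) (.lit 0))) round

lemma sample_natMods {a : ℕ} (ha : a < 14 ∨ 27 ≤ a) : a ∉ sample.natMods := by
  have := round_natMods ha
  simp [sample, fillMask, Prog.natMods, this]
  omega

include hp in
lemma spec_sample (hZ : 0 < G.rootProb R) (hE : Encodes G σ) (hR : RootsAre R σ) :
    Spec sample σ (G.condPMF R hp hZ) (fun S σ' => G.RootConn R S ∧ Encodes G σ' ∧
        RootsAre R σ' ∧ IsSet arrAlive S σ')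
      (140 * (n + M + 1) * (1 + ENNReal.ofReal (G.oneProb R / G.rootProb R))) := by
  set x := ENNReal.ofReal (G.oneProb R / G.rootProb R)
  refine Spec.mono (T := 1 + ((4 * n + 3 : ℕ) : ℝ≥0∞) + (2 + 130 * (n + M + 1) +
    (130 * (n + M + 1) + 1) * x)) ?_ ?_ (fun _ _ h => h)
  · refine (hoare_fillMask hE.size).frame.seq_spec ?_
    rintro σ₁ ⟨hm, hF⟩
    have hfr : ∀ a, a < 16 → σ₁.nat a = σ.nat a := fun a ha =>
      hF.nat a (by simp [fillMask, Prog.natMods]; omega)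
    have hE₁ : Encodes G σ₁ := hE.congr (fun a ha _ => hfr a (by lia))
      (hF.real _ (by simp [fillMask, Prog.realMods]))
    have hR₁ : RootsAre R σ₁ := hR.congr (hfr _ (by lia)) (by rw [hfr _ (by lia)])
    refine (Network.spec_popping hp hZ (Popping G R) ?_ ?_ ?_).mono le_rfl ?_
    · rintro S C σ ⟨-, -, -, h⟩
      rcases h with ⟨h, h', -⟩ | ⟨h, h'⟩
      · exact Or.inl ⟨by simpa using h, h'⟩
      · exact Or.inr ⟨by simpa using h, h'⟩
    · rintro S C σ ⟨hE, hR, hS, h⟩ hb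
      rcases h with ⟨_, _, h⟩ | ⟨h, _⟩
      · exact spec_round hp hE hR hS h
      · simp [h] at hb
    · classical
      have hS₁ : IsSet arrAlive (Finset.univ.filter fun x : Fin M => σ₁.nat arrAlive x = 1) σ₁ :=
        fun x => by simp
      refine (spec_round hp hE₁ hR₁ hS₁ hm).mono le_rfl ?_
      rintro S' σ' ⟨C', h⟩
      refine ⟨C', ?_⟩
      have : G.mix Finset.univ (Finset.univ.filter fun x : Fin M => σ₁.nat arrAlive x = 1) S' =
          S' := by ext; simp [Network.mem_mix]
      rwa [this] at h
    · rintro S σ' ⟨hS, C, h1, h2, h3, -⟩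
      exact ⟨hS, h1, h2, h3⟩
  · rw [mul_add, mul_one]
    calc _ = ((1 + (4 * n + 3) + (2 + 130 * (n + M + 1)) : ℕ) : ℝ≥0∞) +
          ((130 * (n + M + 1) + 1 : ℕ) : ℝ≥0∞) * x := by push_cast; ring
      _ ≤ ((140 * (n + M + 1) : ℕ) : ℝ≥0∞) + ((140 * (n + M + 1) : ℕ) : ℝ≥0∞) * x := by
          gcongr <;> lia
      _ = _ := by push_cast; ring

end

/-! ### Preparing the network -/

/-- The arcs of the network are in memory, but not yet the lists of arcs. -/
structure HasArcs {n M : ℕ} (G : Network (Fin n) (Fin M)) (σ : State) : Prop where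
  size : σ.nat arrSize 0 = n
  arcs : σ.nat regArcs 0 = M
  tail : ∀ a : Fin M, σ.nat arrTail a = G.fst a
  head : ∀ a : Fin M, σ.nat arrHead a = G.snd a
  fail : ∀ a : Fin M, σ.real arrFail a = G.fail a

/-- Build the lists of the arcs that start, and that end, at the vertices. -/
def linkArcs : Prog :=
  .seq (setReg regI (.lit 0)) <|
  .loop (.natLt (reg regI) (reg regArcs)) <|
    .seq (.setNat arrTailNext (reg regI) (.get arrTailTop (.get arrTail (reg regI)))) <|
    .seq (.setNat arrTailTop (.get arrTail (reg regI)) (.add (reg regI) (.lit 1))) <|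
    .seq (.setNat arrHeadNext (reg regI) (.get arrHeadTop (.get arrHead (reg regI)))) <|
    .seq (.setNat arrHeadTop (.get arrHead (reg regI)) (.add (reg regI) (.lit 1))) <|
    setReg regI (.add (reg regI) (.lit 1))

lemma hoare_linkArcs {n M : ℕ} {G : Network (Fin n) (Fin M)} {σ : State} (h : HasArcs G σ)
    (ht : ∀ y, σ.nat arrTailTop y = 0) (hh : ∀ y, σ.nat arrHeadTop y = 0) :
    Hoare linkArcs σ (10 * M + 3) (Encodes G) := by
  set J : ℕ → State → Prop := fun k σ' => σ'.nat regI 0 = k ∧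
    (∀ y, σ'.nat arrTailTop y = prevArc (σ.nat arrTail) y k) ∧
    (∀ a < k, σ'.nat arrTailNext a = prevArc (σ.nat arrTail) (σ.nat arrTail a) a) ∧
    (∀ y, σ'.nat arrHeadTop y = prevArc (σ.nat arrHead) y k) ∧
    (∀ a < k, σ'.nat arrHeadNext a = prevArc (σ.nat arrHead) (σ.nat arrHead a) a) with hJ
  refine Hoare.mono (T := 1 + 1 + ((9 + 1) * M + 1))
    (Q := fun σ' => J M σ' ∧ linkArcs.Frame σ σ') (Hoare.frame ?_) (by lia) ?_
  · refine Hoare.seq (Q := fun σ' => σ' = σ.writeNat regI 0 0)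
      (Hoare.of_run (by rfl) (by simp [Prog.size]) (by simp)) ?_
    rintro _ rfl
    refine Hoare.loop_count J M ?_ ?_ ⟨by simp, fun y => by simp [ht, prevArc], fun a ha => by lia,
      fun y => by simp [hh, prevArc], fun a ha => by lia⟩
    · rintro k hk σ' hF ⟨hI, h1, h2, h3, h4⟩
      have hM : σ'.nat regArcs 0 = M := by
        rw [hF.nat _ (by simp [Prog.natMods])]; simpa using h.arcs
      have ht' : σ'.nat arrTail = σ.nat arrTail := by
        rw [hF.nat _ (by simp [Prog.natMods])]; simp
      have hh' : σ'.nat arrHead = σ.nat arrHead := by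
        rw [hF.nat _ (by simp [Prog.natMods])]; simp
      have key : ∀ (key : ℕ → ℕ) (top : ℕ → ℕ), (∀ y, top y = prevArc key y k) →
          ∀ y, Function.update top (key k) (k + 1) y = prevArc key y (k + 1) := by
        intro key top htop y
        rw [prevArc]
        by_cases hy : key k = y
        · rw [if_pos hy, hy, Function.update_self]
        · rw [if_neg hy, Function.update_of_ne (Ne.symm hy), htop]
      have key2 : ∀ (key next : ℕ → ℕ), (∀ a < k, next a = prevArc key (key a) a) →
          ∀ a < k + 1, Function.update next k (prevArc key (key k) k) a =
            prevArc key (key a) a := by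
        intro key next hnext a ha
        by_cases hak : a = k
        · rw [hak, Function.update_self]
        · rw [Function.update_of_ne hak, hnext a (by lia)]
      refine ⟨by simp [hI, hM, hk], Hoare.of_run (by rfl) (by simp [Prog.size]) ?_⟩
      refine ⟨by simp [hI], ?_, ?_, ?_, ?_⟩
      · simpa [hI, ht'] using key _ _ h1
      · simpa [hI, ht', h1] using key2 _ _ h2
      · simpa [hI, hh'] using key _ _ h3
      · simpa [hI, hh', h3] using key2 _ _ h4
    · rintro σ' hF ⟨hI, -⟩
      have hM : σ'.nat regArcs 0 = M := by
        rw [hF.nat _ (by simp [Prog.natMods])]; simpa using h.arcs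
      simp [hI, hM]
  · rintro σ' ⟨⟨-, h1, h2, h3, h4⟩, hF⟩
    have ht' : σ'.nat arrTail = σ.nat arrTail := hF.nat _ (by simp [linkArcs, Prog.natMods])
    have hh' : σ'.nat arrHead = σ.nat arrHead := hF.nat _ (by simp [linkArcs, Prog.natMods])
    refine ⟨?_, ?_, ?_, ?_, ?_, ?_, ?_, ?_, ?_⟩
    · rw [hF.nat _ (by simp [linkArcs, Prog.natMods])]; exact h.size
    · rw [hF.nat _ (by simp [linkArcs, Prog.natMods])]; exact h.arcs
    · rw [ht']; exact h.tail
    · rw [hh']; exact h.head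
    · rw [hF.real _ (by simp [linkArcs, Prog.realMods])]; exact h.fail
    · rw [ht']; exact fun y _ => h1 y
    · rw [ht']; exact h2
    · rw [hh']; exact fun y _ => h3 y
    · rw [hh']; exact h4

/-- Use the edges of the input as arcs. -/
def copyArcs : Prog :=
  .seq (setReg regArcs (.get arrSize (.lit 1))) <|
  .seq (setReg regI (.lit 0)) <|
  .loop (.natLt (reg regI) (reg regArcs)) <|
    .seq (.setNat arrTail (reg regI) (.get arrFst (reg regI))) <|
    .seq (.setNat arrHead (reg regI) (.get arrSnd (reg regI))) <|
    .seq (.setReal arrFail (reg regI) (.get arrFailIn (reg regI))) <|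
    setReg regI (.add (reg regI) (.lit 1))

/-- Use every edge of the input as two anti-parallel arcs. -/
def copyEdges : Prog :=
  .seq (setReg regArcs (.add (.get arrSize (.lit 1)) (.get arrSize (.lit 1)))) <|
  .seq (setReg regI (.lit 0)) <|
  .loop (.natLt (reg regI) (.get arrSize (.lit 1))) <|
    .seq (.setNat arrTail (reg regI) (.get arrFst (reg regI))) <|
    .seq (.setNat arrHead (reg regI) (.get arrSnd (reg regI))) <|
    .seq (.setReal arrFail (reg regI) (.get arrFailIn (reg regI))) <|
    .seq (.setNat arrTail (.add (.get arrSize (.lit 1)) (reg regI)) (.get arrSnd (reg regI))) <|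
    .seq (.setNat arrHead (.add (.get arrSize (.lit 1)) (reg regI)) (.get arrFst (reg regI))) <|
    .seq (.setReal arrFail (.add (.get arrSize (.lit 1)) (reg regI))
      (.get arrFailIn (reg regI))) <|
    setReg regI (.add (reg regI) (.lit 1))

section Input

variable {n m : ℕ} (G : Network (Fin n) (Fin m)) (r : ℕ) (ε : ℝ)

lemma hoare_copyArcs : Hoare copyArcs (input G r ε) (8 * m + 5) (HasArcs G) := by
  set σ := input G r ε with hσ
  have h1 : ∀ x (hx : x < m), σ.nat arrFst x = G.fst ⟨x, hx⟩ := fun x hx => by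
    simp [hσ, input, hx]
  have h2 : ∀ x (hx : x < m), σ.nat arrSnd x = G.snd ⟨x, hx⟩ := fun x hx => by
    simp [hσ, input, hx]
  have h3 : ∀ x (hx : x < m), σ.real arrFailIn x = G.fail ⟨x, hx⟩ := fun x hx => by
    simp [hσ, input, hx]
  set J : ℕ → State → Prop := fun k σ' => σ'.nat regI 0 = k ∧
    (∀ x (hx : x < m), x < k → σ'.nat arrTail x = G.fst ⟨x, hx⟩) ∧
    (∀ x (hx : x < m), x < k → σ'.nat arrHead x = G.snd ⟨x, hx⟩) ∧
    (∀ x (hx : x < m), x < k → σ'.real arrFail x = G.fail ⟨x, hx⟩) with hJ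
  set σ₁ := (σ.writeNat regArcs 0 m).writeNat regI 0 0 with hσ₁
  have hM : σ₁.nat regArcs 0 = m := by simp [hσ₁]
  refine Hoare.mono (T := 1 + 1 + (1 + 1 + ((7 + 1) * m + 1)))
    (Q := fun σ' => J m σ' ∧ σ'.nat arrSize 0 = n ∧ σ'.nat regArcs 0 = m) ?_ (by lia) ?_
  · refine Hoare.seq (Q := fun σ' => σ' = σ.writeNat regArcs 0 m)
      (Hoare.of_run (by rfl) (by simp [Prog.size]) (by simp [hσ, input])) ?_
    rintro _ rfl
    refine Hoare.seq (Q := fun σ' => σ' = σ₁)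
      (Hoare.of_run (by rfl) (by simp [Prog.size]) (by simp [hσ₁])) ?_
    rintro _ rfl
    refine (Hoare.loop_count J m ?_ ?_ ⟨by simp [hσ₁], by simp, by simp, by simp⟩).frame.conseq ?_
    · rintro k hk σ' hF ⟨hI, g1, g2, g3⟩
      have hM' : σ'.nat regArcs 0 = m := by rw [hF.nat _ (by simp [Prog.natMods])]; exact hM
      have e1 : σ'.nat arrFst k = G.fst ⟨k, hk⟩ := by
        rw [hF.nat _ (by simp [Prog.natMods]), ← h1]; simp [hσ₁]
      have e2 : σ'.nat arrSnd k = G.snd ⟨k, hk⟩ := by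
        rw [hF.nat _ (by simp [Prog.natMods]), ← h2]; simp [hσ₁]
      have e3 : σ'.real arrFailIn k = G.fail ⟨k, hk⟩ := by
        rw [hF.real _ (by simp [Prog.realMods]), ← h3]; simp [hσ₁]
      refine ⟨by simp [hI, hM', hk], Hoare.of_run (by rfl) (by simp [Prog.size]) ?_⟩
      refine ⟨by simp [hI], fun x hx hxk => ?_, fun x hx hxk => ?_, fun x hx hxk => ?_⟩ <;>
        by_cases hk' : x = k
      · subst hk'; simp [hI, e1]
      · simp [hI, Function.update_of_ne hk', g1 x hx (by lia)]
      · subst hk'; simp [hI, e2]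
      · simp [hI, Function.update_of_ne hk', g2 x hx (by lia)]
      · subst hk'; simp [hI, e3]
      · simp [hI, Function.update_of_ne hk', g3 x hx (by lia)]
    · rintro σ' hF ⟨hI, -⟩
      have hM' : σ'.nat regArcs 0 = m := by rw [hF.nat _ (by simp [Prog.natMods])]; exact hM
      simp [hI, hM']
    · rintro σ' ⟨h, hF⟩
      refine ⟨h, ?_, ?_⟩
      · rw [hF.nat _ (by simp [Prog.natMods])]; simp [hσ₁, hσ, input]
      · rw [hF.nat _ (by simp [Prog.natMods])]; exact hM
  · rintro σ' ⟨⟨-, g1, g2, g3⟩, g4, g5⟩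
    exact ⟨g4, g5, fun a => g1 a a.2 a.2, fun a => g2 a a.2 a.2, fun a => g3 a a.2 a.2⟩

/-- The arcs of the bi-directed network in memory: the edges in their given direction come first. -/
def arcEquiv (m : ℕ) : Fin (m + m) ≃ Fin m × Bool :=
  finSumFinEquiv.symm.trans <| (Equiv.boolProdEquivSum _).symm.trans (Equiv.prodComm _ _)

@[simp] lemma arcEquiv_castAdd (a : Fin m) : arcEquiv m (Fin.castAdd m a) = (a, false) := by
  simp [arcEquiv]

@[simp] lemma arcEquiv_natAdd (a : Fin m) : arcEquiv m (Fin.natAdd m a) = (a, true) := by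
  simp [arcEquiv, -Fin.natAdd_eq_addNat]

/-- The bi-directed network in memory. -/
def _root_.NetRel.Network.doubled : Network (Fin n) (Fin (m + m)) :=
  G.toBidirected.reindex (arcEquiv m)

lemma hoare_copyEdges : Hoare copyEdges (input G r ε) (14 * m + 5) (HasArcs G.doubled) := by
  set σ := input G r ε with hσ
  have h0 : σ.nat arrSize 1 = m := by simp [hσ, input]
  have h1 : ∀ x (hx : x < m), σ.nat arrFst x = G.fst ⟨x, hx⟩ := fun x hx => by
    simp [hσ, input, hx]
  have h2 : ∀ x (hx : x < m), σ.nat arrSnd x = G.snd ⟨x, hx⟩ := fun x hx => by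
    simp [hσ, input, hx]
  have h3 : ∀ x (hx : x < m), σ.real arrFailIn x = G.fail ⟨x, hx⟩ := fun x hx => by
    simp [hσ, input, hx]
  set J : ℕ → State → Prop := fun k σ' => σ'.nat regI 0 = k ∧
    (∀ x (hx : x < m), x < k → σ'.nat arrTail x = G.fst ⟨x, hx⟩ ∧
      σ'.nat arrTail (m + x) = G.snd ⟨x, hx⟩) ∧
    (∀ x (hx : x < m), x < k → σ'.nat arrHead x = G.snd ⟨x, hx⟩ ∧
      σ'.nat arrHead (m + x) = G.fst ⟨x, hx⟩) ∧
    (∀ x (hx : x < m), x < k → σ'.real arrFail x = G.fail ⟨x, hx⟩ ∧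
      σ'.real arrFail (m + x) = G.fail ⟨x, hx⟩) with hJ
  set σ₁ := (σ.writeNat regArcs 0 (m + m)).writeNat regI 0 0 with hσ₁
  have hm : σ₁.nat arrSize 1 = m := by simpa [hσ₁] using h0
  refine Hoare.mono (T := 1 + 1 + (1 + 1 + ((13 + 1) * m + 1)))
    (Q := fun σ' => J m σ' ∧ σ'.nat arrSize 0 = n ∧ σ'.nat regArcs 0 = m + m) ?_ (by lia) ?_
  · refine Hoare.seq (Q := fun σ' => σ' = σ.writeNat regArcs 0 (m + m))
      (Hoare.of_run (by rfl) (by simp [Prog.size]) (by simp [h0])) ?_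
    rintro _ rfl
    refine Hoare.seq (Q := fun σ' => σ' = σ₁)
      (Hoare.of_run (by rfl) (by simp [Prog.size]) (by simp [hσ₁])) ?_
    rintro _ rfl
    refine (Hoare.loop_count J m ?_ ?_ ⟨by simp [hσ₁], by simp, by simp, by simp⟩).frame.conseq ?_
    · rintro k hk σ' hF ⟨hI, g1, g2, g3⟩
      have hM' : σ'.nat arrSize 1 = m := by rw [hF.nat _ (by simp [Prog.natMods])]; exact hm
      have e1 : σ'.nat arrFst k = G.fst ⟨k, hk⟩ := by
        rw [hF.nat _ (by simp [Prog.natMods]), ← h1]; simp [hσ₁]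
      have e2 : σ'.nat arrSnd k = G.snd ⟨k, hk⟩ := by
        rw [hF.nat _ (by simp [Prog.natMods]), ← h2]; simp [hσ₁]
      have e3 : σ'.real arrFailIn k = G.fail ⟨k, hk⟩ := by
        rw [hF.real _ (by simp [Prog.realMods]), ← h3]; simp [hσ₁]
      refine ⟨by simp [hI, hM', hk], Hoare.of_run (by rfl) (by simp [Prog.size]) ?_⟩
      have u1 : ∀ x < m, x ≠ m + k := fun x hx => by lia
      have u2 : ∀ x, m + x ≠ k := fun x => by lia
      refine ⟨by simp [hI], fun x hx hxk => ?_, fun x hx hxk => ?_, fun x hx hxk => ?_⟩ <;>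
        by_cases hk' : x = k
      · subst hk'; simp [hI, hM', e1, e2, (show m ≠ 0 by lia)]
      · simp [hI, hM', hk', u1 x hx, u2, g1 x hx (by lia)]
      · subst hk'; simp [hI, hM', e1, e2, (show m ≠ 0 by lia)]
      · simp [hI, hM', hk', u1 x hx, u2, g2 x hx (by lia)]
      · subst hk'; simp [hI, hM', e3, (show m ≠ 0 by lia)]
      · simp [hI, hM', hk', u1 x hx, u2, g3 x hx (by lia)]
    · rintro σ' hF ⟨hI, -⟩
      have hM' : σ'.nat arrSize 1 = m := by rw [hF.nat _ (by simp [Prog.natMods])]; exact hm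
      simp [hI, hM']
    · rintro σ' ⟨h, hF⟩
      refine ⟨h, ?_, ?_⟩
      · rw [hF.nat _ (by simp [Prog.natMods])]; simp [hσ₁, hσ, input]
      · rw [hF.nat _ (by simp [Prog.natMods])]; simp [hσ₁]
  · rintro σ' ⟨⟨-, g1, g2, g3⟩, g4, g5⟩
    refine ⟨g4, g5, fun a => ?_, fun a => ?_, fun a => ?_⟩ <;> refine Fin.addCases ?_ ?_ a <;>
      intro x
    · simpa [Network.doubled, Network.reindex, Network.toBidirected] using (g1 x x.2 x.2).1
    · simpa [Network.doubled, Network.reindex, Network.toBidirected, -Fin.natAdd_eq_addNat]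
        using (g1 x x.2 x.2).2
    · simpa [Network.doubled, Network.reindex, Network.toBidirected] using (g2 x x.2 x.2).1
    · simpa [Network.doubled, Network.reindex, Network.toBidirected, -Fin.natAdd_eq_addNat]
        using (g2 x x.2 x.2).2
    · simpa [Network.doubled, Network.reindex, Network.toBidirected] using (g3 x x.2 x.2).1
    · simpa [Network.doubled, Network.reindex, Network.toBidirected, -Fin.natAdd_eq_addNat]
        using (g3 x x.2 x.2).2

end Input

/-! ### Ranking the vertices -/

/-- Rank the vertices: the root gets rank `1`, and repeatedly a vertex that has an arc to a ranked
vertex gets the next rank. -/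
def rankAll : Prog :=
  .seq (.setNat arrRank (.get arrSize (.lit 2)) (.lit 1)) <|
  .seq (setReg regCount (.lit 1)) <| .seq (setReg regJ (.lit 0)) <|
  .loop (.natLt (reg regJ) (reg regArcs)) <|
    .ite (.conj (.neg (.natEq (.get arrRank (.get arrHead (reg regJ))) (.lit 0)))
        (.natEq (.get arrRank (.get arrTail (reg regJ))) (.lit 0)))
      (.seq (setReg regCount (.add (reg regCount) (.lit 1))) <|
        .seq (.setNat arrRank (.get arrTail (reg regJ)) (reg regCount)) <|
        setReg regJ (.lit 0))
      (setReg regJ (.add (reg regJ) (.lit 1)))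

/-- The vertices with `rank v > 0` have the ranks `1, …, c`, and except for the root each of them
has an arc to a vertex of smaller positive rank. -/
structure IsRanking {n M : ℕ} (G : Network (Fin n) (Fin M)) (r : Fin n) (rank : Fin n → ℕ)
    (c : ℕ) : Prop where
  root : rank r = 1
  le : ∀ v, rank v ≤ c
  surj : ∀ k, 0 < k → k ≤ c → ∃ v, rank v = k
  inj : ∀ u v, 0 < rank u → rank u = rank v → u = v
  arc : ∀ v, 1 < rank v → ∃ a, G.fst a = v ∧ 0 < rank (G.snd a) ∧ rank (G.snd a) < rank v

section Ranking

variable {n M : ℕ} {G : Network (Fin n) (Fin M)} {r : Fin n} {rank : Fin n → ℕ} {c : ℕ}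

lemma IsRanking.exists_equiv (h : IsRanking G r rank c) :
    ∃ f : Fin c → Fin n, Function.Injective f ∧ ∀ k, rank (f k) = k + 1 := by
  choose f hf using fun k : Fin c => h.surj (k + 1) (by lia) (by lia)
  exact ⟨f, fun i j hij => Fin.ext (by have := hf i; rw [hij, hf j] at this; lia), hf⟩

lemma IsRanking.count_le (h : IsRanking G r rank c) : c ≤ n := by
  obtain ⟨f, hf, -⟩ := h.exists_equiv
  simpa using Fintype.card_le_of_injective f hf

lemma IsRanking.pos (h : IsRanking G r rank n) (v : Fin n) : 0 < rank v := by
  obtain ⟨f, hf, hr⟩ := h.exists_equiv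
  obtain ⟨k, rfl⟩ := (Finite.injective_iff_surjective.1 hf) v
  rw [hr]; lia

lemma IsRanking.insert (h : IsRanking G r rank c) {a : Fin M} (h1 : 0 < rank (G.snd a))
    (h2 : rank (G.fst a) = 0) :
    IsRanking G r (Function.update rank (G.fst a) (c + 1)) (c + 1) := by
  have hne : G.snd a ≠ G.fst a := fun h => by rw [h] at h1; lia
  refine ⟨?_, fun v => ?_, fun k hk hkc => ?_, fun u v hu huv => ?_, fun v hv => ?_⟩
  · rw [Function.update_of_ne]
    · exact h.root
    · intro hr; rw [← hr, h.root] at h2; lia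
  · have := h.le v
    rw [Function.update_apply]; split_ifs <;> lia
  · by_cases hkc' : k = c + 1
    · exact ⟨G.fst a, by simp [hkc']⟩
    · obtain ⟨v, hv⟩ := h.surj k hk (by lia)
      refine ⟨v, ?_⟩
      rw [Function.update_of_ne, hv]
      intro hva; rw [hva, h2] at hv; lia
  · rw [Function.update_apply] at hu huv
    rw [Function.update_apply] at huv
    have h3 := h.le u
    have h4 := h.le v
    split_ifs at hu huv with hua hva hva
    · rw [hua, hva]
    · lia
    · lia
    · exact h.inj u v hu huv
  · by_cases hva : v = G.fst a
    · refine ⟨a, hva.symm, ?_, ?_⟩ <;> rw [Function.update_of_ne hne]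
      · exact h1
      · have := h.le (G.snd a)
        rw [hva, Function.update_self]; lia
    · rw [Function.update_of_ne hva] at hv ⊢
      obtain ⟨b, hb, hb1, hb2⟩ := h.arc v hv
      refine ⟨b, hb, ?_⟩
      rw [Function.update_of_ne]
      · exact ⟨hb1, hb2⟩
      · intro hba; rw [hba, h2] at hb1; lia

lemma IsRanking.reaches (h : IsRanking G r rank c) (v : Fin n) (hv : 0 < rank v) :
    G.Reaches Finset.univ v r := by
  induction hk : rank v using Nat.strong_induction_on generalizing v with
  | _ k ih =>
    by_cases h1 : rank v = 1
    · rw [h.inj v r hv (by rw [h1, h.root])]; exact .refl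
    · obtain ⟨a, ha, hp, hlt⟩ := h.arc v (by lia)
      exact .head ⟨a, Finset.mem_univ _, ha, rfl⟩ (ih _ (by lia) _ hp rfl)

lemma IsRanking.rootConn (h : IsRanking G r rank n) : G.RootConn {r} Finset.univ := fun v =>
  ⟨r, by simp, h.reaches v (h.pos v)⟩

/-- If no more vertices can be ranked, then the ranked vertices are those with a path to the root. -/
lemma IsRanking.eq_of_rootConn (h : IsRanking G r rank c)
    (hdone : ∀ a, 0 < rank (G.snd a) → 0 < rank (G.fst a))
    (hc : G.RootConn {r} Finset.univ) : c = n := by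
  have hpos : ∀ v, 0 < rank v := fun v => by
    obtain ⟨_, hr, hv⟩ := hc v
    rw [Finset.mem_singleton.1 hr] at hv
    induction hv using Relation.ReflTransGen.head_induction_on with
    | refl => rw [h.root]; lia
    | head hbc _ ih => obtain ⟨a, -, rfl, rfl⟩ := hbc; exact hdone a ih
  refine le_antisymm h.count_le ?_
  have hinj : Function.Injective fun v => (⟨rank v - 1, by
      have := h.le v; have := hpos v; lia⟩ : Fin c) := fun u v huv => by
    have h1 := hpos u; have h2 := hpos v
    simp only [Fin.mk.injEq] at huv
    exact h.inj u v h1 (by lia)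
  simpa using Fintype.card_le_of_injective _ hinj

lemma hoare_rankAll {σ : State} (hE : Encodes G σ) (hr : σ.nat arrSize 2 = r)
    (h0 : ∀ v, σ.nat arrRank v = 0) :
    Hoare rankAll σ (8 * (n * (M + 1)) + 7) (fun σ' => Encodes G σ' ∧
      IsRanking G r (fun v => σ'.nat arrRank v) (σ'.nat regCount 0) ∧
      (σ'.nat regCount 0 = n ↔ G.RootConn {r} Finset.univ)) := by
  set J : ℕ × ℕ → State → Prop := fun x σ' => σ'.nat regCount 0 = x.1 ∧
    σ'.nat regJ 0 = x.2 ∧ x.2 ≤ M ∧ IsRanking G r (fun v => σ'.nat arrRank v) x.1 ∧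
    (∀ a : Fin M, (a : ℕ) < x.2 → 0 < σ'.nat arrRank (G.snd a) →
      0 < σ'.nat arrRank (G.fst a)) with hJ
  have hn : 0 < n := r.pos
  set σ₁ := ((σ.writeNat arrRank r 1).writeNat regCount 0 1).writeNat regJ 0 0 with hσ₁
  have hE₁ : Encodes G σ₁ := hE.congr (fun a ha _ => by
    rw [hσ₁]; repeat rw [State.nat_writeNat_of_ne _ _ _ (by lia)]) rfl
  have hrk : ∀ v : Fin n, σ₁.nat arrRank v = if v = r then 1 else 0 := fun v => by
    simp [hσ₁, Function.update_apply, h0, Fin.ext_iff]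
  refine Hoare.mono (T := 1 + 1 + (1 + 1 + (1 + 1 + ((7 + 1) * ((n - 1) * (M + 1) + (M - 0)) + 1))))
    ?_ ?_ (fun _ h => h)
  · refine Hoare.seq (Q := fun σ' => σ' = σ.writeNat arrRank r 1)
      (Hoare.of_run (by rfl) (by simp [Prog.size]) (by simp [hr])) ?_
    rintro _ rfl
    refine Hoare.seq (Q := fun σ' => σ' = (σ.writeNat arrRank r 1).writeNat regCount 0 1)
      (Hoare.of_run (by rfl) (by simp [Prog.size]) (by simp)) ?_
    rintro _ rfl
    refine Hoare.seq (Q := fun σ' => σ' = σ₁)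
      (Hoare.of_run (by rfl) (by simp [Prog.size]) (by simp [hσ₁])) ?_
    rintro _ rfl
    refine (Hoare.loop_ghost J (fun x => (n - x.1) * (M + 1) + (M - x.2)) ?_ (1, 0)
      ⟨by simp [hσ₁], by simp [hσ₁], Nat.zero_le _, ?_, fun a ha => by simp at ha⟩).frame.conseq ?_
    · rintro ⟨c, k⟩ σ' hF ⟨hc, hj, hk, hrank, hold⟩ hb
      have hE' : Encodes G σ' := hE₁.congr (fun a ha _ =>
        hF.nat a (by simp [Prog.natMods]; omega)) (hF.real _ (by simp [Prog.realMods]))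
      have hkM : k < M := by simpa [hj, hE'.arcs] using hb
      have ht := hE'.tail ⟨k, hkM⟩
      have hh := hE'.head ⟨k, hkM⟩
      simp only [] at ht hh hc hj
      refine Hoare.of_run (by rfl) (by simp [Prog.size]) ?_
      by_cases hcase : σ'.nat arrRank (G.snd ⟨k, hkM⟩) ≠ 0 ∧ σ'.nat arrRank (G.fst ⟨k, hkM⟩) = 0
      · refine ⟨(c + 1, 0), ?_, ?_⟩
        · have hins := hrank.insert (a := ⟨k, hkM⟩) (by simpa [Nat.pos_iff_ne_zero] using hcase.1)
            hcase.2
          have heq : (fun v : Fin n => Function.update (σ'.nat arrRank) (G.fst ⟨k, hkM⟩) (c + 1) v)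
              = Function.update (fun v : Fin n => σ'.nat arrRank v) (G.fst ⟨k, hkM⟩) (c + 1) := by
            funext v
            simp [Function.update_apply, Fin.ext_iff]
          rw [← heq] at hins
          refine ⟨?_, ?_, Nat.zero_le _, ?_, fun a ha => by simp at ha⟩
          · simp [hj, ht, hh, hcase.1, hcase.2, hc]
          · simp [hj, ht, hh, hcase.1, hcase.2]
          · simpa [hj, ht, hh, hcase.1, hcase.2, hc] using hins
        · have h1 := hrank.count_le
          have h2 := (hrank.insert (a := ⟨k, hkM⟩) (by
            simpa [Nat.pos_iff_ne_zero] using hcase.1) hcase.2).count_le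
          obtain ⟨d, rfl⟩ : ∃ d, n = c + 1 + d := ⟨n - (c + 1), by simp only [] at h2; lia⟩
          simp only []
          have e1 : c + 1 + d - (c + 1) = d := by lia
          have e2 : c + 1 + d - c = d + 1 := by lia
          rw [e1, e2, Nat.succ_mul]
          lia
      · refine ⟨(c, k + 1), ?_, ?_⟩
        · refine ⟨?_, ?_, by simp only []; lia, ?_, fun a ha => ?_⟩
          · simpa [hj, ht, hh, hcase] using hc
          · simp [hj, ht, hh, hcase]
          · simpa [hj, ht, hh, hcase] using hrank
          · by_cases hak : (a : ℕ) = k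
            · have : a = ⟨k, hkM⟩ := Fin.ext hak
              intro h1
              rw [this] at h1 ⊢
              simp only [Prog.run, Test.Holds, NatExp.eval, hj, ht, hh, hcase, if_false] at h1 ⊢
              rw [State.nat_writeNat_of_ne _ _ _ (by lia)] at h1 ⊢
              by_contra h2
              exact hcase ⟨by lia, by lia⟩
            · have := hold a (by simp only [] at ha ⊢; lia)
              simpa [hj, ht, hh, hcase] using this
        · simp only []
          lia
    · refine ⟨by simp [hrk], fun v => ?_, fun k h1 h2 => ⟨r, ?_⟩, fun u v hu huv => ?_,
        fun v hv => ?_⟩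
      · simp only [hrk]; split_ifs <;> lia
      · simp only [hrk, if_true] at h2 ⊢; lia
      · simp only [hrk] at hu huv
        split_ifs at hu huv with h1 h2 h2
        · rw [h1, h2]
        · lia
      · simp only [hrk] at hv
        split_ifs at hv
        · lia
        · lia
    · rintro σ' ⟨⟨⟨c, k⟩, ⟨hc, hj, hk, hrank, hold⟩, hb⟩, hF⟩
      have hE' : Encodes G σ' := hE₁.congr (fun a ha _ =>
        hF.nat a (by simp [Prog.natMods]; omega)) (hF.real _ (by simp [Prog.realMods]))
      simp only [] at hc hj hk hrank hold
      have hkM : k = M := by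
        have : ¬ k < M := by simpa [hj, hE'.arcs] using hb
        lia
      subst hkM
      rw [hc]
      refine ⟨hE', hrank, fun h => ?_, fun h => ?_⟩
      · subst h; exact hrank.rootConn
      · exact hrank.eq_of_rootConn (fun a ha => hold a a.2 ha) h
  · have : (n - 1 + 1) * (M + 1) = n * (M + 1) := by rw [Nat.sub_add_cancel hn]
    rw [Nat.succ_mul] at this
    lia

end Ranking

/-! ### Ratios of connection probabilities -/

namespace Network

section

open Classical

variable {V E : Type} [Fintype V] [Fintype E] {G : Network V E} {R R' : Finset V}

lemma RootConn.mono_roots {S : Finset E} (h : G.RootConn R S) (hR : R ⊆ R') : G.RootConn R' S :=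
  fun v => let ⟨r, hr, hv⟩ := h v; ⟨r, hR hr, hv⟩

variable (hp : ∀ e, 0 ≤ G.fail e ∧ G.fail e ≤ 1)
include hp

/-- The probability that there are paths to `R`, given that there are paths to `R' ⊇ R`. -/
lemma ev_condPMF_rootConn (hZ : 0 < G.rootProb R') (hR : R ⊆ R') :
    ev (G.condPMF R' hp hZ) (fun S => if G.RootConn R S then 1 else 0) =
      ENNReal.ofReal (G.rootProb R / G.rootProb R') := by
  have h1 : G.rootProb R / G.rootProb R' =
      ∑ S, if G.RootConn R S then G.wt S / G.rootProb R' else 0 := by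
    conv_lhs => rw [rootProb]
    rw [Finset.sum_div]
    exact Finset.sum_congr rfl fun S _ => by split_ifs <;> simp
  rw [ev_eq_sum, h1, ENNReal.ofReal_sum_of_nonneg fun S _ => by
    split_ifs; exacts [div_nonneg (wt_nonneg hp S) hZ.le, le_rfl]]
  refine Finset.sum_congr rfl fun S _ => ?_
  rw [condPMF_apply]
  split_ifs with h2 h3 h3
  · simp
  · simp
  · exact absurd (h3.mono_roots hR) h2
  · simp

/-- If the only new root is the start of an arc to an old root, then the survival of this arc
reconnects everything to the old roots. -/
lemma rootProb_le_of_arc {a : E} (ha : G.snd a ∈ R) (hR : ∀ v ∈ R', v ∈ R ∨ v = G.fst a) :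
    (1 - G.fail a) * G.rootProb R' ≤ G.rootProb R := by
  set s : Finset E := Finset.univ.erase a with hs
  have has : a ∉ s := by simp [hs]
  have hsum : ∀ F : Finset E → ℝ, ∑ S, F S = ∑ S ∈ s.powerset, (F S + F (insert a S)) := fun F => by
    rw [Finset.sum_add_distrib, ← Finset.sum_powerset_insert has, hs,
      Finset.insert_erase (Finset.mem_univ a), Finset.powerset_univ]
  set w : Finset E → ℝ := fun S => ∏ e ∈ s, if e ∈ S then 1 - G.fail e else G.fail e with hw
  have hw0 : ∀ S, 0 ≤ w S := fun S => Finset.prod_nonneg fun e _ => by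
    split_ifs <;> linarith [hp e]
  have h1 : ∀ S ∈ s.powerset, G.wt S = G.fail a * w S := fun S hS => by
    rw [wt_eq_prod, ← Finset.mul_prod_erase _ _ (Finset.mem_univ a), if_neg]
    exact fun h => has (Finset.mem_powerset.1 hS h)
  have h2 : ∀ S, G.wt (insert a S) = (1 - G.fail a) * w S := fun S => by
    rw [wt_eq_prod, ← Finset.mul_prod_erase _ _ (Finset.mem_univ a),
      if_pos (Finset.mem_insert_self a S)]
    congr 1
    refine Finset.prod_congr rfl fun e he => ?_
    simp [Finset.ne_of_mem_erase he]
  have h3 : ∀ S, G.RootConn R' S → G.RootConn R (insert a S) := by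
    intro S h v
    obtain ⟨r, hr, hv⟩ := h v
    have hv' : G.Reaches (insert a S) v r := hv.mono (Finset.subset_insert a S)
    rcases hR r hr with h | rfl
    · exact ⟨r, h, hv'⟩
    · exact ⟨_, ha, hv'.tail ⟨a, Finset.mem_insert_self a S, rfl, rfl⟩⟩
  -- compare the sets `S` and `insert a S` on both sides
  rw [rootProb, rootProb, hsum, hsum, Finset.mul_sum]
  refine Finset.sum_le_sum fun S hS => ?_
  have ha0 := (hp a).1
  have ha1 : 0 ≤ 1 - G.fail a := by linarith [hp a]
  have hwS := hw0 S
  rw [h1 S hS, h2]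
  have e2 : (1 - G.fail a) * w S * (1 - G.fail a) + (1 - G.fail a) * w S * G.fail a =
    (1 - G.fail a) * w S := by ring
  by_cases hRS : G.RootConn R (insert a S)
  · have e1 : 0 ≤ (if G.RootConn R S then G.fail a * w S else 0) := by
      split_ifs; exacts [mul_nonneg ha0 hwS, le_rfl]
    rw [if_pos hRS]
    have e3 : (if G.RootConn R' S then G.fail a * w S else 0) ≤ G.fail a * w S := by
      split_ifs; exacts [le_rfl, mul_nonneg ha0 hwS]
    have e4 : (if G.RootConn R' (insert a S) then (1 - G.fail a) * w S else 0) ≤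
        (1 - G.fail a) * w S := by
      split_ifs; exacts [le_rfl, mul_nonneg ha1 hwS]
    have := mul_le_mul_of_nonneg_left (add_le_add e3 e4) ha1
    linarith
  · have e1 : ¬ G.RootConn R' S := fun h => hRS (h3 S h)
    have e2 : ¬ G.RootConn R' (insert a S) := fun h => hRS (by simpa using h3 _ h)
    have e3 : ¬ G.RootConn R S := fun h => hRS fun v =>
      let ⟨r, hr, hv⟩ := h v; ⟨r, hr, hv.mono (Finset.subset_insert a S)⟩
    simp [hRS, e1, e2, e3]

omit hp

lemma rootProb_univ : G.rootProb Finset.univ = 1 := by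
  have : ∀ S, G.RootConn Finset.univ S := fun S v => ⟨v, Finset.mem_univ v, .refl⟩
  simp [rootProb, this, sum_wt]

lemma rootProb_eq_zero (h : ¬ G.RootConn R Finset.univ) : G.rootProb R = 0 := by
  refine Finset.sum_eq_zero fun S _ => if_neg fun hS => h fun v => ?_
  obtain ⟨r, hr, hv⟩ := hS v
  exact ⟨r, hr, hv.mono (Finset.subset_univ S)⟩

lemma rootProb_pos (hp : ∀ e, 0 ≤ G.fail e ∧ G.fail e < 1) (h : G.RootConn R Finset.univ) :
    0 < G.rootProb R := by
  have hp' : ∀ e, 0 ≤ G.fail e ∧ G.fail e ≤ 1 := fun e => ⟨(hp e).1, (hp e).2.le⟩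
  have h1 : (0 : ℝ) < if G.RootConn R Finset.univ then G.wt Finset.univ else 0 := by
    rw [if_pos h, wt_eq_prod]
    exact Finset.prod_pos fun e _ => by simp; exact (hp e).2
  refine h1.trans_le (Finset.single_le_sum (f := fun S => if G.RootConn R S then G.wt S else 0)
    (fun S _ => ?_) (Finset.mem_univ _))
  split_ifs
  exacts [wt_nonneg hp' S, le_rfl]

/-- Every vertex except for the root has an arc of its own. -/
lemma card_le_of_rootConn {r : V} (h : G.RootConn {r} Finset.univ) :
    Fintype.card V ≤ Fintype.card E + 1 := by
  have hex : ∀ v : {v // v ≠ r}, ∃ e, G.fst e = v := by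
    rintro ⟨v, hv⟩
    rcases (rootConn_singleton.1 h v).cases_head with h | ⟨y, ⟨e, -, he, -⟩, -⟩
    · exact absurd h hv
    · exact ⟨e, he⟩
  choose f hf using hex
  have hinj : Function.Injective f := fun u v huv => Subtype.ext (by rw [← hf, huv, hf])
  have := Fintype.card_le_of_injective f hinj
  rw [Fintype.card_subtype_compl, Fintype.card_subtype_eq] at this
  lia

end

end Network

section

variable {n M : ℕ} {G : Network (Fin n) (Fin M)} {R : Finset (Fin n)} {r : Fin n}

/-- The expected cost of cluster-popping in a bi-directed network. -/
lemma sample_cost_le (hbi : G.IsBidirected) (hr : G.RootConn {r} Finset.univ) (hrR : r ∈ R) {q : ℝ}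
    (hp : ∀ e, 0 ≤ G.fail e ∧ G.fail e ≤ q) (hq : q < 1) (hM : 0 < M) :
    140 * ((n : ℝ≥0∞) + M + 1) * (1 + ENNReal.ofReal (G.oneProb R / G.rootProb R)) ≤
      ENNReal.ofReal (1120 * ((1 - q)⁻¹ * M ^ 2 * n)) := by
  have hRc : G.RootConn R Finset.univ := hr.mono_roots (by simpa using hrR)
  have hZ : 0 < G.rootProb R := Network.rootProb_pos (fun e => ⟨(hp e).1, (hp e).2.trans_lt hq⟩) hRc
  have h1 := hbi.oneProb_le (R := R) hRc hp hq.le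
  have hn := Network.card_le_of_rootConn hr
  simp only [Fintype.card_fin] at h1 hn
  have hn0 : 0 < n := r.pos
  have hq0 : 0 < 1 - q := by linarith
  have hq1 : 1 - q ≤ 1 := by linarith [hp ⟨0, hM⟩]
  have hinv : 1 ≤ (1 - q)⁻¹ := (one_le_inv₀ hq0).2 hq1
  have hM1 : (1 : ℝ) ≤ M := by exact_mod_cast hM
  have hn1 : (1 : ℝ) ≤ n := by exact_mod_cast hn0
  have hnM : (n : ℝ) ≤ M + 1 := by exact_mod_cast hn
  set x := (1 - q)⁻¹ * (n * M) with hx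
  have h2 : G.oneProb R / G.rootProb R ≤ x := by
    rw [div_le_iff₀ hZ, hx, mul_assoc, ← div_eq_inv_mul, le_div_iff₀ hq0]
    linarith
  have hx1 : 1 ≤ x := by
    rw [hx]
    exact one_le_mul_of_one_le_of_one_le hinv (one_le_mul_of_one_le_of_one_le hn1 hM1)
  calc _ ≤ ENNReal.ofReal (560 * M) * ENNReal.ofReal (2 * x) := by
        gcongr
        · rw [← ENNReal.ofReal_natCast n, ← ENNReal.ofReal_natCast M, ← ENNReal.ofReal_one,
            ← ENNReal.ofReal_add (by positivity) (by positivity),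
            ← ENNReal.ofReal_add (by positivity) (by positivity),
            show (140 : ℝ≥0∞) = ENNReal.ofReal 140 by simp, ← ENNReal.ofReal_mul (by norm_num)]
          exact ENNReal.ofReal_le_ofReal (by linarith)
        · rw [two_mul, ENNReal.ofReal_add (by positivity) (by positivity)]
          gcongr
          rw [← ENNReal.ofReal_one]
          exact ENNReal.ofReal_le_ofReal hx1
    _ = _ := by
        rw [← ENNReal.ofReal_mul (by positivity), hx]
        congr 1
        ring

end

/-! ### Estimating a product of probabilities -/

section Moments

open Classical

variable {α : Type*}

/-- One more trial: the count `c` increases if the event `B` occurs under `D`. -/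
noncomputable def hitKernel (D : PMF α) (B : Set α) (c : ℕ) : PMF ℕ :=
  D.map fun a => if a ∈ B then c + 1 else c

lemma ev_indicator_compl (D : PMF α) (B : Set α) :
    ev D (fun a => if a ∈ B then 1 else 0) + ev D (fun a => if a ∈ B then 0 else 1) = 1 := by
  rw [← ev_add]
  refine Eq.trans ?_ (ev_const D 1)
  congr 1
  funext a
  split_ifs <;> simp

lemma ev_hitKernel (D : PMF α) (B : Set α) (c : ℕ) (f : ℕ → ℝ≥0∞) :
    ev (hitKernel D B c) f = ev D (fun a => if a ∈ B then 1 else 0) * f (c + 1) +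
      ev D (fun a => if a ∈ B then 0 else 1) * f c := by
  rw [hitKernel, ev_map, mul_comm, mul_comm _ (f c), ← ev_const_mul, ← ev_const_mul, ← ev_add]
  congr 1
  funext a
  by_cases h : a ∈ B <;> simp [h]

lemma ev_iter_hitKernel (D : PMF α) (B : Set α) (k c : ℕ) :
    ev (iter (fun _ => hitKernel D B) k c) (fun x => (x : ℝ≥0∞)) =
      c + k * ev D (fun a => if a ∈ B then 1 else 0) := by
  have h := ev_indicator_compl D B
  set p := ev D (fun a => if a ∈ B then 1 else 0)
  set p' := ev D (fun a => if a ∈ B then 0 else 1)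
  induction k generalizing c with
  | zero => simp [iter, ev_pure]
  | succ k ih =>
    rw [iter, ev_bind, ev_hitKernel, ih, ih]
    push_cast
    calc p * (c + 1 + k * p) + p' * (c + k * p) = (p + p') * (c + k * p) + p := by ring
      _ = _ := by rw [h]; ring

lemma ev_iter_hitKernel_sq (D : PMF α) (B : Set α) (k c : ℕ) :
    ev (iter (fun _ => hitKernel D B) k c) (fun x => (x : ℝ≥0∞) ^ 2) ≤
      (c + k * ev D (fun a => if a ∈ B then 1 else 0)) ^ 2 +
        k * ev D (fun a => if a ∈ B then 1 else 0) := by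
  have h := ev_indicator_compl D B
  set p := ev D (fun a => if a ∈ B then 1 else 0)
  set p' := ev D (fun a => if a ∈ B then 0 else 1)
  induction k generalizing c with
  | zero => simp [iter, ev_pure]
  | succ k ih =>
    rw [iter, ev_bind, ev_hitKernel]
    calc _ ≤ p * (((c + 1 : ℕ) + k * p) ^ 2 + k * p) + p' * ((c + k * p) ^ 2 + k * p) := by
          gcongr
          exacts [ih (c + 1), ih c]
      _ = (p + p') * ((c + k * p) ^ 2 + k * p) + (2 * p * (c + k * p) + p) := by
          push_cast; ring
      _ ≤ (p + p') * ((c + k * p) ^ 2 + k * p) + (2 * p * (c + k * p) + p) + p ^ 2 :=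
          le_self_add
      _ = _ := by rw [h]; push_cast; ring

/-- Multiply by a random factor. -/
noncomputable def mulKernel (D : ℕ → PMF ℕ) (k x : ℕ) : PMF ℕ := (D k).map (x * ·)

lemma ev_iter_mulKernel (D : ℕ → PMF ℕ) (u : ℕ → ℝ≥0∞) (k x : ℕ)
    (hu : ∀ j < k, ev (D j) (fun y => (y : ℝ≥0∞)) = u j) :
    ev (iter (mulKernel D) k x) (fun y => (y : ℝ≥0∞)) = x * ∏ j ∈ Finset.range k, u j := by
  induction k generalizing x with
  | zero => simp [iter, ev_pure]
  | succ k ih =>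
    rw [iter, ev_bind, mulKernel, ev_map, Finset.prod_range_succ]
    simp only [Function.comp_def, ih _ fun j hj => hu j (by lia), Nat.cast_mul]
    rw [show (fun y : ℕ => (x : ℝ≥0∞) * y * ∏ j ∈ Finset.range k, u j) =
      fun y : ℕ => (x * ∏ j ∈ Finset.range k, u j) * (y : ℝ≥0∞) from funext fun y => by ring,
      ev_const_mul, hu k (by lia)]
    ring

lemma ev_iter_mulKernel_sq (D : ℕ → PMF ℕ) (v : ℕ → ℝ≥0∞) (k x : ℕ)
    (hv : ∀ j < k, ev (D j) (fun y => (y : ℝ≥0∞) ^ 2) ≤ v j) :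
    ev (iter (mulKernel D) k x) (fun y => (y : ℝ≥0∞) ^ 2) ≤
      (x : ℝ≥0∞) ^ 2 * ∏ j ∈ Finset.range k, v j := by
  induction k generalizing x with
  | zero => simp [iter, ev_pure]
  | succ k ih =>
    rw [iter, ev_bind, mulKernel, ev_map, Finset.prod_range_succ]
    refine (ev_mono _ fun y => ih _ fun j hj => hv j (by lia)).trans ?_
    rw [show (fun y : ℕ => ((x * y : ℕ) : ℝ≥0∞) ^ 2 * ∏ j ∈ Finset.range k, v j) =
      fun y : ℕ => ((x : ℝ≥0∞) ^ 2 * ∏ j ∈ Finset.range k, v j) * (y : ℝ≥0∞) ^ 2 from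
        funext fun y => by push_cast; ring, ev_const_mul, ← mul_assoc]
    gcongr
    exact hv k (by lia)

/-- Chebyshev's inequality, for a second moment that exceeds the square of the mean `A` by at most
the fraction `ε² / 4`. -/
lemma ev_near_mean (D : PMF ℕ) {A ε : ℝ} (hA : 0 < A) (hε : 0 < ε)
    (h1 : ev D (fun x => (x : ℝ≥0∞)) = ENNReal.ofReal A)
    (h2 : ev D (fun x => (x : ℝ≥0∞) ^ 2) ≤ ENNReal.ofReal (A ^ 2 * (1 + ε ^ 2 / 4))) :
    3 / 4 ≤ ev D (fun x => if x ∈ {x : ℕ | |(x : ℝ) - A| ≤ ε * A} then 1 else 0) := by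
  have hcompl := ev_indicator_compl D {x : ℕ | |(x : ℝ) - A| ≤ ε * A}
  set good := ev D (fun x => if x ∈ {x : ℕ | |(x : ℝ) - A| ≤ ε * A} then 1 else 0)
  set bad := ev D (fun x => if x ∈ {x : ℕ | |(x : ℝ) - A| ≤ ε * A} then 0 else 1) with hbad
  -- `(ε A)² [|x - A| > ε A] ≤ (x - A)²`, without subtraction
  have hpt : ∀ x : ℕ, ENNReal.ofReal ((ε * A) ^ 2) *
      (if x ∈ {x : ℕ | |(x : ℝ) - A| ≤ ε * A} then 0 else 1) + ENNReal.ofReal (2 * A) * x ≤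
      (x : ℝ≥0∞) ^ 2 + ENNReal.ofReal (A ^ 2) := fun x => by
    have hx : (x : ℝ≥0∞) = ENNReal.ofReal x := (ENNReal.ofReal_natCast x).symm
    rw [hx, ← ENNReal.ofReal_pow (by positivity), ← ENNReal.ofReal_mul (by positivity),
      ← ENNReal.ofReal_add (by positivity) (by positivity)]
    split_ifs with h
    · rw [mul_zero, zero_add]
      exact ENNReal.ofReal_le_ofReal (by nlinarith [sq_nonneg ((x : ℝ) - A)])
    · rw [mul_one, ← ENNReal.ofReal_add (by positivity) (by positivity)]
      refine ENNReal.ofReal_le_ofReal ?_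
      have h' : ε * A < |(x : ℝ) - A| := by simpa using h
      have := pow_le_pow_left₀ (by positivity) h'.le 2
      rw [sq_abs] at this
      nlinarith
  have hev := ev_mono D hpt
  rw [ev_add, ev_add, ev_const_mul, ev_const_mul, ev_const, h1, ← hbad] at hev
  have hfin : bad ≠ ⊤ := fun h => by rw [h] at hcompl; simp at hcompl
  have hfin' : good ≠ ⊤ := fun h => by rw [h] at hcompl; simp at hcompl
  lift bad to NNReal using hfin with b
  lift good to NNReal using hfin' with g
  have hev' := hev.trans (add_le_add h2 le_rfl)
  have hb : (b : ℝ≥0∞) = ENNReal.ofReal b := by simp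
  rw [hb, ← ENNReal.ofReal_mul (by positivity), ← ENNReal.ofReal_mul (by positivity),
    ← ENNReal.ofReal_add (by positivity) (by positivity),
    ← ENNReal.ofReal_add (by positivity) (by positivity),
    ENNReal.ofReal_le_ofReal_iff (by positivity)] at hev'
  have hb4 : (b : ℝ) ≤ 1 / 4 := by
    have hpos : 0 < (ε * A) ^ 2 := by positivity
    by_contra hlt
    push Not at hlt
    nlinarith [mul_lt_mul_of_pos_left hlt hpos]
  have hsum : (g : ℝ) + b = 1 := by exact_mod_cast hcompl
  have hg : (3 / 4 : ℝ) ≤ g := by linarith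
  have h34 : (3 / 4 : ℝ≥0∞) = ENNReal.ofReal (3 / 4) := by
    rw [ENNReal.ofReal_div_of_pos (by norm_num)]; simp
  rw [h34]
  simpa using ENNReal.ofReal_le_ofReal hg

lemma one_add_pow_le {x : ℝ} (hx : 0 ≤ x) (k : ℕ) (hk : 2 * (k * x) ≤ 1) :
    (1 + x) ^ k ≤ 1 + 2 * (k * x) := by
  induction k with
  | zero => simp
  | succ k ih =>
    push_cast at hk ⊢
    have h1 := mul_le_mul_of_nonneg_right (ih (by nlinarith)) (show 0 ≤ 1 + x by linarith)
    rw [pow_succ]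
    nlinarith [mul_le_mul_of_nonneg_right (show 2 * (k * x) ≤ 1 by nlinarith) hx]

/-- A product of estimated probabilities: if `N` samples are taken for each of `k` probabilities
`ρ j`, then the product of the counts is close to its expectation. The relative variance of each
count is at most `1 / (N ρ j) ≤ δ`. -/
lemma three_quarters_le_near (k N : ℕ) (D : ℕ → PMF α) (B : ℕ → Set α) (ρ : ℕ → ℝ) {δ ε : ℝ}
    (hρ : ∀ j < k, ev (D j) (fun a => if a ∈ B j then 1 else 0) = ENNReal.ofReal (ρ j))
    (hε : 0 < ε) (hδ : 0 ≤ δ) (hN : ∀ j < k, 0 < ρ j ∧ 1 ≤ N * ρ j * δ)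
    (hk : (1 + δ) ^ k ≤ 1 + ε ^ 2 / 4) :
    3 / 4 ≤ ev (iter (mulKernel fun j => iter (fun _ => hitKernel (D j) (B j)) N 0) k 1)
      (fun x => if x ∈ {x : ℕ | |(x : ℝ) - ∏ j ∈ Finset.range k, N * ρ j| ≤
        ε * ∏ j ∈ Finset.range k, N * ρ j} then 1 else 0) := by
  have hpos : ∀ j ∈ Finset.range k, 0 < N * ρ j := fun j hj => by
    have := hN j (Finset.mem_range.1 hj)
    have h0 : (N : ℝ) ≠ 0 := fun h => by rw [h] at this; linarith
    have : (0 : ℝ) < N := lt_of_le_of_ne (by positivity) (Ne.symm h0)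
    have := (hN j (Finset.mem_range.1 hj)).1
    positivity
  have hcast : ∀ j ∈ Finset.range k, (N : ℝ≥0∞) * ENNReal.ofReal (ρ j) =
      ENNReal.ofReal (N * ρ j) := fun j _ => by
    rw [ENNReal.ofReal_mul (by positivity), ENNReal.ofReal_natCast]
  refine ev_near_mean _ (Finset.prod_pos hpos) hε ?_ ?_
  · rw [ev_iter_mulKernel _ (fun j => ENNReal.ofReal (N * ρ j)), Nat.cast_one, one_mul,
      ENNReal.ofReal_prod_of_nonneg fun j hj => (hpos j hj).le]
    intro j hj
    rw [ev_iter_hitKernel, hρ j hj, hcast j (Finset.mem_range.2 hj)]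
    simp
  · refine (ev_iter_mulKernel_sq _ (fun j => ENNReal.ofReal ((N * ρ j) ^ 2 * (1 + δ))) k 1
      fun j hj => ?_).trans ?_
    · refine (ev_iter_hitKernel_sq _ _ _ _).trans ?_
      have hj' := Finset.mem_range.2 hj
      rw [hρ j hj, hcast j hj', Nat.cast_zero, zero_add,
        ← ENNReal.ofReal_pow (hpos j hj').le, ← ENNReal.ofReal_add (by positivity) (hpos j hj').le]
      refine ENNReal.ofReal_le_ofReal ?_
      have := mul_le_mul_of_nonneg_left (hN j hj).2 (hpos j hj').le
      nlinarith
    · rw [Nat.cast_one, one_pow, one_mul, ← ENNReal.ofReal_prod_of_nonneg fun j _ => by positivity,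
        Finset.prod_mul_distrib, Finset.prod_const, Finset.card_range, Finset.prod_pow]
      exact ENNReal.ofReal_le_ofReal (mul_le_mul_of_nonneg_left hk (by positivity))

end Moments

/-! ### The number of samples -/

/-- Compute `⌈1 / x⌉` for the real number `x` in cell `0` of the array `a`, by adding up `x`. -/
def ceilInv (dst a : ℕ) : Prog :=
  .seq (setReg dst (.lit 0)) <| .seq (.setReal regAcc (.lit 0) (.lit 0)) <|
  .loop (.realLt (.get regAcc (.lit 0)) (.lit 1)) <|
    .seq (.setReal regAcc (.lit 0) (.add (.get regAcc (.lit 0)) (.get a (.lit 0)))) <|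
    setReg dst (.add (reg dst) (.lit 1))

lemma hoare_ceilInv {σ : State} {dst a : ℕ} (ha : a ≠ regAcc) (hx : 0 < σ.real a 0) :
    Hoare (ceilInv dst a) σ (4 * ⌈(σ.real a 0)⁻¹⌉₊ + 5)
      (fun σ' => σ'.nat dst 0 = ⌈(σ.real a 0)⁻¹⌉₊) := by
  set x := σ.real a 0 with hxdef
  set J : ℕ → State → Prop := fun k σ' => σ'.nat dst 0 = k ∧ σ'.real regAcc 0 = k * x ∧
    σ'.real a 0 = x with hJ
  have hlt : ∀ k : ℕ, (k * x < 1 ↔ k < ⌈x⁻¹⌉₊) := fun k => by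
    rw [Nat.lt_ceil, ← one_div, lt_div_iff₀ hx]
  refine Hoare.mono (T := 1 + 1 + (1 + 1 + ((3 + 1) * ⌈x⁻¹⌉₊ + 1))) (Q := J ⌈x⁻¹⌉₊) ?_ (by lia)
    fun σ' h => h.1
  refine Hoare.seq (Q := fun σ' => σ' = σ.writeNat dst 0 0)
      (Hoare.of_run (by rfl) (by simp [Prog.size]) (by simp)) ?_
  rintro _ rfl
  refine Hoare.seq (Q := fun σ' => σ' = (σ.writeNat dst 0 0).writeReal regAcc 0 0)
      (Hoare.of_run (by rfl) (by simp [Prog.size]) (by simp)) ?_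
  rintro _ rfl
  refine Hoare.loop_count J _ ?_ ?_ ⟨by simp, by simp, by simp [ha, hxdef]⟩
  · rintro k hk σ' - ⟨h1, h2, h3⟩
    refine ⟨by simpa [h2] using (hlt k).2 hk, Hoare.of_run (by rfl) (by simp [Prog.size]) ?_⟩
    refine ⟨by simp [h1], ?_, by simp [ha, h3]⟩
    simp [h2, h3]
    ring
  · rintro σ' - ⟨h1, h2, h3⟩
    simp only [Test.Holds, RealExp.eval, NatExp.eval, h2, Nat.cast_one, hlt]
    exact lt_irrefl _

/-- The smallest survival probability. -/
def findMin : Prog :=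
  .seq (.setReal regMin (.lit 0) (.lit 1)) <| .seq (setReg regI (.lit 0)) <|
  .loop (.natLt (reg regI) (reg regArcs)) <|
    .seq (.ite (.realLt (.sub (.lit 1) (.get arrFail (reg regI))) (.get regMin (.lit 0)))
      (.setReal regMin (.lit 0) (.sub (.lit 1) (.get arrFail (reg regI)))) .skip) <|
    setReg regI (.add (reg regI) (.lit 1))

lemma hoare_findMin {n M : ℕ} {G : Network (Fin n) (Fin M)} {σ : State} (hE : Encodes G σ) :
    Hoare findMin σ (6 * M + 5) (fun σ' => (∀ e, σ'.real regMin 0 ≤ 1 - G.fail e) ∧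
      (σ'.real regMin 0 = 1 ∨ ∃ e, σ'.real regMin 0 = 1 - G.fail e)) := by
  set J : ℕ → State → Prop := fun k σ' => σ'.nat regI 0 = k ∧
    (∀ e : Fin M, (e : ℕ) < k → σ'.real regMin 0 ≤ 1 - G.fail e) ∧
      (σ'.real regMin 0 = 1 ∨ ∃ e, σ'.real regMin 0 = 1 - G.fail e) ∧
      σ'.nat regArcs 0 = M ∧ (∀ e : Fin M, σ'.real arrFail e = G.fail e) with hJ
  refine Hoare.mono (T := 1 + 1 + (1 + 1 + ((5 + 1) * M + 1))) (Q := J M) ?_ (by lia)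
    fun σ' h => ⟨fun e => h.2.1 e e.2, h.2.2.1⟩
  refine Hoare.seq (Q := fun σ' => σ' = σ.writeReal regMin 0 1)
      (Hoare.of_run (by rfl) (by simp [Prog.size]) (by simp)) ?_
  rintro _ rfl
  refine Hoare.seq (Q := fun σ' => σ' = (σ.writeReal regMin 0 1).writeNat regI 0 0)
      (Hoare.of_run (by rfl) (by simp [Prog.size]) (by simp)) ?_
  rintro _ rfl
  refine Hoare.loop_count J _ ?_ ?_ ⟨by simp, by simp, by simp, by simp [hE.arcs],
    by simp [hE.fail]⟩
  · rintro k hk σ' - ⟨hI, h1, h2, hM, hf⟩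
    refine ⟨by simp [hI, hM, hk], Hoare.of_run (by rfl) (by simp [Prog.size]) ?_⟩
    have hfk := hf ⟨k, hk⟩
    simp only [] at hfk
    by_cases hlt : 1 - G.fail ⟨k, hk⟩ < σ'.real regMin 0
    · refine ⟨by simp [hI, hfk, hlt], fun e he => ?_, Or.inr ⟨⟨k, hk⟩, by simp [hI, hfk, hlt]⟩,
        by simp [hI, hfk, hlt, hM], by simp [hI, hfk, hlt, hf]⟩
      by_cases hek : (e : ℕ) = k
      · rw [show e = ⟨k, hk⟩ from Fin.ext hek]; simp [hI, hfk, hlt]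
      · have := h1 e (by lia)
        simp only [Prog.run, Test.Holds, RealExp.eval, NatExp.eval, hI, hfk, Nat.cast_one, hlt,
          if_true, State.real_writeNat, State.real_writeReal_self, Function.update_self]
        linarith
    · refine ⟨by simp [hI, hfk, hlt], fun e he => ?_, by simpa [hI, hfk, hlt] using h2,
        by simp [hI, hfk, hlt, hM], by simp [hI, hfk, hlt, hf]⟩
      simp only [Prog.run, Test.Holds, RealExp.eval, NatExp.eval, hI, hfk, Nat.cast_one, hlt,
          if_false, State.real_writeNat]
      by_cases hek : (e : ℕ) = k
      · rw [show e = ⟨k, hk⟩ from Fin.ext hek]; exact not_lt.1 hlt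
      · exact h1 e (by lia)
  · rintro σ' - ⟨hI, -, -, hM, -⟩
    simp [hI, hM]

/-- Multiplication of two registers by repeated addition. -/
def mulReg (dst a b : ℕ) : Prog :=
  .seq (setReg dst (.lit 0)) <| .seq (setReg regK (.lit 0)) <|
  .loop (.natLt (reg regK) (reg b)) <|
    .seq (setReg dst (.add (reg dst) (reg a))) <| setReg regK (.add (reg regK) (.lit 1))

lemma hoare_mulReg {σ : State} {dst a b : ℕ} (h1 : a ≠ dst) (h2 : b ≠ dst) (h3 : a ≠ regK)
    (h4 : b ≠ regK) (h5 : dst ≠ regK) : Hoare (mulReg dst a b) σ (4 * σ.nat b 0 + 5)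
      (fun σ' => σ'.nat dst 0 = σ.nat a 0 * σ.nat b 0) := by
  set x := σ.nat a 0 with hx
  set y := σ.nat b 0 with hy
  set J : ℕ → State → Prop := fun k σ' => σ'.nat regK 0 = k ∧ σ'.nat dst 0 = x * k ∧
    σ'.nat a 0 = x ∧ σ'.nat b 0 = y with hJ
  refine Hoare.mono (T := 1 + 1 + (1 + 1 + ((3 + 1) * y + 1))) (Q := J y) ?_ (by lia)
    fun σ' h => h.2.1
  refine Hoare.seq (Q := fun σ' => σ' = σ.writeNat dst 0 0)
      (Hoare.of_run (by rfl) (by simp [Prog.size]) (by simp)) ?_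
  rintro _ rfl
  refine Hoare.seq (Q := fun σ' => σ' = (σ.writeNat dst 0 0).writeNat regK 0 0)
      (Hoare.of_run (by rfl) (by simp [Prog.size]) (by simp)) ?_
  rintro _ rfl
  refine Hoare.loop_count J _ ?_ ?_ ⟨by simp, by simp [h5], by simp [h1, h3, hx],
    by simp [h2, h4, hy]⟩
  · rintro k hk σ' - ⟨g1, g2, g3, g4⟩
    refine ⟨by simpa [g1, g4] using hk, Hoare.of_run (by rfl) (by simp [Prog.size]) ?_⟩
    refine ⟨?_, ?_, by simp [h1, h3, g3], by simp [h2, h4, g4]⟩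
    · simp [Ne.symm h5, g1]
    · simp [h5, g2, g3, Nat.mul_succ]
  · rintro σ' - ⟨g1, -, -, g4⟩
    simp [g1, g4]

/-- The number of samples for each probability is `8 n b a²`, where `a = ⌈1 / ε⌉`, and `b` is
the rounded inverse of the smallest survival probability. As the machine neither multiplies nor
divides, `b` and the product are computed by repeated addition. -/
def setSamples : Prog :=
  .seq (ceilInv regA 0) <| .seq findMin <| .seq (ceilInv regB regMin) <|
  .seq (mulReg regX regA regA) <| .seq (mulReg regY regX regB) <|
  .seq (mulReg regZ regY arrSize) <|
  .seq (setReg regSamples (.add (reg regZ) (reg regZ))) <|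
  .seq (setReg regSamples (.add (reg regSamples) (reg regSamples))) <|
  setReg regSamples (.add (reg regSamples) (reg regSamples))

lemma setSamples_natMods {a : ℕ} (ha : a < 14) : a ∉ setSamples.natMods := by
  simp [setSamples, ceilInv, findMin, mulReg, Prog.natMods]
  omega

lemma setSamples_realMods {a : ℕ} (ha : a < 3) : a ∉ setSamples.realMods := by
  simp [setSamples, ceilInv, findMin, mulReg, Prog.realMods]
  omega

lemma hoare_setSamples {n M : ℕ} {G : Network (Fin n) (Fin M)} {σ : State} (hE : Encodes G σ)
    (hε : 0 < σ.real 0 0) {q : ℝ} (hp : ∀ e, 0 ≤ G.fail e ∧ G.fail e ≤ q) (hq0 : 0 ≤ q)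
    (hq : q < 1) :
    Hoare setSamples σ (8 * ⌈(σ.real 0 0)⁻¹⌉₊ + 4 * ⌈(1 - q)⁻¹⌉₊ + 6 * M + 4 * n +
        (4 * ⌈(1 - q)⁻¹⌉₊ + 50)) (fun σ' => ∃ b : ℕ, b ≤ ⌈(1 - q)⁻¹⌉₊ ∧
        (∀ e, 1 ≤ b * (1 - G.fail e)) ∧
        σ'.nat regSamples 0 = 8 * (⌈(σ.real 0 0)⁻¹⌉₊ * ⌈(σ.real 0 0)⁻¹⌉₊ * b * n)) := by
  set a := ⌈(σ.real 0 0)⁻¹⌉₊ with ha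
  refine Hoare.mono (T := 1 + (4 * a + 5) + (1 + (6 * M + 5) + (1 + (4 * ⌈(1 - q)⁻¹⌉₊ + 5) +
    (1 + (4 * a + 5) + (1 + (4 * ⌈(1 - q)⁻¹⌉₊ + 5) + (1 + (4 * n + 5) + 5))))))
    ?_ (by lia) (fun _ h => h)
  refine (hoare_ceilInv (dst := regA) (by lia) hε).frame.seq ?_
  rintro σ₁ ⟨h1, hF₁⟩
  have hE₁ : Encodes G σ₁ := hE.congr (fun a ha _ => hF₁.nat a (by
    simp [ceilInv, Prog.natMods]; omega)) (hF₁.real _ (by simp [ceilInv, Prog.realMods]))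
  refine (hoare_findMin hE₁).frame.seq ?_
  rintro σ₂ ⟨⟨h2, h2'⟩, hF₂⟩
  have hE₂ : Encodes G σ₂ := hE₁.congr (fun a ha _ => hF₂.nat a (by
    simp [findMin, Prog.natMods]; omega)) (hF₂.real _ (by simp [findMin, Prog.realMods]))
  have hA₂ : σ₂.nat regA 0 = a := by rw [hF₂.nat _ (by simp [findMin, Prog.natMods]), h1]
  set x := σ₂.real regMin 0 with hx
  have hqx : 1 - q ≤ x := by
    rcases h2' with h | ⟨e, h⟩
    · rw [h]; linarith
    · rw [h]; linarith [hp e]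
  have hx0 : 0 < x := by linarith
  have hb : ⌈x⁻¹⌉₊ ≤ ⌈(1 - q)⁻¹⌉₊ := Nat.ceil_mono (inv_anti₀ (by linarith) hqx)
  refine ((hoare_ceilInv (dst := regB) (a := regMin) (by lia) hx0).mono (by lia)
    fun _ h => h).frame.seq ?_
  rintro σ₃ ⟨h3, hF₃⟩
  rw [← hx] at h3
  have hA₃ : σ₃.nat regA 0 = a := by rw [hF₃.nat _ (by simp [ceilInv, Prog.natMods]), hA₂]
  have hn₃ : σ₃.nat arrSize 0 = n := by
    rw [hF₃.nat _ (by simp [ceilInv, Prog.natMods]), hE₂.size]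
  refine ((hoare_mulReg (dst := regX) (a := regA) (b := regA) (by lia) (by lia) (by lia) (by lia)
    (by lia)).mono (by lia) fun _ h => h).frame.seq ?_
  rintro σ₄ ⟨h4, hF₄⟩
  rw [hA₃] at h4
  have hB₄ : σ₄.nat regB 0 = ⌈x⁻¹⌉₊ := by rw [hF₄.nat _ (by simp [mulReg, Prog.natMods]), h3]
  have hn₄ : σ₄.nat arrSize 0 = n := by rw [hF₄.nat _ (by simp [mulReg, Prog.natMods]), hn₃]
  refine ((hoare_mulReg (dst := regY) (a := regX) (b := regB) (by lia) (by lia) (by lia) (by lia)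
    (by lia)).mono (by lia) fun _ h => h).frame.seq ?_
  rintro σ₅ ⟨h5, hF₅⟩
  rw [h4, hB₄] at h5
  have hn₅ : σ₅.nat arrSize 0 = n := by rw [hF₅.nat _ (by simp [mulReg, Prog.natMods]), hn₄]
  refine ((hoare_mulReg (dst := regZ) (a := regY) (b := arrSize) (by lia) (by lia) (by lia) (by lia)
    (by lia)).mono (by lia) fun _ h => h).seq ?_
  intro σ₆ h6
  rw [h5, hn₅] at h6
  refine Hoare.of_run (by rfl) (by simp [Prog.size]) ⟨⌈x⁻¹⌉₊, hb, fun e => ?_, ?_⟩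
  · have h7 : x⁻¹ ≤ ⌈x⁻¹⌉₊ := Nat.le_ceil _
    calc (1 : ℝ) = x⁻¹ * x := (inv_mul_cancel₀ hx0.ne').symm
      _ ≤ _ := mul_le_mul h7 (h2 e) hx0.le (by positivity)
  · simp [h6]
    ring

/-! ### Counting -/

/-- Sample with the roots up to the threshold, and count if there are paths to the roots below the
threshold. The count is kept multiplied with the numerator of the output, and the number of
samples multiplied with the denominator. -/
def trial : Prog :=
  .seq sample <| .seq (setReg regThr (.sub (reg regThr) (.lit 1))) <| .seq find <|
  .seq (.ite (.natEq (reg regFlag) (.lit 0))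
    (setReg regGood (.add (reg regGood) (.get arrOut (.lit 0)))) .skip) <|
  .seq (setReg regY (.add (reg regY) (.get arrOut (.lit 1)))) <|
  .seq (setReg regThr (.add (reg regThr) (.lit 1))) <|
  setReg regX (.add (reg regX) (.lit 1))

/-- Estimate one conditional probability, and multiply the output by it. -/
def estimateStep : Prog :=
  .seq (setReg regGood (.lit 0)) <| .seq (setReg regY (.lit 0)) <| .seq (setReg regX (.lit 0)) <|
  .seq (.loop (.natLt (reg regX) (reg regSamples)) trial) <|
  .seq (.setNat arrOut (.lit 0) (reg regGood)) <| .seq (.setNat arrOut (.lit 1) (reg regY)) <|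
  setReg regThr (.sub (reg regThr) (.lit 1))

/-- Estimate the product of the conditional probabilities. The threshold goes down from the number
of vertices, where all vertices are roots, to `1`, where only the root remains. -/
def estimate : Prog :=
  .seq (.setNat arrOut (.lit 0) (.lit 1)) <| .seq (.setNat arrOut (.lit 1) (.lit 1)) <|
  .seq (setReg regThr (.get arrSize (.lit 0))) <|
  .loop (.natLt (.lit 1) (reg regThr)) estimateStep

lemma find_natMods {a : ℕ} (ha : a < 15 ∨ 25 < a) : a ∉ find.natMods := by
  simp [find, markRoots, collect, search, searchStep, Prog.natMods]
  omega

lemma find_realMods : find.realMods = [] := by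
  simp [find, markRoots, collect, search, searchStep, Prog.realMods]

/-- The vertices of positive rank up to `k`. -/
def rootsUpTo {n : ℕ} (rank : ℕ → ℕ) (k : ℕ) : Finset (Fin n) :=
  Finset.univ.filter fun v => 0 < rank v ∧ rank v ≤ k

lemma rootsAre_rootsUpTo {n : ℕ} (σ : State) :
    RootsAre (rootsUpTo (n := n) (σ.nat arrRank) (σ.nat regThr 0)) σ := fun v => by
  simp [rootsUpTo]

lemma rootsUpTo_mono {n : ℕ} (rank : ℕ → ℕ) {j k : ℕ} (h : j ≤ k) :
    rootsUpTo (n := n) rank j ⊆ rootsUpTo rank k := fun v => by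
  simp only [rootsUpTo, Finset.mem_filter, Finset.mem_univ, true_and]
  lia

section

variable {n M : ℕ} {G : Network (Fin n) (Fin M)} {rank : ℕ → ℕ}

/-- The memory after `j` trials with the threshold `k + 2`, of which `c` were successful. -/
structure InTrials (G : Network (Fin n) (Fin M)) (rank : ℕ → ℕ) (N num den k c j : ℕ) (σ : State) :
    Prop where
  encodes : Encodes G σ
  ranks : σ.nat arrRank = rank
  thr : σ.nat regThr 0 = k + 2
  samples : σ.nat regSamples 0 = N
  out_num : σ.nat arrOut 0 = num
  out_den : σ.nat arrOut 1 = den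
  good : σ.nat regGood 0 = num * c
  total : σ.nat regY 0 = den * j
  index : σ.nat regX 0 = j

/-- The memory when `k` more conditional probabilities have to be estimated. -/
structure InEstimate (G : Network (Fin n) (Fin M)) (rank : ℕ → ℕ) (N k num : ℕ) (σ : State) :
    Prop where
  encodes : Encodes G σ
  ranks : σ.nat arrRank = rank
  thr : σ.nat regThr 0 = k + 1
  le : k + 1 ≤ n
  samples : σ.nat regSamples 0 = N
  out_num : σ.nat arrOut 0 = num
  out_den : σ.nat arrOut 1 = N ^ (n - 1 - k)

variable (hp : ∀ e, 0 ≤ G.fail e ∧ G.fail e ≤ 1)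
  (hZ : ∀ k, 0 < G.rootProb (rootsUpTo rank (k + 1))) {Ts : ℝ≥0∞}
  (hTs : ∀ k, 140 * ((n : ℝ≥0∞) + M + 1) * (1 + ENNReal.ofReal
    (G.oneProb (rootsUpTo rank (k + 1)) / G.rootProb (rootsUpTo rank (k + 1)))) ≤ Ts)

include hTs

lemma spec_trial {N num den k c j : ℕ} {σ : State} (h : InTrials G rank N num den k c j σ) :
    Spec trial σ (hitKernel (G.condPMF (rootsUpTo rank (k + 2)) hp (hZ (k + 1)))
        {S | G.RootConn (rootsUpTo rank (k + 1)) S} c)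
      (fun c' σ' => InTrials G rank N num den k c' (j + 1) σ')
      (1 + Ts + ((120 * (n + M + 1) + 15 : ℕ) : ℝ≥0∞)) := by
  classical
  have hR : RootsAre (rootsUpTo (n := n) rank (k + 2)) σ := by
    have := rootsAre_rootsUpTo (n := n) σ
    rwa [h.ranks, h.thr] at this
  refine Spec.map (Q := fun S σ' => InTrials G rank N num den k
    (if S ∈ {S | G.RootConn (rootsUpTo rank (k + 1)) S} then c + 1 else c) (j + 1) σ') ?_ _
    (fun S σ' h => h)
  refine ((spec_sample hp (hZ (k + 1)) h.encodes hR).frame.mono (hTs (k + 1))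
    fun _ _ h => h).seq_hoare ?_
  rintro S σ₁ ⟨⟨-, hE₁, -, hS₁⟩, hF₁⟩
  have f1 : ∀ a, (a < 14 ∨ 27 ≤ a) → σ₁.nat a = σ.nat a := fun a ha =>
    hF₁.nat a (sample_natMods ha)
  refine Hoare.mono (T := 1 + 1 + (1 + 120 * (n + M + 1) + 9)) ?_ (by lia) (fun _ h => h)
  refine Hoare.seq (Q := fun σ' => σ' = σ₁.writeNat regThr 0 (k + 1))
    (Hoare.of_run (by rfl) (by simp [Prog.size]) (by simp [f1, h.thr])) ?_
  rintro _ rfl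
  set σ₂ := σ₁.writeNat regThr 0 (k + 1) with hσ₂
  have f2 : ∀ a, (a < 13 ∨ 27 ≤ a) → σ₂.nat a = σ.nat a := fun a ha => by
    rw [hσ₂, State.nat_writeNat_of_ne _ _ _ (by lia), f1 a (by lia)]
  have hE₂ : Encodes G σ₂ := hE₁.congr (fun a ha _ => by
    rw [hσ₂, State.nat_writeNat_of_ne _ _ _ (by lia)]) rfl
  have hR₂ : RootsAre (rootsUpTo (n := n) rank (k + 1)) σ₂ := by
    have := rootsAre_rootsUpTo (n := n) σ₂
    rw [f2 _ (by lia), h.ranks] at this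
    simpa [hσ₂] using this
  have hS₂ : IsSet arrAlive S σ₂ := hS₁.congr (by simp [hσ₂])
  refine (hoare_find hE₂ hR₂ hS₂).frame.seq ?_
  rintro σ₃ ⟨hfound, hF₃⟩
  have f3 : ∀ a, (a < 13 ∨ 27 ≤ a) → σ₃.nat a = σ.nat a := fun a ha => by
    rw [hF₃.nat a (find_natMods (by lia)), f2 a ha]
  have hthr : σ₃.nat regThr 0 = k + 1 := by
    rw [hF₃.nat _ (find_natMods (by lia))]; simp [hσ₂]
  have hE₃ : Encodes G σ₃ := hE₂.congr (fun a ha _ => hF₃.nat a (find_natMods (by lia)))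
    (hF₃.real _ (by simp [find_realMods]))
  refine Hoare.of_run (by rfl) (by simp [Prog.size]) ?_
  have hg : σ₃.nat regGood 0 = num * c := by rw [f3 _ (by lia), h.good]
  have hn : σ₃.nat arrOut 0 = num := by rw [f3 _ (by lia), h.out_num]
  have hd : σ₃.nat arrOut 1 = den := by rw [f3 _ (by lia), h.out_den]
  have hy : σ₃.nat regY 0 = den * j := by rw [f3 _ (by lia), h.total]
  have hx : σ₃.nat regX 0 = j := by rw [f3 _ (by lia), h.index]
  have hs : σ₃.nat regSamples 0 = N := by rw [f3 _ (by lia), h.samples]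
  have hr : σ₃.nat arrRank = rank := by rw [f3 _ (by lia), h.ranks]
  by_cases hfl : σ₃.nat regFlag 0 = 0
  · have hrc : G.RootConn (rootsUpTo rank (k + 1)) S := by
      rcases hfound with h | h
      · exact h.2
      · exact absurd hfl h.1
    rw [if_pos (Set.mem_ofPred.2 hrc)]
    refine ⟨hE₃.congr (fun a ha _ => ?_) (by simp [hfl]), ?_, ?_, ?_, ?_, ?_, ?_, ?_, ?_⟩
    · simp only [Prog.run, Test.Holds, NatExp.eval, hfl, if_true]
      repeat rw [State.nat_writeNat_of_ne _ _ _ (by lia)]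
    all_goals simp [hfl, hg, hn, hd, hy, hx, hs, hr, hthr, Nat.mul_succ]
  · have hrc : ¬ G.RootConn (rootsUpTo rank (k + 1)) S := by
      rcases hfound with h | ⟨_, C, hC, _⟩
      · exact absurd h.1 hfl
      · exact fun h => Network.rootConn_iff.1 h ⟨C, hC⟩
    rw [if_neg (Set.mem_ofPred.not.2 hrc)]
    refine ⟨hE₃.congr (fun a ha _ => ?_) (by simp [hfl]), ?_, ?_, ?_, ?_, ?_, ?_, ?_, ?_⟩
    · simp only [Prog.run, Test.Holds, NatExp.eval, hfl, if_false]
      repeat rw [State.nat_writeNat_of_ne _ _ _ (by lia)]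
    all_goals simp [hfl, hg, hn, hd, hy, hx, hs, hr, hthr, Nat.mul_succ]

lemma spec_estimateStep {N k num : ℕ} {σ : State} (h : InEstimate G rank N (k + 1) num σ) :
    Spec estimateStep σ (mulKernel (fun k => iter (fun _ => hitKernel
        (G.condPMF (rootsUpTo rank (k + 2)) hp (hZ (k + 1)))
        {S | G.RootConn (rootsUpTo rank (k + 1)) S}) N 0) k num)
      (InEstimate G rank N k)
      (N * (1 + Ts + ((120 * (n + M + 1) + 15 : ℕ) : ℝ≥0∞) + 1) + 13) := by
  set T := 1 + Ts + ((120 * (n + M + 1) + 15 : ℕ) : ℝ≥0∞) with hT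
  set den := N ^ (n - 1 - (k + 1)) with hden
  refine Spec.mono (T := 1 + (1 : ℕ) + (1 + (1 : ℕ) + (1 + (1 : ℕ) + (1 + (N * (T + 1) + 1) +
    (5 : ℕ))))) ?_ ?_ (fun _ _ h => h)
  · refine Hoare.seq_spec (Q₀ := fun σ' => σ' = σ.writeNat regGood 0 0)
      (Hoare.of_run (by rfl) (by simp [Prog.size]) (by simp)) ?_
    rintro _ rfl
    refine Hoare.seq_spec (Q₀ := fun σ' => σ' = (σ.writeNat regGood 0 0).writeNat regY 0 0)
      (Hoare.of_run (by rfl) (by simp [Prog.size]) (by simp)) ?_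
    rintro _ rfl
    refine Hoare.seq_spec (Q₀ := fun σ' =>
        σ' = ((σ.writeNat regGood 0 0).writeNat regY 0 0).writeNat regX 0 0)
      (Hoare.of_run (by rfl) (by simp [Prog.size]) (by simp)) ?_
    rintro _ rfl
    refine Spec.map (Q := fun c σ' => InEstimate G rank N k (num * c) σ') ?_ _ (fun _ _ h => h)
    refine (Spec.loop_count (T := T) _ (fun i c σ' => i ≤ N ∧
      InTrials G rank N num den k c (N - i) σ') ?_ ?_ N 0 _ ⟨le_rfl, ?_⟩).seq_hoare ?_
    · rintro i c σ' ⟨hi, h'⟩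
      refine ⟨by simp [h'.index, h'.samples]; lia, ?_⟩
      refine (spec_trial hp hZ hTs h').mono le_rfl fun c' σ'' h'' => ⟨by lia, ?_⟩
      rwa [show N - (i + 1) + 1 = N - i by lia] at h''
    · rintro c σ' ⟨-, h'⟩
      simp [h'.index, h'.samples]
    · refine ⟨h.encodes.congr (fun a ha _ => ?_) rfl, ?_, ?_, ?_, ?_, ?_, ?_, ?_, ?_⟩
      · repeat rw [State.nat_writeNat_of_ne _ _ _ (by lia)]
      all_goals simp [h.ranks, h.thr, h.samples, h.out_num, h.out_den, hden]
    · rintro c σ' ⟨-, h'⟩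
      refine Hoare.of_run (by rfl) (by simp [Prog.size]) ?_
      have hle := h.le
      refine ⟨h'.encodes.congr (fun a ha _ => ?_) rfl, ?_, ?_, by lia, ?_, ?_, ?_⟩
      · simp only [Prog.run]
        repeat rw [State.nat_writeNat_of_ne _ _ _ (by lia)]
      · simp [h'.ranks]
      · simp [h'.thr]
      · simp [h'.samples]
      · simp [h'.good]
      · simp [h'.total, hden, ← pow_succ]
        congr 1
        lia
  · refine le_of_eq ?_
    push_cast
    ring

lemma spec_estimate {N : ℕ} {σ : State} (hE : Encodes G σ) (hr : σ.nat arrRank = rank)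
    (hN : σ.nat regSamples 0 = N) (hn : 0 < n) :
    Spec estimate σ (iter (mulKernel (fun k => iter (fun _ => hitKernel
        (G.condPMF (rootsUpTo rank (k + 2)) hp (hZ (k + 1)))
        {S | G.RootConn (rootsUpTo rank (k + 1)) S}) N 0)) (n - 1) 1)
      (fun num σ' => σ'.nat arrOut 0 = num ∧ σ'.nat arrOut 1 = N ^ (n - 1))
      (n * (N * (Ts + ((120 * (n + M + 1) + 17 : ℕ) : ℝ≥0∞)) + 14) + 7) := by
  refine Spec.mono (T := 1 + (1 : ℕ) + (1 + (1 : ℕ) + (1 + (1 : ℕ) + (((n - 1 : ℕ) : ℝ≥0∞) *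
    (N * (1 + Ts + ((120 * (n + M + 1) + 15 : ℕ) : ℝ≥0∞) + 1) + 13 + 1) + 1))))
    (Q := InEstimate G rank N 0) ?_ ?_ ?_
  · refine Hoare.seq_spec (Q₀ := fun σ' => σ' = σ.writeNat arrOut 0 1)
      (Hoare.of_run (by rfl) (by simp [Prog.size]) (by simp)) ?_
    rintro _ rfl
    refine Hoare.seq_spec (Q₀ := fun σ' => σ' = (σ.writeNat arrOut 0 1).writeNat arrOut 1 1)
      (Hoare.of_run (by rfl) (by simp [Prog.size]) (by simp)) ?_
    rintro _ rfl
    refine Hoare.seq_spec (Q₀ := fun σ' =>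
        σ' = ((σ.writeNat arrOut 0 1).writeNat arrOut 1 1).writeNat regThr 0 n)
      (Hoare.of_run (by rfl) (by simp [Prog.size]) (by simp [hE.size])) ?_
    rintro _ rfl
    refine Spec.loop_count _ (InEstimate G rank N) ?_ ?_ (n - 1) 1 _ ?_
    · intro k num σ' h
      exact ⟨by simp [h.thr], spec_estimateStep hp hZ hTs h⟩
    · intro num σ' h
      simp [h.thr]
    · refine ⟨hE.congr (fun a ha ha' => ?_) rfl, ?_, ?_, ?_, ?_, ?_, ?_⟩
      · repeat rw [State.nat_writeNat_of_ne _ _ _ (by lia)]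
      · simp [hr]
      · simp; lia
      · lia
      · simp [hN]
      · simp
      · simp
  · calc _ = ((n - 1 : ℕ) : ℝ≥0∞) * (N * (Ts + ((120 * (n + M + 1) + 17 : ℕ) : ℝ≥0∞)) + 14) + 7 := by
          push_cast; ring
      _ ≤ _ := by gcongr; lia
  · intro num σ' h
    exact ⟨h.out_num, by simpa using h.out_den⟩

end

/-- Approximate the probability of root-connectedness, after the arcs were written by `pre`. If not
all vertices can be ranked, then the probability is `0`, and this is the output. -/
def countFrom (pre : Prog) : Prog :=
  .seq (.seq pre (.seq linkArcs rankAll)) <|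
  .ite (.natEq (reg regCount) (.get arrSize (.lit 0))) (.seq setSamples estimate)
    (.seq (.setNat arrOut (.lit 0) (.lit 0)) (.setNat arrOut (.lit 1) (.lit 1)))

/-- The memory contains the arcs of the network, and all that was not part of the input is clear. -/
structure Ready {n M : ℕ} (G : Network (Fin n) (Fin M)) (r : Fin n) (ε : ℝ) (σ : State) :
    Prop where
  hasArcs : HasArcs G σ
  root : σ.nat arrSize 2 = r
  eps : σ.real 0 0 = ε
  tailTop : ∀ y, σ.nat arrTailTop y = 0
  headTop : ∀ y, σ.nat arrHeadTop y = 0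
  rank : ∀ v, σ.nat arrRank v = 0

section

variable {n M : ℕ} {G : Network (Fin n) (Fin M)} {r : Fin n} {ε : ℝ} {σ : State}

lemma hoare_prepare {pre : Prog} {Tp : ℕ} (h : Hoare pre σ Tp (Ready G r ε)) :
    Hoare (.seq pre (.seq linkArcs rankAll)) σ (Tp + 10 * M + 8 * (n * (M + 1)) + 12) (fun σ' =>
      Encodes G σ' ∧ σ'.real 0 0 = ε ∧ σ'.nat arrSize 2 = r ∧
      IsRanking G r (fun v => σ'.nat arrRank v) (σ'.nat regCount 0) ∧
      (σ'.nat regCount 0 = n ↔ G.RootConn {r} Finset.univ)) := by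
  refine Hoare.mono (T := 1 + Tp + (1 + (10 * M + 3) + (8 * (n * (M + 1)) + 7))) ?_ (by lia)
    (fun _ h => h)
  refine h.seq ?_
  rintro σ₁ h₁
  refine (hoare_linkArcs h₁.hasArcs h₁.tailTop h₁.headTop).frame.seq ?_
  rintro σ₂ ⟨hE, hF⟩
  refine (hoare_rankAll hE (by rw [hF.nat _ (by simp [linkArcs, Prog.natMods]), h₁.root])
    (by rw [hF.nat _ (by simp [linkArcs, Prog.natMods])]; exact h₁.rank)).frame.conseq ?_
  rintro σ₃ ⟨⟨h1, h2, h3⟩, hF'⟩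
  refine ⟨h1, ?_, ?_, h2, h3⟩
  · rw [hF'.real _ (by simp [rankAll, Prog.realMods]),
      hF.real _ (by simp [linkArcs, Prog.realMods]), h₁.eps]
  · rw [hF'.nat _ (by simp [rankAll, Prog.natMods]),
      hF.nat _ (by simp [linkArcs, Prog.natMods]), h₁.root]

section Ratio

variable {rank : ℕ → ℕ} (hrank : IsRanking G r (fun v => rank v) n)
include hrank

lemma root_mem_rootsUpTo (k : ℕ) : r ∈ rootsUpTo (n := n) rank (k + 1) := by
  have := hrank.root
  simp [rootsUpTo, this]

lemma rootsUpTo_one : rootsUpTo (n := n) rank 1 = {r} := by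
  ext v
  have hr := hrank.root
  simp only [rootsUpTo, Finset.mem_filter, Finset.mem_univ, true_and, Finset.mem_singleton]
  constructor
  · rintro ⟨h1, h2⟩
    exact hrank.inj v r h1 (by simp only [hr]; lia)
  · rintro rfl
    lia

lemma rootsUpTo_card : rootsUpTo (n := n) rank n = Finset.univ := by
  ext v
  have h1 := hrank.pos v
  have h2 := hrank.le v
  simp only [rootsUpTo, Finset.mem_filter, Finset.mem_univ, true_and, iff_true]
  exact ⟨h1, h2⟩

/-- The conditional probabilities are at least the probability that one arc survives. -/
lemma exists_le_ratio (hp : ∀ e, 0 ≤ G.fail e ∧ G.fail e ≤ 1) {k : ℕ} (hk : k < n - 1)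
    (hZ : 0 < G.rootProb (rootsUpTo rank (k + 2))) :
    ∃ a, 1 - G.fail a ≤
      G.rootProb (rootsUpTo rank (k + 1)) / G.rootProb (rootsUpTo rank (k + 2)) := by
  obtain ⟨w, hw⟩ := hrank.surj (k + 2) (by lia) (by lia)
  obtain ⟨a, ha, h1, h2⟩ := hrank.arc w (by lia)
  refine ⟨a, ?_⟩
  rw [le_div_iff₀ hZ]
  refine Network.rootProb_le_of_arc hp ?_ fun v hv => ?_
  · simp only [rootsUpTo, Finset.mem_filter, Finset.mem_univ, true_and]
    lia
  · simp only [rootsUpTo, Finset.mem_filter, Finset.mem_univ, true_and] at hv ⊢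
    by_cases h : rank v = k + 2
    · right
      rw [ha]
      exact hrank.inj v w hv.1 (by simp only [h, hw])
    · left; lia

lemma prod_ratio (N : ℕ) (hZ : ∀ k, 0 < G.rootProb (rootsUpTo rank (k + 1))) :
    ∏ j ∈ Finset.range (n - 1), (N : ℝ) *
      (G.rootProb (rootsUpTo rank (j + 1)) / G.rootProb (rootsUpTo rank (j + 2))) =
      N ^ (n - 1) * G.rootProb {r} := by
  have h : ∀ k, ∏ j ∈ Finset.range k, (N : ℝ) *
      (G.rootProb (rootsUpTo rank (j + 1)) / G.rootProb (rootsUpTo rank (j + 2))) =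
      N ^ k * (G.rootProb (rootsUpTo rank 1) / G.rootProb (rootsUpTo rank (k + 1))) := fun k => by
    induction k with
    | zero => simp [(hZ 0).ne']
    | succ k ih =>
      rw [Finset.prod_range_succ, ih, pow_succ]
      have h1 := (hZ k).ne'
      have h2 := (hZ (k + 1)).ne'
      field_simp
  have hn : 0 < n := r.pos
  rw [h, Nat.sub_add_cancel hn, rootsUpTo_one hrank, rootsUpTo_card hrank, Network.rootProb_univ,
    div_one]

end Ratio

lemma ceil_inv_le {x : ℝ} (hx : 1 ≤ x) : (⌈x⌉₊ : ℝ) ≤ 2 * x := by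
  have := (Nat.ceil_lt_add_one (show 0 ≤ x by linarith)).le
  linarith

lemma estimate_cost_le {e p m k N : ℝ} (he : 1 ≤ e) (hp : 1 ≤ p) (hm : 1 ≤ m) (hk : 1 ≤ k)
    (hN : N ≤ 64 * (e ^ 2 * p * k)) (hkm : k ≤ m + 1) :
    k * (N * (1120 * (p * m ^ 2 * k) + (120 * (k + m + 1) + 17)) + 14) + 7 ≤
      103600 * (e ^ 2 * p ^ 2 * m ^ 2 * k ^ 3) := by
  have h1 : m ≤ p * m ^ 2 * k := by
    calc m = 1 * (1 * m) * 1 := by ring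
      _ ≤ p * (m * m) * k := by gcongr
      _ = _ := by ring
  have h2 : 1120 * (p * m ^ 2 * k) + (120 * (k + m + 1) + 17) ≤ 1617 * (p * m ^ 2 * k) := by
    linarith
  have h3 : N * (1120 * (p * m ^ 2 * k) + (120 * (k + m + 1) + 17)) ≤
      64 * (e ^ 2 * p * k) * (1617 * (p * m ^ 2 * k)) := by
    gcongr
  have h4 : 1 ≤ e ^ 2 * p ^ 2 * m ^ 2 * k ^ 2 := by
    calc (1 : ℝ) = 1 ^ 2 * 1 ^ 2 * 1 ^ 2 * 1 ^ 2 := by norm_num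
      _ ≤ _ := by gcongr
  have h5 : N * (1120 * (p * m ^ 2 * k) + (120 * (k + m + 1) + 17)) + 14 ≤
      103502 * (e ^ 2 * p ^ 2 * m ^ 2 * k ^ 2) := by linarith
  have h6 := mul_le_mul_of_nonneg_left h5 (show 0 ≤ k by linarith)
  have h7 : 1 ≤ k * (e ^ 2 * p ^ 2 * m ^ 2 * k ^ 2) := one_le_mul_of_one_le_of_one_le hk h4
  have h8 : k * (e ^ 2 * p ^ 2 * m ^ 2 * k ^ 2) = e ^ 2 * p ^ 2 * m ^ 2 * k ^ 3 := by ring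
  rw [h8] at h7
  linarith

/-- Approximate counting in a bi-directed network, whose arcs are written by `pre`. -/
theorem count_spec {pre : Prog} {Tp : ℕ} (hpre : Hoare pre σ Tp (Ready G r ε))
    (hbi : G.IsBidirected) {q : ℝ} (hp : ∀ e, 0 ≤ G.fail e ∧ G.fail e ≤ q) (hq : q < 1)
    (hM : 0 < M) (hε : 0 < ε) (hε1 : ε ≤ 1) :
    3 / 4 ≤ haltProb (countFrom pre) σ (approximates (G.rootProb {r}) ε) ∧
    expectedTime (countFrom pre) σ ≤
      ENNReal.ofReal (Tp + 104000 * (ε⁻¹ ^ 2 * (1 - q)⁻¹ ^ 2 * M ^ 2 * n ^ 3)) := by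
  classical
  have hn : 0 < n := r.pos
  have hq0 : 0 ≤ q := (hp ⟨0, hM⟩).1.trans (hp ⟨0, hM⟩).2
  have hp1 : ∀ e, 0 ≤ G.fail e ∧ G.fail e ≤ 1 := fun e => ⟨(hp e).1, (hp e).2.trans hq.le⟩
  have he1 : 1 ≤ ε⁻¹ := (one_le_inv₀ hε).2 hε1
  have hs1 : 1 ≤ (1 - q)⁻¹ := (one_le_inv₀ (by linarith)).2 (by linarith)
  have hM1 : (1 : ℝ) ≤ M := by exact_mod_cast hM
  have hn1 : (1 : ℝ) ≤ n := by exact_mod_cast hn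
  -- the bound on the time, up to a constant; it exceeds all lower-order terms
  set W : ℝ := ε⁻¹ ^ 2 * (1 - q)⁻¹ ^ 2 * M ^ 2 * n ^ 3 with hW
  have hle : ∀ x y z w : ℝ, x ≤ ε⁻¹ ^ 2 → 0 ≤ x → y ≤ (1 - q)⁻¹ ^ 2 → 0 ≤ y → z ≤ M ^ 2 → 0 ≤ z →
      w ≤ n ^ 3 → 0 ≤ w → x * y * z * w ≤ W := fun x y z w h1 h1' h2 h2' h3 h3' h4 h4' => by
    rw [hW]; gcongr
  have w1 : 1 ≤ W := by
    simpa using hle 1 1 1 1 (one_le_pow₀ he1) zero_le_one (one_le_pow₀ hs1) zero_le_one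
      (one_le_pow₀ hM1) zero_le_one (one_le_pow₀ hn1) zero_le_one
  have we : ε⁻¹ ≤ W := by
    simpa using hle ε⁻¹ 1 1 1 (le_self_pow₀ he1 (by lia)) (by linarith) (one_le_pow₀ hs1)
      zero_le_one (one_le_pow₀ hM1) zero_le_one (one_le_pow₀ hn1) zero_le_one
  have ws : (1 - q)⁻¹ ≤ W := by
    simpa using hle 1 (1 - q)⁻¹ 1 1 (one_le_pow₀ he1) zero_le_one (le_self_pow₀ hs1 (by lia))
      (by linarith) (one_le_pow₀ hM1) zero_le_one (one_le_pow₀ hn1) zero_le_one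
  have wMn : M * n ≤ W := by
    simpa using hle 1 1 M n (one_le_pow₀ he1) zero_le_one (one_le_pow₀ hs1) zero_le_one
      (le_self_pow₀ hM1 (by lia)) (by linarith) (le_self_pow₀ hn1 (by lia)) (by linarith)
  have wM : M ≤ W := le_trans (by nlinarith) wMn
  have wn : n ≤ W := le_trans (by nlinarith) wMn
  obtain ⟨σ₁, t₁, hb₁, ht₁, hE₁, heps₁, -, hrank, hiff⟩ := hoare_prepare hpre
  have hH₁ : Hoare (.seq pre (.seq linkArcs rankAll)) σ (Tp + 10 * M + 8 * (n * (M + 1)) + 12)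
      (fun σ' => σ' = σ₁) := ⟨σ₁, t₁, hb₁, ht₁, rfl⟩
  have hpreal : ((1 + (Tp + 10 * M + 8 * (n * (M + 1)) + 12) : ℕ) : ℝ) ≤ Tp + 40 * W := by
    push_cast; nlinarith
  by_cases hrc : G.RootConn {r} Finset.univ
  · have hcount := hiff.2 hrc
    rw [hcount] at hrank
    set rank := σ₁.nat arrRank with hrankdef
    have hZ : ∀ k, 0 < G.rootProb (rootsUpTo rank (k + 1)) := fun k =>
      Network.rootProb_pos (fun e => ⟨(hp e).1, (hp e).2.trans_lt hq⟩)
        (hrc.mono_roots (by simpa using root_mem_rootsUpTo hrank k))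
    have hTs := fun k => sample_cost_le hbi hrc (root_mem_rootsUpTo hrank k) hp hq hM
    obtain ⟨σ₂, t₂, hb₂, ht₂, ⟨b, hb, hbe, hN⟩, hF⟩ :=
      (hoare_setSamples hE₁ (by rw [heps₁]; exact hε) hp hq0 hq).frame
    rw [heps₁] at hN ht₂
    set a := ⌈ε⁻¹⌉₊ with ha
    have hE₂ : Encodes G σ₂ := hE₁.congr (fun a ha _ => hF.nat a (setSamples_natMods (by lia)))
      (hF.real _ (setSamples_realMods (by lia)))
    have hr₂ : σ₂.nat arrRank = rank := hF.nat _ (setSamples_natMods (by lia))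
    set N := 8 * (a * a * b * n) with hNdef
    have hspec := spec_estimate hp1 hZ hTs hE₂ hr₂ hN hn
    have hH₂ : Hoare setSamples σ₁ t₂ (fun σ' => σ' = σ₂) := ⟨σ₂, t₂, hb₂, le_rfl, rfl⟩
    have hmain : Spec (.seq setSamples estimate) σ₁ _ _ _ :=
      hH₂.seq_spec (fun σ' h => by subst h; exact hspec)
    have hall : Spec (countFrom pre) σ _ _ _ := hH₁.seq_spec (fun σ' h => by
      subst h
      exact Spec.ite (fun _ => hmain) (fun h => absurd (by simp [hcount, hE₁.size]) h))
    have ha1 : (1 : ℝ) ≤ a := he1.trans (Nat.le_ceil _)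
    have hae : ε⁻¹ ≤ a := Nat.le_ceil _
    have hb0 : 0 < b := by
      have := hbe ⟨0, hM⟩
      by_contra h
      have : b = 0 := by lia
      subst this
      simp at this
      linarith
    have hN0 : 0 < N := by
      have : 0 < a := by exact_mod_cast lt_of_lt_of_le one_pos ha1
      positivity
    constructor
    -- `δ` bounds the relative variance of each of the `n - 1` counts: `N * δ = b`
    · set δ : ℝ := 1 / (8 * (a * a * n)) with hδ
      have hδ0 : 0 < δ := by positivity
      have hmom := three_quarters_le_near (n - 1) N
        (fun k => G.condPMF (rootsUpTo rank (k + 2)) hp1 (hZ (k + 1)))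
        (fun k => {S | G.RootConn (rootsUpTo rank (k + 1)) S})
        (fun k => G.rootProb (rootsUpTo rank (k + 1)) / G.rootProb (rootsUpTo rank (k + 2)))
        (δ := δ) (ε := ε) (fun j _ => ?_) hε hδ0.le (fun j hj => ?_) ?_
      · rw [prod_ratio hrank N hZ] at hmom
        refine hmom.trans ?_
        refine hall.le_haltProb _ _ fun x hx σ' ⟨h1, h2⟩ => ?_
        have hNp : (0 : ℝ) < (N : ℝ) ^ (n - 1) := by positivity
        rw [approximates, Set.mem_ofPred, h1, h2]
        refine ⟨by positivity, ?_⟩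
        rw [Set.mem_ofPred] at hx
        push_cast
        rw [show (x : ℝ) / (N : ℝ) ^ (n - 1) - G.rootProb {r} =
          (x - (N : ℝ) ^ (n - 1) * G.rootProb {r}) / (N : ℝ) ^ (n - 1) by field_simp, abs_div,
          abs_of_pos hNp, div_le_iff₀ hNp]
        linarith
      · refine Eq.trans ?_ (Network.ev_condPMF_rootConn hp1 (hZ (j + 1))
          (rootsUpTo_mono rank (by lia : j + 1 ≤ j + 1 + 1)))
        rfl
      · refine ⟨div_pos (hZ j) (hZ (j + 1)), ?_⟩
        obtain ⟨e, he⟩ := exists_le_ratio hrank hp1 hj (hZ (j + 1))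
        have h1 : (N : ℝ) * δ = b := by
          rw [hNdef, hδ]; push_cast
          have : (a : ℝ) ≠ 0 := by positivity
          have : (n : ℝ) ≠ 0 := by positivity
          field_simp
        rw [mul_right_comm, h1]
        exact (hbe e).trans (mul_le_mul_of_nonneg_left he (by positivity))
      · have h1 : ((n - 1 : ℕ) : ℝ) ≤ n := by exact_mod_cast Nat.sub_le n 1
        have h2 : 2 * (((n - 1 : ℕ) : ℝ) * δ) ≤ 1 / (4 * (a * a)) := by
          calc _ ≤ 2 * ((n : ℝ) * δ) := by gcongr
            _ = _ := by
              rw [hδ]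
              have : (a : ℝ) ≠ 0 := by positivity
              have : (n : ℝ) ≠ 0 := by positivity
              field_simp
              norm_num
        have h3 : 1 / (4 * ((a : ℝ) * a)) ≤ ε ^ 2 / 4 := by
          rw [div_le_div_iff₀ (by positivity) (by norm_num)]
          have h4 : 1 ≤ ε * a := by
            have := mul_le_mul_of_nonneg_left hae hε.le
            rwa [mul_inv_cancel₀ hε.ne'] at this
          nlinarith [mul_le_mul h4 h4 zero_le_one (by positivity)]
        have h5 : 1 / (4 * ((a : ℝ) * a)) ≤ 1 := by
          rw [div_le_one (by positivity)]; nlinarith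
        exact (one_add_pow_le hδ0.le _ (h2.trans h5)).trans (by linarith)
    · refine hall.expectedTime_le.trans ?_
      have haB : (a : ℝ) ≤ 2 * ε⁻¹ := ceil_inv_le he1
      have hBB : (⌈(1 - q)⁻¹⌉₊ : ℝ) ≤ 2 * (1 - q)⁻¹ := ceil_inv_le hs1
      have hbB : (b : ℝ) ≤ 2 * (1 - q)⁻¹ := le_trans (by exact_mod_cast hb) hBB
      have hNB : (N : ℝ) ≤ 64 * (ε⁻¹ ^ 2 * (1 - q)⁻¹ * n) := by
        rw [hNdef]; push_cast
        calc 8 * ((a : ℝ) * a * b * n) ≤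
            8 * (2 * ε⁻¹ * (2 * ε⁻¹) * (2 * (1 - q)⁻¹) * n) := by gcongr
          _ = _ := by ring
      have hnM : (n : ℝ) ≤ M + 1 := by
        have := Network.card_le_of_rootConn hrc
        simp only [Fintype.card_fin] at this
        exact_mod_cast this
      have hest := estimate_cost_le he1 hs1 hM1 hn1 hNB hnM
      have ht₂' : (t₂ : ℝ) ≤ 100 * W := by
        calc (t₂ : ℝ) ≤ ((8 * a + 4 * ⌈(1 - q)⁻¹⌉₊ + 6 * M + 4 * n +
              (4 * ⌈(1 - q)⁻¹⌉₊ + 50) : ℕ) : ℝ) := by exact_mod_cast ht₂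
          _ ≤ 100 * W := by push_cast; linarith
      have hx0 : 0 ≤ 1120 * ((1 - q)⁻¹ * (M : ℝ) ^ 2 * n) := by positivity
      have hy0 : 0 ≤ (Tp : ℝ) + 104000 * W := by positivity
      obtain ⟨x, ex⟩ : ∃ x : NNReal, (x : ℝ) = 1120 * ((1 - q)⁻¹ * (M : ℝ) ^ 2 * n) :=
        ⟨⟨_, hx0⟩, rfl⟩
      obtain ⟨y, ey⟩ : ∃ y : NNReal, (y : ℝ) = Tp + 104000 * W := ⟨⟨_, hy0⟩, rfl⟩
      rw [← ex, ← ey, ENNReal.ofReal_coe_nnreal, ENNReal.ofReal_coe_nnreal]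
      have key : (1 + (Tp + 10 * M + 8 * (n * (M + 1)) + 12) : ℕ) + (1 + (1 + (t₂ : NNReal) +
          (n * (N * (x + ((120 * (n + M + 1) + 17 : ℕ) : NNReal)) + 14) + 7))) ≤ y := by
        rw [← NNReal.coe_le_coe]
        push_cast at hpreal ⊢
        rw [ex, ey]
        linarith
      refine le_trans (le_of_eq ?_) (ENNReal.coe_le_coe.2 key)
      push_cast
      ring
  · have hZ0 : G.rootProb {r} = 0 := Network.rootProb_eq_zero hrc
    have hcount : σ₁.nat regCount 0 ≠ n := fun h => hrc (hiff.1 h)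
    have hfail : Hoare (countFrom pre) σ (1 + (Tp + 10 * M + 8 * (n * (M + 1)) + 12) + (1 + 3))
        (fun σ' => σ'.nat arrOut 0 = 0 ∧ σ'.nat arrOut 1 = 1) := by
      refine hH₁.seq ?_
      rintro _ rfl
      refine Hoare.ite (fun h => absurd (by simpa [hE₁.size] using h) hcount) fun _ =>
        Hoare.of_run (by rfl) (by simp [Prog.size]) (by simp)
    have hall := hfail.spec ()
    constructor
    · refine le_trans ?_ (hall.le_haltProb _ Set.univ fun x _ σ' ⟨_, h1, h2⟩ => ?_)
      · simp only [Set.mem_univ, if_true, ev_const]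
        rw [ENNReal.div_le_iff (by norm_num) (by norm_num), one_mul]
        norm_num
      · rw [approximates, Set.mem_ofPred, h1, h2, hZ0]
        simp
    · refine hall.expectedTime_le.trans ?_
      rw [← ENNReal.ofReal_natCast]
      refine ENNReal.ofReal_le_ofReal ?_
      push_cast at hpreal ⊢
      linarith

end

/-! ### Distances to the root -/

open Classical in
/-- If memories realizing `a` are in `A` exactly for `a ∈ B`, then the probability of ending in `A`
is that of `B`. -/
lemma Spec.haltProb_eq {α : Type*} {P : Prog} {σ : State} {D : PMF α} {Q : α → State → Prop}
    {T : ℝ≥0∞} (h : Spec P σ D Q T) (A : Set State) (B : Set α)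
    (hAB : ∀ a σ', Q a σ' → (a ∈ B ↔ σ' ∈ A)) :
    haltProb P σ A = ev D (fun a => if a ∈ B then 1 else 0) := by
  have h1 : ev D (fun a => if a ∈ B then 1 else 0) ≤ haltProb P σ A :=
    h.le_haltProb A B fun a ha σ' hq => (hAB a σ' hq).1 ha
  have h2 : ev D (fun a => if a ∈ B then 0 else 1) ≤ haltProb P σ Aᶜ := by
    refine le_trans (ev_mono _ fun a => ?_) (h.le_haltProb Aᶜ Bᶜ fun a ha σ' hq hA =>
      ha ((hAB a σ' hq).2 hA))
    by_cases ha : a ∈ B <;> simp [ha]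
  have h3 : haltProb P σ A + haltProb P σ Aᶜ ≤ 1 := by
    rw [haltProb_eq_valC, haltProb_eq_valC, valC, valC,
      ENNReal.iSup_add_iSup_of_monotone (fun i j hij => val_mono 0 _ hij _)
        (fun i j hij => val_mono 0 _ hij _)]
    refine iSup_le fun k => ?_
    generalize ([P], σ) = c
    induction k generalizing c with
    | zero =>
      obtain ⟨_ | ⟨P, K⟩, σ⟩ := c
      · by_cases hσ : σ ∈ A <;> simp [hσ]
      · simp [val]
    | succ k ih =>
      obtain ⟨_ | ⟨P, K⟩, σ⟩ := c
      · by_cases hσ : σ ∈ A <;> simp [hσ]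
      · simp only [val, zero_add]
        rw [← ev_add]
        exact (ev_mono _ ih).trans_eq (ev_const _ 1)
  have h4 := ev_indicator_compl D B
  refine le_antisymm ?_ h1
  have hfin : ev D (fun a => if a ∈ B then 0 else 1) ≠ ⊤ := fun h => by
    have := h ▸ h2.trans (haltProb_le_one P σ Aᶜ)
    simp at this
  refine (ENNReal.add_le_add_iff_right hfin).1 ?_
  calc _ ≤ haltProb P σ A + haltProb P σ Aᶜ := by gcongr
    _ ≤ 1 := h3
    _ = _ := h4.symm

/-- The vertices at distance `k` from the root, where `k` is the content of a register, get the
entry `k + 1`. -/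
def distancePhase : Prog :=
  .seq (setReg regI (.lit 0)) <|
  .loop (.natLt (reg regI) (reg regArcs)) <|
    .seq (.ite (.conj (.natEq (.get arrAlive (reg regI)) (.lit 1))
        (.conj (.natEq (.get arrDist (.get arrHead (reg regI))) (reg regK))
          (.natEq (.get arrDist (.get arrTail (reg regI))) (.lit 0))))
      (.setNat arrDist (.get arrTail (reg regI)) (.add (reg regK) (.lit 1))) .skip) <|
    setReg regI (.add (reg regI) (.lit 1))

/-- Compute the distances to the root `0` along the surviving arcs, shifted by one. -/
def distances : Prog :=
  .seq (.setNat arrDist (.lit 0) (.lit 1)) <| .seq (setReg regK (.lit 1)) <|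
  .loop (.natLt (reg regK) (.get arrSize (.lit 0))) <|
    .seq distancePhase <| setReg regK (.add (reg regK) (.lit 1))

section

variable {n M : ℕ} {G : Network (Fin n) (Fin M)} {S : Finset (Fin M)} {r : Fin n} {σ : State}
  {d : Fin n → ℕ}

lemma IsDist.lt_card {A : Fin n → Fin n → Prop} (h : IsDist A r d) (v : Fin n) : d v < n := by
  have hex : ∀ j (v : Fin n), d v = j → ∀ k ≤ j, ∃ u, d u = k := fun j => by
    induction j with
    | zero => exact fun v hv k hk => ⟨v, by lia⟩
    | succ j ih =>
      intro v hv k hk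
      by_cases hkj : k = j + 1
      · exact ⟨v, by lia⟩
      · obtain ⟨y, -, hy⟩ := h.pred v fun hvr => by
          have := (h.zero v).2 hvr
          lia
        exact ih y (by lia) k (by lia)
  choose f hf using fun k : Fin (d v + 1) => hex (d v) v rfl k (by lia)
  have hinj : Function.Injective f := fun i j hij => Fin.ext (by rw [← hf, hij, hf])
  simpa using Fintype.card_le_of_injective f hinj

lemma hoare_distancePhase (hE : Encodes G σ) (hS : IsSet arrAlive S σ)
    (hd : IsDist (G.Arc S) r d) {k : ℕ} (hk : σ.nat regK 0 = k + 1)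
    (hD : ∀ v : Fin n, σ.nat arrDist v = if d v ≤ k then d v + 1 else 0) :
    Hoare distancePhase σ (6 * M + 3)
      (fun σ' => ∀ v : Fin n, σ'.nat arrDist v = if d v ≤ k + 1 then d v + 1 else 0) := by
  set J : ℕ → State → Prop := fun i σ' => σ'.nat regI 0 = i ∧
    ∀ v : Fin n, σ'.nat arrDist v = if d v ≤ k ∨ (d v = k + 1 ∧
      ∃ a : Fin M, (a : ℕ) < i ∧ a ∈ S ∧ G.fst a = v ∧ d (G.snd a) = k) then d v + 1 else 0
    with hJ
  refine Hoare.mono (T := 1 + 1 + ((5 + 1) * M + 1)) (Q := J M) ?_ (by lia) ?_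
  · refine Hoare.seq (Q := fun σ' => σ' = σ.writeNat regI 0 0)
      (Hoare.of_run (by rfl) (by simp [Prog.size]) (by simp)) ?_
    rintro _ rfl
    refine Hoare.loop_count J M ?_ ?_ ⟨by simp, fun v => by simp [hD v]⟩
    · rintro i hi σ' hF ⟨hI, hv⟩
      have hM : σ'.nat regArcs 0 = M := by
        rw [hF.nat _ (by simp [Prog.natMods])]; simpa using hE.arcs
      have hK : σ'.nat regK 0 = k + 1 := by
        rw [hF.nat _ (by simp [Prog.natMods])]; simpa using hk
      have ht : σ'.nat arrTail i = G.fst ⟨i, hi⟩ := by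
        rw [hF.nat _ (by simp [Prog.natMods])]; simpa using hE.tail ⟨i, hi⟩
      have hh : σ'.nat arrHead i = G.snd ⟨i, hi⟩ := by
        rw [hF.nat _ (by simp [Prog.natMods])]; simpa using hE.head ⟨i, hi⟩
      have ha : σ'.nat arrAlive i = 1 ↔ (⟨i, hi⟩ : Fin M) ∈ S := by
        rw [hF.nat _ (by simp [Prog.natMods])]; simpa using (hS ⟨i, hi⟩).symm
      have hhead : σ'.nat arrDist (G.snd ⟨i, hi⟩) = k + 1 ↔ d (G.snd ⟨i, hi⟩) = k := by
        rw [hv]; split_ifs with h <;> lia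
      refine ⟨by simp [hI, hM, hi], Hoare.of_run (by rfl) (by simp [Prog.size]) ?_⟩
      set b := (⟨i, hi⟩ : Fin M) with hb
      by_cases hc : b ∈ S ∧ d (G.snd b) = k ∧ σ'.nat arrDist (G.fst b) = 0
      · obtain ⟨hc1, hc2, hc3⟩ := hc
        have hstep := hd.step _ _ ⟨b, hc1, rfl, rfl⟩
        have hdf : d (G.fst b) = k + 1 := by
          have h0 := hv (G.fst b)
          rw [hc3] at h0
          split_ifs at h0 with h
          push Not at h
          lia
        refine ⟨by simp [hI, hK, ht, hh, ha.2 hc1, hhead.2 hc2, hc3], fun v => ?_⟩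
        simp only [Prog.run, Test.Holds, NatExp.eval, hI, hK, ht, hh, ha.2 hc1, hhead.2 hc2, hc3,
          and_self, if_true]
        rw [State.nat_writeNat_of_ne _ _ _ (by lia), State.nat_writeNat_self]
        by_cases hvb : v = G.fst b
        · subst hvb
          rw [Function.update_self, if_pos (Or.inr ⟨hdf, b, by simp [hb], hc1, rfl, hc2⟩), hdf]
        · rw [Function.update_of_ne fun h => hvb (Fin.ext h), hv]
          refine if_congr (or_congr Iff.rfl (and_congr Iff.rfl (exists_congr fun a =>
            ⟨fun ⟨h1, h2⟩ => ⟨by lia, h2⟩, fun ⟨h1, h2, h3, h4⟩ => ⟨?_, h2, h3, h4⟩⟩))) rfl rfl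
          by_contra hai
          have : a = b := Fin.ext (by simp only [hb]; lia)
          exact hvb (by rw [← h3, this])
      · have hcond : ¬ (σ'.nat arrAlive i = 1 ∧ σ'.nat arrDist (G.snd b) = k + 1 ∧
            σ'.nat arrDist (G.fst b) = 0) := fun h => hc ⟨ha.1 h.1, hhead.1 h.2.1, h.2.2⟩
        refine ⟨?_, fun v => ?_⟩
        · simp only [Prog.run, Test.Holds, NatExp.eval, hI, hK, ht, hh, if_neg hcond]
          simp
        · simp only [Prog.run, Test.Holds, NatExp.eval, hI, hK, ht, hh, if_neg hcond]
          rw [State.nat_writeNat_of_ne _ _ _ (by lia), hv]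
          refine if_congr ⟨?_, ?_⟩ rfl rfl
          · rintro (h | ⟨h, a, h1, h2⟩)
            exacts [Or.inl h, Or.inr ⟨h, a, by lia, h2⟩]
          · rintro (h | ⟨h, a, h1, h2, h3, h4⟩)
            · exact Or.inl h
            · by_cases hai : (a : ℕ) < i
              · exact Or.inr ⟨h, a, hai, h2, h3, h4⟩
              · have hab : a = b := Fin.ext (by simp only [hb]; lia)
                subst hab
                by_contra hne
                refine hc ⟨h2, h4, ?_⟩
                rw [hv, h3, if_neg hne]
    · rintro σ' hF ⟨hI, -⟩
      have hM : σ'.nat regArcs 0 = M := by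
        rw [hF.nat _ (by simp [Prog.natMods])]; simpa using hE.arcs
      simp [hI, hM]
  · rintro σ' ⟨-, h⟩ v
    rw [h]
    refine if_congr ⟨by lia, fun hv => ?_⟩ rfl rfl
    by_cases hvk : d v ≤ k
    · exact Or.inl hvk
    · have hv' : d v = k + 1 := by lia
      obtain ⟨y, ⟨a, ha, h1, rfl⟩, hy⟩ := hd.pred v fun hvr => by
        have := (hd.zero v).2 hvr
        lia
      exact Or.inr ⟨hv', a, a.2, ha, h1, by lia⟩

lemma hoare_distances (hE : Encodes G σ) (hS : IsSet arrAlive S σ) (hd : IsDist (G.Arc S) r d)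
    (hr : (r : ℕ) = 0) (h0 : ∀ v, σ.nat arrDist v = 0) :
    Hoare distances σ (n * (6 * M + 6) + 5) (fun σ' => ∀ v : Fin n,
      σ'.nat arrDist v = d v + 1) := by
  have hn : 0 < n := r.pos
  set σ₁ := (σ.writeNat arrDist 0 1).writeNat regK 0 1 with hσ₁
  have hE₁ : Encodes G σ₁ := hE.congr (fun a ha _ => by
    rw [hσ₁]; repeat rw [State.nat_writeNat_of_ne _ _ _ (by lia)]) rfl
  have hS₁ : IsSet arrAlive S σ₁ := hS.congr (by simp [hσ₁])
  have hmul : (n - 1) * (6 * M + 6) ≤ n * (6 * M + 6) := Nat.mul_le_mul_right _ (by lia)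
  set J : ℕ → State → Prop := fun k σ' => σ'.nat regK 0 = k + 1 ∧
    ∀ v : Fin n, σ'.nat arrDist v = if d v ≤ k then d v + 1 else 0 with hJ
  refine Hoare.mono (T := 1 + 1 + (1 + 1 + ((1 + (6 * M + 3) + 1 + 1) * (n - 1) + 1)))
    (Q := J (n - 1)) ?_ (by lia) ?_
  · refine Hoare.seq (Q := fun σ' => σ' = σ.writeNat arrDist 0 1)
      (Hoare.of_run (by rfl) (by simp [Prog.size]) (by simp)) ?_
    rintro _ rfl
    refine Hoare.seq (Q := fun σ' => σ' = σ₁)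
      (Hoare.of_run (by rfl) (by simp [Prog.size]) (by simp [hσ₁])) ?_
    rintro _ rfl
    refine Hoare.loop_count J (n - 1) ?_ ?_ ⟨by simp [hσ₁], fun v => ?_⟩
    · rintro k hk σ' hF ⟨hK, hv⟩
      have hE' : Encodes G σ' := hE₁.congr (fun a ha _ => hF.nat a (by
        simp [distancePhase, Prog.natMods]; omega)) (hF.real _ (by
        simp [distancePhase, Prog.realMods]))
      have hS' : IsSet arrAlive S σ' := hS₁.congr (hF.nat _ (by
        simp [distancePhase, Prog.natMods]))
      refine ⟨by simp [hK, hE'.size]; lia, ?_⟩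
      refine (hoare_distancePhase hE' hS' hd hK hv).frame.seq ?_
      rintro σ'' ⟨h, hF'⟩
      have hK' : σ''.nat regK 0 = k + 1 := by
        rw [hF'.nat _ (by simp [distancePhase, Prog.natMods]), hK]
      exact Hoare.of_run (by rfl) (by simp [Prog.size]) ⟨by simp [hK'], by simpa using h⟩
    · rintro σ' hF ⟨hK, -⟩
      have hn' : σ'.nat arrSize 0 = n := by
        rw [hF.nat _ (by simp [distancePhase, Prog.natMods]), hE₁.size]
      simp [hK, hn']
      lia
    · have hz := hd.zero v
      have : σ₁.nat arrDist v = Function.update (σ.nat arrDist) 0 1 v := by simp [hσ₁]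
      rw [this, Function.update_apply, h0]
      have hvr : v = r ↔ (v : ℕ) = 0 := by rw [Fin.ext_iff, hr]
      rw [hvr] at hz
      split_ifs <;> lia
  · rintro σ' ⟨-, h⟩ v
    rw [h, if_pos]
    have := hd.lt_card v
    lia

end

/-! ### Exact sampling of connected subgraphs -/

/-- Output for every edge whether its direction towards the root survives. -/
def outputEdges : Prog :=
  .seq (setReg regI (.lit 0)) <|
  .loop (.natLt (reg regI) (.get arrSize (.lit 1))) <|
    .seq (.ite (.natLt (.get arrDist (.get arrHead (reg regI)))
        (.get arrDist (.get arrTail (reg regI))))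
      (.setNat arrOut (reg regI) (.get arrAlive (reg regI)))
      (.setNat arrOut (reg regI) (.get arrAlive (.add (.get arrSize (.lit 1)) (reg regI))))) <|
    setReg regI (.add (reg regI) (.lit 1))

/-- Sample a connected subgraph: sample a root-connected set of arcs in the bi-directed network,
and keep of each edge its direction towards the root. -/
def sampleConnected : Prog :=
  .seq (.seq copyEdges <| .seq linkArcs <| .seq (.setNat arrRank (.lit 0) (.lit 1)) <|
    setReg regThr (.lit 1)) <|
  .seq sample <| .seq distances outputEdges

section

variable {n m : ℕ} {G : Network (Fin n) (Fin m)} {r : Fin n} {σ : State}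

lemma hoare_outputEdges {S : Finset (Fin (m + m))} {d : Fin n → ℕ} (hE : Encodes G.doubled σ)
    (hm : σ.nat arrSize 1 = m) (hS : IsSet arrAlive S σ)
    (hd : ∀ v : Fin n, σ.nat arrDist v = d v + 1) :
    Hoare outputEdges σ (6 * m + 3)
      (fun σ' => outputSet m σ' = G.project d (S.map (arcEquiv m).toEmbedding)) := by
  have hmem : ∀ (e : Fin m) (b : Bool), (e, b) ∈ S.map (arcEquiv m).toEmbedding ↔
      σ.nat arrAlive (if b then m + e else e) = 1 := fun e b => by
    cases b
    · have := hS (Fin.castAdd m e)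
      rw [Fin.val_castAdd] at this
      rw [if_neg (by simp), ← this, ← arcEquiv_castAdd]
      exact Finset.mem_map' (arcEquiv m).toEmbedding
    · have := hS (Fin.natAdd m e)
      rw [Fin.val_natAdd] at this
      rw [if_pos rfl, ← this, ← arcEquiv_natAdd]
      exact Finset.mem_map' (arcEquiv m).toEmbedding
  have ht : ∀ x (hx : x < m), σ.nat arrTail x = G.fst ⟨x, hx⟩ := by
    suffices h : ∀ e : Fin m, σ.nat arrTail e = G.fst e from fun x hx => h ⟨x, hx⟩
    intro e
    have := hE.tail (Fin.castAdd m e)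
    simpa [Network.doubled, Network.reindex, Network.toBidirected] using this
  have hh : ∀ x (hx : x < m), σ.nat arrHead x = G.snd ⟨x, hx⟩ := by
    suffices h : ∀ e : Fin m, σ.nat arrHead e = G.snd e from fun x hx => h ⟨x, hx⟩
    intro e
    have := hE.head (Fin.castAdd m e)
    simpa [Network.doubled, Network.reindex, Network.toBidirected] using this
  set J : ℕ → State → Prop := fun k σ' => σ'.nat regI 0 = k ∧ ∀ e : Fin m, (e : ℕ) < k →
    (σ'.nat arrOut e = 1 ↔ e ∈ G.project d (S.map (arcEquiv m).toEmbedding)) with hJ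
  refine Hoare.mono (T := 1 + 1 + ((5 + 1) * m + 1)) (Q := J m) ?_ (by lia) ?_
  · refine Hoare.seq (Q := fun σ' => σ' = σ.writeNat regI 0 0)
      (Hoare.of_run (by rfl) (by simp [Prog.size]) (by simp)) ?_
    rintro _ rfl
    refine Hoare.loop_count J m ?_ ?_ ⟨by simp, fun e he => by lia⟩
    · rintro k hk σ' hF ⟨hI, hout⟩
      have hm' : σ'.nat arrSize 1 = m := by
        rw [hF.nat _ (by simp [Prog.natMods])]; simpa using hm
      have ht' : σ'.nat arrTail k = G.fst ⟨k, hk⟩ := by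
        rw [hF.nat _ (by simp [Prog.natMods])]; simpa using ht k hk
      have hh' : σ'.nat arrHead k = G.snd ⟨k, hk⟩ := by
        rw [hF.nat _ (by simp [Prog.natMods])]; simpa using hh k hk
      have hd' : ∀ v : Fin n, σ'.nat arrDist v = d v + 1 := fun v => by
        rw [hF.nat _ (by simp [Prog.natMods])]; simpa using hd v
      have ha' : σ'.nat arrAlive = σ.nat arrAlive := by
        rw [hF.nat _ (by simp [Prog.natMods])]; simp
      refine ⟨by simp [hI, hm', hk], Hoare.of_run (by rfl) (by simp [Prog.size]) ?_⟩
      have hpr := hmem ⟨k, hk⟩ (G.orient d ⟨k, hk⟩)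
      rw [← Network.mem_project] at hpr
      by_cases hlt : d (G.snd ⟨k, hk⟩) < d (G.fst ⟨k, hk⟩)
      · refine ⟨by simp [hI, ht', hh', hd', hlt], fun e he => ?_⟩
        simp only [Prog.run, Test.Holds, NatExp.eval, hI, ht', hh', hd', ha',
          add_lt_add_iff_right, hlt, if_true]
        rw [State.nat_writeNat_of_ne _ _ _ (by lia), State.nat_writeNat_self]
        by_cases hek : (e : ℕ) = k
        · obtain rfl : e = ⟨k, hk⟩ := Fin.ext hek
          rw [Function.update_self, hpr]
          simp [Network.orient, not_le.2 hlt]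
        · rw [Function.update_of_ne hek]
          exact hout e (by lia)
      · refine ⟨by simp [hI, ht', hh', hd', hlt], fun e he => ?_⟩
        simp only [Prog.run, Test.Holds, NatExp.eval, hI, ht', hh', hd', ha', hm',
          add_lt_add_iff_right, hlt, if_false]
        rw [State.nat_writeNat_of_ne _ _ _ (by lia), State.nat_writeNat_self]
        by_cases hek : (e : ℕ) = k
        · obtain rfl : e = ⟨k, hk⟩ := Fin.ext hek
          rw [Function.update_self, hpr]
          simp [Network.orient, not_lt.1 hlt]
        · rw [Function.update_of_ne hek]
          exact hout e (by lia)
    · rintro σ' hF ⟨hI, -⟩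
      have hm' : σ'.nat arrSize 1 = m := by
        rw [hF.nat _ (by simp [Prog.natMods])]; simpa using hm
      simp [hI, hm']
  · rintro σ' ⟨-, h⟩
    ext e
    rw [← h e e.2]
    simp [outputSet]

lemma isBidirected_doubled (G : Network (Fin n) (Fin m)) : G.doubled.IsBidirected := by
  refine ⟨fun a => (arcEquiv m).symm (((arcEquiv m) a).1, !((arcEquiv m) a).2), fun a => ?_,
    fun a => ?_⟩
  · simp
  · simp only [Network.doubled, Network.reindex, Network.toBidirected, Equiv.apply_symm_apply]
    cases (arcEquiv m a).2 <;> simp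

lemma rootProb_doubled (G : Network (Fin n) (Fin m)) (r : Fin n) :
    G.doubled.rootProb {r} = G.rel := by
  rw [Network.doubled, Network.rootProb_reindex, ← Network.reach_eq_rootProb,
    ← Network.rel_eq_reach]

lemma rootConn_doubled (r : Fin n) (h : G.IsConnected Finset.univ) :
    G.doubled.RootConn {r} Finset.univ := by
  rw [Network.doubled, Network.rootConn_reindex, Finset.map_univ_equiv]
  have := (Network.isConnected_iff (r := r)).1 h
  rwa [Network.bothWays, Finset.univ_product_univ] at this

open Classical in
/-- The random set of edges obtained from root-connected arcs has the right distribution. -/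
lemma ev_project (hp : ∀ e, 0 ≤ G.doubled.fail e ∧ G.doubled.fail e ≤ 1)
    (hZ : 0 < G.doubled.rootProb {r}) (D : Finset (Fin m × Bool) → Fin n → ℕ)
    (hD : ∀ S, G.toBidirected.RootConn {r} S → IsDist (G.toBidirected.Arc S) r (D S))
    {T : Finset (Fin m)} (hT : G.IsConnected T) (B : Set (Finset (Fin (m + m))))
    (hB : ∀ S, S ∈ B ↔ G.doubled.RootConn {r} S ∧ G.project (D (S.map (arcEquiv m).toEmbedding))
      (S.map (arcEquiv m).toEmbedding) = T) :
    ev (G.doubled.condPMF {r} hp hZ) (fun S => if S ∈ B then 1 else 0) =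
      ENNReal.ofReal (G.wt T / G.rel) := by
  have h1 := Network.sum_wt_project r D hD hT
  rw [← Network.sum_reindex (arcEquiv m)] at h1
  rw [← h1, Finset.sum_div, ENNReal.ofReal_sum_of_nonneg, ev_eq_sum]
  · refine Finset.sum_congr rfl fun S _ => ?_
    rw [Network.condPMF_apply, rootProb_doubled]
    have h2 := hB S
    rw [Network.doubled, Network.rootConn_reindex] at h2 ⊢
    rw [Network.wt_reindex]
    by_cases hS : S ∈ B
    · rw [if_pos hS, if_pos (h2.1 hS), if_pos (h2.1 hS).1, mul_one]
    · rw [if_neg hS, if_neg fun h => hS (h2.2 h)]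
      simp
  · intro S _
    have hZ' : 0 ≤ G.rel := by rw [← rootProb_doubled G r]; exact hZ.le
    refine div_nonneg ?_ hZ'
    split_ifs
    · rw [← Network.wt_reindex]
      exact Network.wt_nonneg hp S
    · exact le_rfl

theorem sampleConnected_spec {ε : ℝ} {q : ℝ} (hp : ∀ e, 0 ≤ G.fail e ∧ G.fail e ≤ q) (hq : q < 1)
    (hm : 0 < m) (hG : G.IsConnected Finset.univ) :
    (∀ S : Finset (Fin m), G.IsConnected S →
      haltProb sampleConnected (input G 0 ε) {σ | outputSet m σ = S} =
        ENNReal.ofReal (G.wt S / G.rel)) ∧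
    (∀ S : Finset (Fin m), ¬ G.IsConnected S →
      haltProb sampleConnected (input G 0 ε) {σ | outputSet m σ = S} = 0) ∧
    expectedTime sampleConnected (input G 0 ε) ≤
      ENNReal.ofReal (5000 * ((1 - q)⁻¹ * m ^ 2 * n)) := by
  classical
  have hn : 0 < n := (G.fst ⟨0, hm⟩).pos
  set r : Fin n := ⟨0, hn⟩ with hr
  have hp2 : ∀ e, 0 ≤ G.doubled.fail e ∧ G.doubled.fail e ≤ q := fun e => hp _
  have hp1 : ∀ e, 0 ≤ G.doubled.fail e ∧ G.doubled.fail e ≤ 1 := fun e =>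
    ⟨(hp2 e).1, (hp2 e).2.trans hq.le⟩
  have hrc := rootConn_doubled r hG
  have hZ : 0 < G.doubled.rootProb {r} :=
    Network.rootProb_pos (fun e => ⟨(hp2 e).1, (hp2 e).2.trans_lt hq⟩) hrc
  have hex : ∀ S, ∃ d, G.toBidirected.RootConn {r} S → IsDist (G.toBidirected.Arc S) r d :=
    fun S => by
      by_cases h : G.toBidirected.RootConn {r} S
      · obtain ⟨d, hd⟩ := exists_isDist (Network.rootConn_singleton.1 h)
        exact ⟨d, fun _ => hd⟩
      · exact ⟨fun _ => 0, fun h' => absurd h' h⟩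
  choose D hD using hex
  set σ₀ := input G 0 ε with hσ₀
  have hprep : Hoare (.seq copyEdges <| .seq linkArcs <| .seq (.setNat arrRank (.lit 0) (.lit 1)) <|
      setReg regThr (.lit 1)) σ₀ (1 + (14 * m + 5) + (1 + (10 * (m + m) + 3) + 3)) (fun σ =>
        Encodes G.doubled σ ∧ RootsAre {r} σ ∧ σ.nat arrSize 1 = m ∧
          ∀ v, σ.nat arrDist v = 0) := by
    refine (hoare_copyEdges G 0 ε).frame.seq ?_
    rintro σ₁ ⟨h1, hF₁⟩
    have f1 : ∀ a, (a < 4 ∨ (6 < a ∧ a ≠ 25)) → σ₁.nat a = σ₀.nat a := fun a ha => hF₁.nat a (by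
      simp [copyEdges, Prog.natMods]; omega)
    have h0 : ∀ a, 3 < a → ∀ v, σ₀.nat a v = 0 := fun a ha v => by
      have e1 : a ≠ 0 := by lia
      have e2 : a ≠ 1 := by lia
      have e3 : a ≠ 2 := by lia
      simp [hσ₀, input, e1, e2, e3]
    refine (hoare_linkArcs h1 (fun y => by rw [f1 _ (by lia), h0 _ (by lia)])
      (fun y => by rw [f1 _ (by lia), h0 _ (by lia)])).frame.seq ?_
    rintro σ₂ ⟨hE, hF₂⟩
    have f2 : ∀ a, (a < 4 ∨ (10 < a ∧ a ≠ 25)) → σ₂.nat a = σ₀.nat a := fun a ha => by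
      rw [hF₂.nat a (by simp [linkArcs, Prog.natMods]; omega), f1 a (by lia)]
    refine Hoare.of_run (by rfl) (by simp [Prog.size]) ?_
    simp only [Prog.run, NatExp.eval]
    refine ⟨hE.congr (fun a ha _ => ?_) rfl, fun v => ?_, ?_, ?_⟩
    · repeat rw [State.nat_writeNat_of_ne _ _ _ (by lia)]
    · have hv : (σ₂.writeNat arrRank 0 1).nat arrRank v = if (v : ℕ) = 0 then 1 else 0 := by
        rw [State.nat_writeNat_self, Function.update_apply, f2 _ (by lia), h0 _ (by lia)]
      rw [State.nat_writeNat_of_ne _ _ _ (by lia), hv, State.nat_writeNat_self,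
        Function.update_self, Finset.mem_singleton, Fin.ext_iff]
      simp only [hr]
      split_ifs with h <;> simp [h]
    · simp [f2, hσ₀, input]
    · intro v
      repeat rw [State.nat_writeNat_of_ne _ _ _ (by lia)]
      rw [f2 _ (by lia), h0 _ (by lia)]
  obtain ⟨σ₁, t₁, hb₁, ht₁, hE₁, hR₁, hm₁, hd₁⟩ := hprep
  have hspec : Spec sampleConnected σ₀ (G.doubled.condPMF {r} hp1 hZ)
      (fun S σ' => G.doubled.RootConn {r} S ∧ outputSet m σ' =
        G.project (D (S.map (arcEquiv m).toEmbedding)) (S.map (arcEquiv m).toEmbedding))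
      (1 + t₁ + (1 + ENNReal.ofReal (1120 * ((1 - q)⁻¹ * ((m + m : ℕ) : ℝ) ^ 2 * n)) +
        ((1 + (n * (6 * (m + m) + 6) + 5) + (6 * m + 3) : ℕ) : ℝ≥0∞))) := by
    refine Hoare.seq_spec (Q₀ := fun σ' => σ' = σ₁) ⟨σ₁, t₁, hb₁, le_rfl, rfl⟩ ?_
    rintro _ rfl
    refine ((spec_sample hp1 hZ hE₁ hR₁).frame.mono (sample_cost_le (isBidirected_doubled G) hrc
      (by simp) hp2 hq (by lia)) fun _ _ h => h).seq_hoare ?_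
    rintro S σ₂ ⟨⟨hS, hE₂, -, hS₂⟩, hF₂⟩
    have hS' : G.toBidirected.RootConn {r} (S.map (arcEquiv m).toEmbedding) := by
      rwa [Network.doubled, Network.rootConn_reindex] at hS
    have hdist : IsDist (G.doubled.Arc S) r (D (S.map (arcEquiv m).toEmbedding)) := by
      rw [Network.doubled, Network.arc_reindex]
      exact hD _ hS'
    refine (hoare_distances hE₂ hS₂ hdist rfl (by
      rw [hF₂.nat _ (sample_natMods (by lia))]; exact hd₁)).frame.seq ?_
    rintro σ₃ ⟨h3, hF₃⟩
    have hE₃ : Encodes G.doubled σ₃ := hE₂.congr (fun a ha _ => hF₃.nat a (by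
      simp [distances, distancePhase, Prog.natMods]; omega)) (hF₃.real _ (by
      simp [distances, distancePhase, Prog.realMods]))
    have hS₃ : IsSet arrAlive S σ₃ := hS₂.congr (hF₃.nat _ (by
      simp [distances, distancePhase, Prog.natMods]))
    refine (hoare_outputEdges hE₃ ?_ hS₃ h3).conseq fun σ' h => ⟨hS, h⟩
    rw [hF₃.nat _ (by simp [distances, distancePhase, Prog.natMods]),
      hF₂.nat _ (sample_natMods (by lia)), hm₁]
  refine ⟨fun T hT => ?_, fun T hT => ?_, ?_⟩
  · rw [hspec.haltProb_eq _ {S | G.doubled.RootConn {r} S ∧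
        G.project (D (S.map (arcEquiv m).toEmbedding)) (S.map (arcEquiv m).toEmbedding) = T}]
    · exact ev_project hp1 hZ D hD hT _ fun S => Iff.rfl
    · rintro S σ' ⟨h1, h2⟩
      simp [h1, h2]
  · rw [hspec.haltProb_eq _ ∅]
    · simp [ev_const]
    · rintro S σ' ⟨h1, h2⟩
      simp only [Set.mem_empty_iff_false, Set.mem_ofPred, false_iff, h2]
      rintro rfl
      rw [Network.doubled, Network.rootConn_reindex] at h1
      exact hT (Network.isConnected_project r (hD _ h1))
  · refine hspec.expectedTime_le.trans ?_
    have hq0 : 0 ≤ q := (hp ⟨0, hm⟩).1.trans (hp ⟨0, hm⟩).2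
    have hs1 : 1 ≤ (1 - q)⁻¹ := (one_le_inv₀ (by linarith)).2 (by linarith)
    have hm1 : (1 : ℝ) ≤ m := by exact_mod_cast hm
    have hn1 : (1 : ℝ) ≤ n := by exact_mod_cast hn
    have hmn : (m : ℝ) * n ≤ (1 - q)⁻¹ * m ^ 2 * n := by
      calc (m : ℝ) * n = 1 * (1 * m) * n := by ring
        _ ≤ (1 - q)⁻¹ * (m * m) * n := by gcongr
        _ = _ := by ring
    have hnm : (n : ℝ) ≤ m * n := by nlinarith
    have hmnm : (m : ℝ) ≤ m * n := by nlinarith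
    have ht₁' : (t₁ : ℝ) ≤ 14 * m + 20 * m + 13 := by
      calc (t₁ : ℝ) ≤ ((1 + (14 * m + 5) + (1 + (10 * (m + m) + 3) + 3) : ℕ) : ℝ) := by
            exact_mod_cast ht₁
        _ ≤ _ := by push_cast; linarith
    have hx0 : 0 ≤ 1120 * ((1 - q)⁻¹ * ((m + m : ℕ) : ℝ) ^ 2 * n) := by positivity
    have hy0 : 0 ≤ 5000 * ((1 - q)⁻¹ * (m : ℝ) ^ 2 * n) := by positivity
    obtain ⟨x, ex⟩ : ∃ x : NNReal, (x : ℝ) = 1120 * ((1 - q)⁻¹ * ((m + m : ℕ) : ℝ) ^ 2 * n) :=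
      ⟨⟨_, hx0⟩, rfl⟩
    obtain ⟨y, ey⟩ : ∃ y : NNReal, (y : ℝ) = 5000 * ((1 - q)⁻¹ * (m : ℝ) ^ 2 * n) :=
      ⟨⟨_, hy0⟩, rfl⟩
    rw [← ex, ← ey, ENNReal.ofReal_coe_nnreal, ENNReal.ofReal_coe_nnreal]
    have key : 1 + (t₁ : NNReal) + (1 + x +
        ((1 + (n * (6 * (m + m) + 6) + 5) + (6 * m + 3) : ℕ) : NNReal)) ≤ y := by
      rw [← NNReal.coe_le_coe]
      push_cast at ex ⊢
      rw [ex, ey]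
      nlinarith
    refine le_trans (le_of_eq ?_) (ENNReal.coe_le_coe.2 key)
    push_cast
    ring

end

lemma ready_of_copy {n m M : ℕ} {G : Network (Fin n) (Fin m)} {G' : Network (Fin n) (Fin M)}
    {r : Fin n} {ε : ℝ} {pre : Prog} {T : ℕ} (h : Hoare pre (input G r ε) T (HasArcs G'))
    (hn : ∀ a ∈ pre.natMods, a = 4 ∨ a = 5 ∨ a = 6 ∨ a = 25) (hr : ∀ a ∈ pre.realMods, a = 2) :
    Hoare pre (input G r ε) T (Ready G' r ε) := by
  refine h.frame.conseq ?_
  rintro σ ⟨hG, hF⟩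
  have h0 : ∀ a, (a = 7 ∨ a = 9 ∨ a = 11) → ∀ v, σ.nat a v = 0 := fun a ha v => by
    rw [hF.nat a fun h => by have := hn a h; lia]
    rcases ha with rfl | rfl | rfl <;> simp [input]
  refine ⟨hG, ?_, ?_, h0 _ (by lia), h0 _ (by lia), h0 _ (by lia)⟩
  · rw [hF.nat _ fun h => by have := hn _ h; lia]
    simp [input]
  · rw [hF.real _ fun h => by have := hr _ h; lia]
    simp [input]

/-- The cost of counting, with `e = 1 / ε`, `p = 1 / (1 - pmax)`, and `M ≤ 2 m` arcs. -/
lemma count_cost_le {e p m n t M : ℝ} (he : 1 ≤ e) (hp : 1 ≤ p) (hm : 1 ≤ m) (hn : 1 ≤ n)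
    (ht : t ≤ 20 * m) (hM0 : 0 ≤ M) (hM : M ≤ 2 * m) :
    t + 104000 * (e ^ 2 * p ^ 2 * M ^ 2 * n ^ 3) ≤ 500000 * (e ^ 2 * p ^ 3 * m ^ 2 * n ^ 3) := by
  have h1 : e ^ 2 * p ^ 2 * M ^ 2 * n ^ 3 ≤ 4 * (e ^ 2 * p ^ 3 * m ^ 2 * n ^ 3) := by
    calc _ ≤ e ^ 2 * p ^ 3 * (2 * m) ^ 2 * n ^ 3 := by
          gcongr
          norm_num
      _ = _ := by ring
  have h2 : m ≤ e ^ 2 * p ^ 3 * m ^ 2 * n ^ 3 := by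
    calc m = 1 ^ 2 * 1 ^ 3 * (1 * m) * 1 ^ 3 := by ring
      _ ≤ e ^ 2 * p ^ 3 * (m * m) * n ^ 3 := by gcongr
      _ = _ := by ring
  linarith

end NetRel

/-! ### Reliability and reachability -/

open NetRel in
theorem theorem1 :
    -- counting, for all-terminal reliability of undirected networks
    (∃ (P : Prog) (C : ℝ), ∀ (n m : ℕ) (G : Network (Fin n) (Fin m)) (ε : ℝ),
      0 < m → (∀ e, 0 ≤ G.fail e ∧ G.fail e < 1) → 0 < ε → ε ≤ 1 →
        3 / 4 ≤ haltProb P (input G 0 ε) (approximates G.rel ε) ∧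
        expectedTime P (input G 0 ε) ≤
          ENNReal.ofReal (C * (ε⁻¹ ^ 2 * (1 - G.pmax)⁻¹ ^ 3 * (m : ℝ) ^ 2 * (n : ℝ) ^ 3))) ∧
    -- counting, for reachability in bi-directed networks
    (∃ (P : Prog) (C : ℝ), ∀ (n m : ℕ) (G : Network (Fin n) (Fin m)) (r : Fin n) (ε : ℝ),
      0 < m → G.IsBidirected → (∀ e, 0 ≤ G.fail e ∧ G.fail e < 1) → 0 < ε → ε ≤ 1 →
        3 / 4 ≤ haltProb P (input G r ε) (approximates (G.reach r) ε) ∧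
        expectedTime P (input G r ε) ≤
          ENNReal.ofReal (C * (ε⁻¹ ^ 2 * (1 - G.pmax)⁻¹ ^ 3 * (m : ℝ) ^ 2 * (n : ℝ) ^ 3))) ∧
    -- the equivalence of the two problems
    (∀ (n m : ℕ) (G : Network (Fin n) (Fin m)) (r : Fin n),
      (∀ e, 0 ≤ G.fail e ∧ G.fail e ≤ 1) → G.rel = G.toBidirected.reach r) ∧
    -- exact sampling of connected subgraphs
    (∃ (P : Prog) (C : ℝ), ∀ (n m : ℕ) (G : Network (Fin n) (Fin m)),
      0 < m → (∀ e, 0 ≤ G.fail e ∧ G.fail e < 1) → G.IsConnected Finset.univ →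
        (∀ S : Finset (Fin m), G.IsConnected S →
          haltProb P (input G 0 0) {σ | outputSet m σ = S} = ENNReal.ofReal (G.wt S / G.rel)) ∧
        (∀ S : Finset (Fin m), ¬ G.IsConnected S →
          haltProb P (input G 0 0) {σ | outputSet m σ = S} = 0) ∧
        expectedTime P (input G 0 0) ≤
          ENNReal.ofReal (C * ((1 - G.pmax)⁻¹ * (m : ℝ) ^ 2 * (n : ℝ)))) := by
  have hpmax : ∀ {n m : ℕ} (G : Network (Fin n) (Fin m)), 0 < m →
      (∀ e, 0 ≤ G.fail e ∧ G.fail e < 1) →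
      (∀ e, 0 ≤ G.fail e ∧ G.fail e ≤ G.pmax) ∧ G.pmax < 1 ∧ 1 ≤ (1 - G.pmax)⁻¹ := by
    intro n m G hm hp
    have hle : ∀ e, G.fail e ≤ G.pmax := fun e => le_ciSup (Set.finite_range _).bddAbove e
    have : Nonempty (Fin m) := ⟨⟨0, hm⟩⟩
    have hlt : G.pmax < 1 := by
      obtain ⟨e, he⟩ := exists_eq_ciSup_of_finite (f := G.fail)
      rw [Network.pmax, ← he]
      exact (hp e).2
    have h0 := (hp ⟨0, hm⟩).1.trans (hle ⟨0, hm⟩)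
    exact ⟨fun e => ⟨(hp e).1, hle e⟩, hlt, (one_le_inv₀ (by linarith)).2 (by linarith)⟩
  refine ⟨⟨countFrom copyEdges, 500000, ?_⟩, ⟨countFrom copyArcs, 500000, ?_⟩, ?_,
    ⟨sampleConnected, 5000, ?_⟩⟩
  · intro n m G ε hm hp hε hε1
    obtain ⟨hp', hq, hq1⟩ := hpmax G hm hp
    have hn : 0 < n := (G.fst ⟨0, hm⟩).pos
    have hpre : Hoare copyEdges (input G 0 ε) (14 * m + 5) (Ready G.doubled ⟨0, hn⟩ ε) :=
      ready_of_copy (r := ⟨0, hn⟩) (hoare_copyEdges G 0 ε) (by simp [copyEdges, Prog.natMods])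
        (by simp [copyEdges, Prog.realMods])
    have := count_spec hpre (isBidirected_doubled G) (q := G.pmax) (fun e => hp' _) hq (by lia)
      hε hε1
    rw [rootProb_doubled] at this
    refine ⟨this.1, this.2.trans (ENNReal.ofReal_le_ofReal ?_)⟩
    have hm1 : (1 : ℝ) ≤ m := by exact_mod_cast hm
    exact count_cost_le ((one_le_inv₀ hε).2 hε1) hq1 hm1 (by exact_mod_cast hn)
      (by push_cast; linarith) (by positivity) (by push_cast; linarith)
  · intro n m G r ε hm hbi hp hε hε1
    obtain ⟨hp', hq, hq1⟩ := hpmax G hm hp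
    have hn : 0 < n := r.pos
    have hpre : Hoare copyArcs (input G r ε) (8 * m + 5) (Ready G r ε) :=
      ready_of_copy (hoare_copyArcs G r ε) (by simp [copyArcs, Prog.natMods])
        (by simp [copyArcs, Prog.realMods])
    have := count_spec hpre hbi (q := G.pmax) hp' hq hm hε hε1
    rw [← Network.reach_eq_rootProb] at this
    refine ⟨this.1, this.2.trans (ENNReal.ofReal_le_ofReal ?_)⟩
    have hm1 : (1 : ℝ) ≤ m := by exact_mod_cast hm
    exact count_cost_le ((one_le_inv₀ hε).2 hε1) hq1 hm1 (by exact_mod_cast hn)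
      (by push_cast; linarith) (by positivity) (by linarith)
  · intro n m G r _
    exact Network.rel_eq_reach G r
  · intro n m G hm hp hG
    obtain ⟨hp', hq, -⟩ := hpmax G hm hp
    exact sampleConnected_spec hp' hq hm hG
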